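/- \textbf{Setting.} Let $M$ be a smooth (Hausdorff, finite-dimensional) manifold and let $(\mathfrak g,\mathfrak h,dt,d\alpha)$ be a differential crossed module of finite-dimensional real Lie algebras: $dt:\mathfrak h\to\mathfrak g$ and $d\alpha:\mathfrak g\to\mathrm{Der}(\mathfrak h)$ are Lie algebra homomorphisms with $dt(d\alpha(x)(y))=[x,dt(y)]$ and $d\alpha(dt(y))(y')=[y,y']$. Let $A\in\Omega^1(M,\mathfrak g)$, $B\in\Omega^2(M,\mathfrak h)$, and put $F_A=dA+\tfrac12A^a\wedge A^b[T_a,T_b]$, $\mathbf d_Aa=da+A^a\wedge d\alpha(T_a)(a)$ for $a\in\Omega^1(M,\mathfrak h)$ ($T_a$ a basis of $\mathfrak g$), and $\tilde F=F_A+dt(B)$ (the fake curvature). For $s,t\in M$ let $\mathcal P_s^t(M)$ be the space of smooth paths $X:[0,1]\to M$ which are constantly $s$ near $0$ and constantly $t$ near $1$. For an $\mathfrak h$-valued $(k+1)$-form $\eta$ let \[ \oint_A(\eta)_X(D_1,\dots,D_k)=\int_0^1 U_\sigma\bigl(\eta_{X(\sigma)}(X'(\sigma),D_1(\sigma),\dots,D_k(\sigma))\bigr)\,d\sigma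 , \] a $k$-form on path space, where $D_1,\dots,D_k$ are vector fields along $X$ and $U_\sigma\in\mathrm{End}(\mathfrak h)$ is the parallel transport along $X$ from $X(\sigma)$ to $X(1)$, \[ U_\sigma=\sum_{n\ge0}(-1)^n\int_{\sigma<\sigma_1<\dots<\sigma_n<1}d\alpha(A(X'(\sigma_n)))\circ\dots\circ d\alpha(A(X'(\sigma_1)))\,d\sigma_1\cdots d\sigma_n . \] The standard connection 1-form on path space is $\mathcal A_{(A,B)}=\oint_A(B)$. Its holonomy along a smooth curve $\Sigma:[0,1]\to\mathcal P_s^t(M)$ is $\mathcal W_{\mathcal A_{(A,B)}}(\Sigma)=\mathrm P\exp\int_\Sigma\mathcal A_{(A,B)}$, with factors at higher parameter value to the right; products are formed in a unital associative real Banach algebra in which $\mathfrak h$ is faithfully represented as a Lie algebra with the commutator bracket (for example a matrix algebra). For $a\in\Omega^1(M,\mathfrak h)$ and $\epsilon\in\mathbb R$ the infinitesimal path space gauge transform of the holonomy is \[ \mathcal W^{a,\epsilon}(\Sigma)=\Bigl(1-\epsilon\oint_A(a)\Bigr)_{\Sigma(0)}\mathcal W_{\mathcal A_{(A,B)}}(\Sigma)\Bigl(1+\epsilon\oint_A(a)\Bigr)_{\Sigma(1)}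 . \] We say that $a$ \emph{acts by the standard transformation} if for all $s,t\in M$ and all smooth curves $\Sigma$ in $\mathcal P_s^t(M)$ \[ \mathcal W^{a,\epsilon}(\Sigma)=\mathcal W_{\mathcal A_{(A+\epsilon\,dt(a),\;B-\epsilon\,\mathbf d_Aa)}}(\Sigma)+O(\epsilon^2)\qquad(\epsilon\to0), \] and that $a$ \emph{gives a standard connection} if there is a family $(A_\epsilon,B_\epsilon)_{\epsilon\in\mathbb R}$, $A_\epsilon\in\Omega^1(M,\mathfrak g)$, $B_\epsilon\in\Omega^2(M,\mathfrak h)$, depending on $\epsilon$ in any way, with $\mathcal W^{a,\epsilon}(\Sigma)=\mathcal W_{\mathcal A_{(A_\epsilon,B_\epsilon)}}(\Sigma)+o(\epsilon)$ for all $s,t\in M$ and all smooth curves $\Sigma$ in $\mathcal P_s^t(M)$. Call $\mathcal A_{(A,B)}$ \emph{strictly r-flat} if $\tilde F=0$. \textbf{Proposition.} \begin{enumerate} \item If $\mathcal A_{(A,B)}$ is strictly r-flat, then every $a\in\Omega^1(M,\mathfrak h)$ acts by the standard transformation. \item Every $a\in\Omega^1(M,\mathfrak h)$ acts by the standard transformation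 if and only if $\tilde F$ acts trivially on $\mathfrak h$, i.e. $d\alpha(\tilde F(u,v))=0$ for all tangent vectors $u,v$ at a common point of $M$. If $\tilde F$ does not act trivially on $\mathfrak h$, there is an $a\in\Omega^1(M,\mathfrak h)$ which does not give a standard connection. \item Suppose that $d\alpha$ is injective. Then every $a\in\Omega^1(M,\mathfrak h)$ acts by the standard transformation if and only if $\mathcal A_{(A,B)}$ is strictly r-flat; and if $\mathcal A_{(A,B)}$ is not strictly r-flat, there is an $a\in\Omega^1(M,\mathfrak h)$ which does not give a standard connection. \end{enumerate} -/

import Mathlib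

open scoped Manifold ContDiff Topology
open Set Filter Asymptotics

noncomputable section

/-- A finite-dimensional real Lie algebra, together with an auxiliary norm (all norms on it are
equivalent, and the bracket is automatically continuous). -/
class FinDimLieAlgebra (L : Type*) extends
    NormedAddCommGroup L, LieRing L, NormedSpace ℝ L, LieAlgebra ℝ L where
  finiteDimensional' : FiniteDimensional ℝ L

instance {L : Type*} [FinDimLieAlgebra L] : FiniteDimensional ℝ L :=
  FinDimLieAlgebra.finiteDimensional'

/-- The Lie bracket as a continuous bilinear map. -/
def bracketCLM (L : Type*) [FinDimLieAlgebra L] : L →L[ℝ] L →L[ℝ] L :=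
  (LinearMap.mk₂ ℝ (fun x y : L => ⁅x, y⁆) add_lie smul_lie lie_add
    (fun c x y => lie_smul c x y)).toContinuousBilinearMap

/-- A differential crossed module `(g, h, dt, dα)`. -/
structure DifferentialCrossedModule (g h : Type*) [FinDimLieAlgebra g] [FinDimLieAlgebra h] where
  dt : h →ₗ⁅ℝ⁆ g
  dα : g →ₗ⁅ℝ⁆ LieDerivation ℝ h h
  equivariance : ∀ (x : g) (y : h), dt (dα x y) = ⁅x, dt y⁆
  peiffer : ∀ y y' : h, dα (dt y) y' = ⁅y, y'⁆

namespace DifferentialCrossedModule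
variable {g h : Type*} [FinDimLieAlgebra g] [FinDimLieAlgebra h]

/-- `dt` as a continuous linear map. -/
def dtCLM (C : DifferentialCrossedModule g h) : h →L[ℝ] g :=
  LinearMap.toContinuousLinearMap (C.dt : h →ₗ[ℝ] g)

/-- The action `(x, y) ↦ dα(x)(y)` as a continuous bilinear map. -/
def dαCLM (C : DifferentialCrossedModule g h) : g →L[ℝ] h →L[ℝ] h :=
  (LinearMap.mk₂ ℝ (fun (x : g) (y : h) => C.dα x y) (by simp) (by simp) (by simp)
    (by simp)).toContinuousBilinearMap
end DifferentialCrossedModule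

section
variable {T V₁ V₂ V₃ : Type*} [AddCommGroup T] [Module ℝ T] [TopologicalSpace T]
  [NormedAddCommGroup V₁] [NormedSpace ℝ V₁]
  [NormedAddCommGroup V₂] [NormedSpace ℝ V₂]
  [NormedAddCommGroup V₃] [NormedSpace ℝ V₃]

theorem oneForm_add (a : T [⋀^Fin 1]→L[ℝ] V₁) (x y : T) : a ![x + y] = a ![x] + a ![y] := by
  have hu : ∀ z : T, Function.update (![0] : Fin 1 → T) 0 z = ![z] := fun z => by
    ext i; fin_cases i; simp
  have := a.map_update_add ![0] 0 x y
  rwa [hu, hu, hu] at this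

theorem oneForm_smul (a : T [⋀^Fin 1]→L[ℝ] V₁) (c : ℝ) (x : T) : a ![c • x] = c • a ![x] := by
  have hu : ∀ z : T, Function.update (![0] : Fin 1 → T) 0 z = ![z] := fun z => by
    ext i; fin_cases i; simp
  have := a.map_update_smul ![0] 0 c x
  rwa [hu, hu] at this

/-- The wedge product of two alternating 1-forms along a bilinear map `β`:
`(u, v) ↦ β (a u) (b v) - β (a v) (b u)`. -/
def wedge11 (β : V₁ →L[ℝ] V₂ →L[ℝ] V₃) (a : T [⋀^Fin 1]→L[ℝ] V₁) (b : T [⋀^Fin 1]→L[ℝ] V₂) :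
    T [⋀^Fin 2]→L[ℝ] V₃ where
  toFun v := β (a ![v 0]) (b ![v 1]) - β (a ![v 1]) (b ![v 0])
  map_update_add' v i x y := by
    revert i
    rw [Fin.forall_fin_two]
    constructor <;>
    simp [oneForm_add] <;> abel
  map_update_smul' v i c x := by
    revert i
    rw [Fin.forall_fin_two]
    constructor <;> simp [oneForm_smul, smul_sub]
  map_eq_zero_of_eq' v i j hv hij := by
    have h01 : v 0 = v 1 := by
      fin_cases i <;> fin_cases j <;> simp_all
    simp [h01]
  cont := by
    have hv : ∀ i : Fin 2, Continuous fun v : Fin 2 → T => (![v i] : Fin 1 → T) := fun i =>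
      continuous_pi fun j => by fin_cases j; exact continuous_apply i
    have ha : ∀ i : Fin 2, Continuous fun v : Fin 2 → T => a ![v i] := fun i => a.cont.comp (hv i)
    have hb : ∀ i : Fin 2, Continuous fun v : Fin 2 → T => b ![v i] := fun i => b.cont.comp (hv i)
    show Continuous fun v : Fin 2 → T => β (a ![v 0]) (b ![v 1]) - β (a ![v 1]) (b ![v 0])
    exact ((β.continuous.comp (ha 0)).clm_apply (hb 1)).sub ((β.continuous.comp (ha 1)).clm_apply (hb 0))

theorem wedge11_comp {T' : Type*} [AddCommGroup T'] [Module ℝ T'] [TopologicalSpace T']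
    (β : V₁ →L[ℝ] V₂ →L[ℝ] V₃) (a : T [⋀^Fin 1]→L[ℝ] V₁) (b : T [⋀^Fin 1]→L[ℝ] V₂)
    (L : T' →L[ℝ] T) : (wedge11 β a b).compContinuousLinearMap L =
      wedge11 β (a.compContinuousLinearMap L) (b.compContinuousLinearMap L) := by
  have hL : ∀ z : T', (L ∘ ![z] : Fin 1 → T) = ![L z] := fun z => by
    ext i; fin_cases i; rfl
  refine ContinuousAlternatingMap.ext fun v => ?_
  show β (a ![L (v 0)]) (b ![L (v 1)]) - β (a ![L (v 1)]) (b ![L (v 0)]) =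
    β (a (L ∘ ![v 0])) (b (L ∘ ![v 1])) - β (a (L ∘ ![v 1])) (b (L ∘ ![v 0]))
  simp only [hL]

end

section
variable {E : Type*} [NormedAddCommGroup E] [NormedSpace ℝ E]
  {V₁ V₂ V₃ : Type*}  [NormedAddCommGroup V₁] [NormedSpace ℝ V₁]
  [NormedAddCommGroup V₂] [NormedSpace ℝ V₂]
  [NormedAddCommGroup V₃] [NormedSpace ℝ V₃]

@[simp]
theorem wedge11_apply (β : V₁ →L[ℝ] V₂ →L[ℝ] V₃) (a : E [⋀^Fin 1]→L[ℝ] V₁)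
    (b : E [⋀^Fin 1]→L[ℝ] V₂) (v : Fin 2 → E) :
    wedge11 β a b v = β (a ![v 0]) (b ![v 1]) - β (a ![v 1]) (b ![v 0]) := rfl

theorem contDiffOn_wedge11 (β : V₁ →L[ℝ] V₂ →L[ℝ] V₃) {s : Set E}
   {a : E → E [⋀^Fin 1]→L[ℝ] V₁} {b : E → E [⋀^Fin 1]→L[ℝ] V₂} (ha : ContDiffOn ℝ ∞ a s)
    (hb : ContDiffOn ℝ ∞ b s) : ContDiffOn ℝ ∞ (fun y => wedge11 β (a y) (b y)) s := by
  let W : (E [⋀^Fin 1]→L[ℝ] V₁) →L[ℝ] (E [⋀^Fin 1]→L[ℝ] V₂) →L[ℝ] (E [⋀^Fin 2]→L[ℝ] V₃) :=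
    LinearMap.mkContinuous₂ (LinearMap.mk₂ ℝ (wedge11 β)
      (fun a a' b => by ext v; simp; abel)
      (fun c a b => by ext v; simp [smul_sub])
      (fun a b b' => by ext v; simp; abel)
      (fun c a b => by ext v; simp [smul_sub])) (2 * ‖β‖) (by
        intro a b
        refine ContinuousAlternatingMap.opNorm_le_bound _ (by positivity) fun v => ?_
        have h1 : ∀ i, ‖a ![v i]‖ ≤ ‖a‖ * ‖v i‖ := fun i => by simpa using a.le_opNorm ![v i]
        have h2 : ∀ i, ‖b ![v i]‖ ≤ ‖b‖ * ‖v i‖ := fun i => by simpa using b.le_opNorm ![v i]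
        have h3 : ∀ i j, ‖β (a ![v i]) (b ![v j])‖ ≤ ‖β‖ * (‖a‖ * ‖v i‖) * (‖b‖ * ‖v j‖) :=
          fun i j => (β.le_opNorm₂ _ _).trans (by gcongr; exacts [h1 i, h2 j])
        show ‖β (a ![v 0]) (b ![v 1]) - β (a ![v 1]) (b ![v 0])‖ ≤ _
        refine (norm_sub_le _ _).trans ((add_le_add (h3 0 1) (h3 1 0)).trans (le_of_eq ?_))
        rw [Fin.prod_univ_two]; ring)
  exact W.isBoundedBilinearMap.contDiff.comp_contDiffOn (ha.prodMk hb)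
end

section
variable {E M V : Type*} [NormedAddCommGroup E] [NormedSpace ℝ E] [TopologicalSpace M]
  [ChartedSpace E M] [NormedAddCommGroup V] [NormedSpace ℝ V] {k : ℕ}

/-- The pullback of a field of alternating forms on `M` along the inverse of the chart at `x₀`. -/
def chartRep (η : ∀ x : M, TangentSpace 𝓘(ℝ, E) x [⋀^Fin k]→L[ℝ] V) (x₀ : M) (y : E) :
    E [⋀^Fin k]→L[ℝ] V :=
  (η ((extChartAt 𝓘(ℝ, E) x₀).symm y)).compContinuousLinearMap
    (mfderiv 𝓘(ℝ, E) 𝓘(ℝ, E) (extChartAt 𝓘(ℝ, E) x₀).symm y)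

/-- A field of alternating forms is smooth if its pullbacks along all inverse charts are. -/
def IsSmoothForm (η : ∀ x : M, TangentSpace 𝓘(ℝ, E) x [⋀^Fin k]→L[ℝ] V) : Prop :=
  ∀ x₀ : M, ContDiffOn ℝ ∞ (chartRep η x₀) (extChartAt 𝓘(ℝ, E) x₀).target

/-- The exterior derivative, computed at each point `x` in the chart at `x`. -/
def exteriorDeriv (η : ∀ x : M, TangentSpace 𝓘(ℝ, E) x [⋀^Fin k]→L[ℝ] V) (x : M) :
    TangentSpace 𝓘(ℝ, E) x [⋀^Fin (k + 1)]→L[ℝ] V :=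
  (extDeriv (chartRep η x) (extChartAt 𝓘(ℝ, E) x x)).compContinuousLinearMap
    (mfderiv 𝓘(ℝ, E) 𝓘(ℝ, E) (extChartAt 𝓘(ℝ, E) x) x)

/-- In every chart the exterior derivative is the exterior derivative of the chart pullback. -/
theorem chartRep_exteriorDeriv [IsManifold 𝓘(ℝ, E) ∞ M]
    {η : ∀ x : M, TangentSpace 𝓘(ℝ, E) x [⋀^Fin k]→L[ℝ] V} (hη : IsSmoothForm η) (x₀ : M) {y : E}
    (hy : y ∈ (extChartAt 𝓘(ℝ, E) x₀).target) :
    chartRep (exteriorDeriv η) x₀ y = extDeriv (chartRep η x₀) y := by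
  set φ₀ := extChartAt 𝓘(ℝ, E) x₀ with hφ₀
  set x : M := φ₀.symm y with hx
  set φ := extChartAt 𝓘(ℝ, E) x with hφ
  let ηE : M → E [⋀^Fin k]→L[ℝ] V := η
  let f : E → E := fun z => φ (φ₀.symm z)
  have hxs : x ∈ φ.source := mem_extChartAt_source x
  have ht₀ : IsOpen φ₀.target := isOpen_extChartAt_target x₀
  have ht : IsOpen φ.target := isOpen_extChartAt_target x
  have hcont : ContinuousOn φ₀.symm φ₀.target := continuousOn_extChartAt_symm x₀
  have hsm₀ : ∀ z ∈ φ₀.target, MDifferentiableAt 𝓘(ℝ, E) 𝓘(ℝ, E) φ₀.symm z := fun z hz =>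
    ((contMDiffOn_extChartAt_symm (n := ∞) x₀).contMDiffAt (ht₀.mem_nhds hz)).mdifferentiableAt
      (by simp)
  have hsm : ∀ z ∈ φ.target, MDifferentiableAt 𝓘(ℝ, E) 𝓘(ℝ, E) φ.symm z := fun z hz =>
    ((contMDiffOn_extChartAt_symm (n := ∞) x).contMDiffAt (ht.mem_nhds hz)).mdifferentiableAt
      (by simp)
  have hop : IsOpen φ.source := isOpen_extChartAt_source x
  have hev : ∀ᶠ z in 𝓝 y, z ∈ φ₀.target ∧ φ₀.symm z ∈ φ.source :=
    Filter.Eventually.and (ht₀.mem_nhds hy)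
      ((hcont.continuousAt (ht₀.mem_nhds hy)).preimage_mem_nhds (hop.mem_nhds hxs))
  have hφm : ∀ p ∈ φ.source, ContMDiffAt 𝓘(ℝ, E) 𝓘(ℝ, E) ∞ φ p := fun p hp =>
    contMDiffAt_extChartAt' (by simpa [hφ] using hp)
  have hfc : ∀ z, z ∈ φ₀.target ∧ φ₀.symm z ∈ φ.source → ContMDiffAt 𝓘(ℝ, E) 𝓘(ℝ, E) ∞ f z :=
    fun z hz => (hφm _ hz.2).comp z
      ((contMDiffOn_extChartAt_symm (n := ∞) x₀).contMDiffAt (ht₀.mem_nhds hz.1))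
  have hyy : y ∈ φ₀.target ∧ φ₀.symm y ∈ φ.source := ⟨hy, hxs⟩
  have key : chartRep η x₀ =ᶠ[𝓝 y]
      fun z => (chartRep η x (f z)).compContinuousLinearMap (fderiv ℝ f z) := by
    filter_upwards [hev] with z hz
    have hfz : f z ∈ φ.target := φ.map_source hz.2
    have hinv : φ.symm (f z) = φ₀.symm z := φ.left_inv hz.2
    have hcomp : (mfderiv 𝓘(ℝ, E) 𝓘(ℝ, E) φ.symm (f z) : E →L[ℝ] E) ∘L fderiv ℝ f z
        = (mfderiv 𝓘(ℝ, E) 𝓘(ℝ, E) φ₀.symm z : E →L[ℝ] E) := by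
      refine (congrArg (fun L : E →L[ℝ] E => (mfderiv 𝓘(ℝ, E) 𝓘(ℝ, E) φ.symm (f z) :
        E →L[ℝ] E).comp L) (mfderiv_eq_fderiv (f := f) (x := z)).symm).trans ?_
      refine (mfderiv_comp z (hsm _ hfz) ((hfc z hz).mdifferentiableAt (by simp))).symm.trans ?_
      refine Filter.EventuallyEq.mfderiv_eq ?_
      have : ∀ᶠ w in 𝓝 z, φ₀.symm w ∈ φ.source :=
        (hcont.continuousAt (ht₀.mem_nhds hz.1)).preimage_mem_nhds (hop.mem_nhds hz.2)
      filter_upwards [this] with w hw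
      exact φ.left_inv hw
    show (ηE (φ₀.symm z)).compContinuousLinearMap
        (mfderiv 𝓘(ℝ, E) 𝓘(ℝ, E) φ₀.symm z : E →L[ℝ] E) =
      ((ηE (φ.symm (f z))).compContinuousLinearMap
        (mfderiv 𝓘(ℝ, E) 𝓘(ℝ, E) φ.symm (f z) : E →L[ℝ] E)).compContinuousLinearMap (fderiv ℝ f z)
    rw [hinv, ← hcomp]
    rfl
  have hd : DifferentiableAt ℝ (chartRep η x) (f y) :=
    ((hη x).contDiffAt (ht.mem_nhds (φ.map_source hxs))).differentiableAt (by simp)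
  have hfy : ContDiffAt ℝ ∞ f y := (hfc y hyy).contDiffAt
  rw [key.extDeriv_eq, extDeriv_pullback hd hfy (by
    rw [minSmoothness_of_isRCLikeNormedField]; exact WithTop.coe_le_coe.2 le_top)]
  have hcomp2 : fderiv ℝ f y = (mfderiv 𝓘(ℝ, E) 𝓘(ℝ, E) φ x : E →L[ℝ] E) ∘L
      (mfderiv 𝓘(ℝ, E) 𝓘(ℝ, E) φ₀.symm y : E →L[ℝ] E) := by
    refine (mfderiv_eq_fderiv (f := f) (x := y)).symm.trans ?_
    exact mfderiv_comp y ((hφm x hxs).mdifferentiableAt (by simp)) (hsm₀ y hy)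
  rw [hcomp2]
  rfl


theorem IsSmoothForm.exteriorDeriv [IsManifold 𝓘(ℝ, E) ∞ M]
    {η : ∀ x : M, TangentSpace 𝓘(ℝ, E) x [⋀^Fin k]→L[ℝ] V} (hη : IsSmoothForm η) :
    IsSmoothForm (exteriorDeriv η) := by
  intro x₀
  refine ContDiffOn.congr ?_ (fun y hy => chartRep_exteriorDeriv hη x₀ hy)
  have h := (hη x₀).fderiv_of_isOpen (m := ∞) (isOpen_extChartAt_target x₀) (by simp)
  exact (ContinuousAlternatingMap.alternatizeUncurryFinCLM ℝ E V).contDiff.comp_contDiffOn h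

end

/-- Smooth differential `k`-forms on the manifold `M` (modelled on `E`) with values in `V`. -/
structure DiffForm (E M V : Type*) [NormedAddCommGroup E] [NormedSpace ℝ E] [TopologicalSpace M]
    [ChartedSpace E M] [NormedAddCommGroup V] [NormedSpace ℝ V] (k : ℕ) where
  toFun : ∀ x : M, TangentSpace 𝓘(ℝ, E) x [⋀^Fin k]→L[ℝ] V
  smooth : IsSmoothForm toFun

namespace DiffForm

variable {E M V V₁ V₂ : Type*} [NormedAddCommGroup E] [NormedSpace ℝ E] [TopologicalSpace M]
  [ChartedSpace E M] [NormedAddCommGroup V] [NormedSpace ℝ V] [NormedAddCommGroup V₁]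
  [NormedSpace ℝ V₁] [NormedAddCommGroup V₂] [NormedSpace ℝ V₂] {k : ℕ}

instance : Add (DiffForm E M V k) where
  add a b := ⟨fun x => a.toFun x + b.toFun x, fun x₀ => (a.smooth x₀).add (b.smooth x₀)⟩

instance : Sub (DiffForm E M V k) where
  sub a b := ⟨fun x => a.toFun x - b.toFun x, fun x₀ => (a.smooth x₀).sub (b.smooth x₀)⟩

instance : SMul ℝ (DiffForm E M V k) where
  smul c a := ⟨fun x => c • a.toFun x, fun x₀ => (a.smooth x₀).const_smul c⟩

/-- Apply a linear map to the values of a form. -/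
def map (L : V →L[ℝ] V₁) (a : DiffForm E M V k) : DiffForm E M V₁ k where
  toFun x := L.compContinuousAlternatingMap (a.toFun x)
  smooth x₀ := (ContinuousLinearMap.compContinuousAlternatingMapCLM ℝ E V V₁
    (Fin k) L).contDiff.comp_contDiffOn (a.smooth x₀)

/-- The wedge product of two 1-forms along a bilinear map of their values. -/
def wedge (β : V₁ →L[ℝ] V₂ →L[ℝ] V) (a : DiffForm E M V₁ 1) (b : DiffForm E M V₂ 1) :
    DiffForm E M V 2 where
  toFun x := wedge11 β (a.toFun x) (b.toFun x)
  smooth x₀ := (contDiffOn_wedge11 β (a.smooth x₀) (b.smooth x₀)).congr fun _ _ =>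
    wedge11_comp β _ _ _

/-- The exterior derivative of a smooth form. -/
def d [IsManifold 𝓘(ℝ, E) ∞ M] (a : DiffForm E M V k) : DiffForm E M V (k + 1) where
  toFun := exteriorDeriv a.toFun
  smooth := a.smooth.exteriorDeriv

end DiffForm

section
variable {E M g h : Type*} [NormedAddCommGroup E] [NormedSpace ℝ E] [TopologicalSpace M]
  [ChartedSpace E M] [FinDimLieAlgebra g] [FinDimLieAlgebra h]

/-- `F_A = dA + ½ A^a ∧ A^b [T_a, T_b]`. -/
def curvature [IsManifold 𝓘(ℝ, E) ∞ M] (A : DiffForm E M g 1) : DiffForm E M g 2 :=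
  A.d + (1 / 2 : ℝ) • DiffForm.wedge (bracketCLM g) A A

/-- `d_A a = da + A^a ∧ dα(T_a)(a)` for an `h`-valued 1-form `a`. -/
def covDeriv [IsManifold 𝓘(ℝ, E) ∞ M] (C : DifferentialCrossedModule g h)
    (A : DiffForm E M g 1) (a : DiffForm E M h 1) : DiffForm E M h 2 :=
  a.d + DiffForm.wedge C.dαCLM A a

/-- A (1,2)-form on `M` with values in a differential crossed module: a `g`-valued 1-form `A` and
an `h`-valued 2-form `B`. -/
structure OneTwoForm (E M g h : Type*) [NormedAddCommGroup E] [NormedSpace ℝ E]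
    [TopologicalSpace M] [ChartedSpace E M] [FinDimLieAlgebra g] [FinDimLieAlgebra h] where
  A : DiffForm E M g 1
  B : DiffForm E M h 2

/-- The fake curvature `F_A + dt(B)`. -/
def fakeCurvature [IsManifold 𝓘(ℝ, E) ∞ M] (C : DifferentialCrossedModule g h)
    (P : OneTwoForm E M g h) : DiffForm E M g 2 :=
  curvature P.A + P.B.map C.dtCLM

/-- Strict r-flatness: the fake curvature vanishes. -/
def StrictlyRFlat [IsManifold 𝓘(ℝ, E) ∞ M] (C : DifferentialCrossedModule g h)
    (P : OneTwoForm E M g h) : Prop :=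
  ∀ x : M, (fakeCurvature C P).toFun x = 0

/-- The values of the fake curvature act trivially on `h`. -/
def FakeCurvatureActsTrivially [IsManifold 𝓘(ℝ, E) ∞ M] (C : DifferentialCrossedModule g h)
    (P : OneTwoForm E M g h) : Prop :=
  ∀ (x : M) (v : Fin 2 → TangentSpace 𝓘(ℝ, E) x), C.dα ((fakeCurvature C P).toFun x v) = 0

/-- `(A, B) ↦ (A + ε dt(a), B - ε d_A a)`. -/
def OneTwoForm.transform [IsManifold 𝓘(ℝ, E) ∞ M] (C : DifferentialCrossedModule g h)
    (P : OneTwoForm E M g h) (a : DiffForm E M h 1) (ε : ℝ) : OneTwoForm E M g h where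
  A := P.A + ε • a.map C.dtCLM
  B := P.B - ε • covDeriv C P.A a

end

section
variable {R : Type*} [NormedRing R] [NormedAlgebra ℝ R]

/-- The `n`-th iterated integral `∫_{c < y₁ < ⋯ < yₙ < x} f(y₁) ⋯ f(yₙ)` (with the usual sign
`(-1)ⁿ` and the opposite order of the parameters if `x < c`). -/
def pathExpTerm (f : ℝ → R) (c : ℝ) : ℕ → ℝ → R
  | 0, _ => 1
  | n + 1, x => ∫ y in c..x, pathExpTerm f c n y * f y

/-- The path-ordered exponential `P exp ∫_c^x f`, the sum of all iterated integrals. For `c ≤ x`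
factors at higher parameter value stand to the right; for `x ≤ c` it is the inverse
of `P exp ∫_x^c f`. -/
def pathExp (f : ℝ → R) (c x : ℝ) : R := ∑' n, pathExpTerm f c n x

end

section
variable {E M g h : Type*} [NormedAddCommGroup E] [NormedSpace ℝ E] [TopologicalSpace M]
  [ChartedSpace E M] [FinDimLieAlgebra g] [FinDimLieAlgebra h]

/-- The velocity of a curve in `M`. -/
def velocity (X : ℝ → M) (σ : ℝ) : TangentSpace 𝓘(ℝ, E) (X σ) :=
  mfderiv 𝓘(ℝ, ℝ) 𝓘(ℝ, E) X σ (1 : ℝ)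

variable (E) in
/-- The based parametrized path space from `s` to `t`: smooth paths `[0,1] → M` which are constant
near both end points. Such a path extends smoothly to `ℝ`; only its values on `[0,1]` matter. -/
def IsPath (s t : M) (X : ℝ → M) : Prop :=
  ContMDiff 𝓘(ℝ, ℝ) 𝓘(ℝ, E) ∞ X ∧ (∀ᶠ σ in 𝓝 (0 : ℝ), X σ = s) ∧ (∀ᶠ σ in 𝓝 (1 : ℝ), X σ = t)

variable (E) in
/-- Smooth curves `τ ↦ S τ`, `τ ∈ [0,1]`, in the based path space from `s` to `t`. -/
def IsPathSpaceCurve (s t : M) (S : ℝ → ℝ → M) : Prop :=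
  ContMDiff 𝓘(ℝ, ℝ × ℝ) 𝓘(ℝ, E) ∞ (Function.uncurry S) ∧ ∀ τ ∈ Icc (0 : ℝ) 1, IsPath E s t (S τ)

/-- Parallel transport in `h` along the path `X` from `X σ` to `X 1`. With
`W = P exp ∫_{X|σ..1} A` this is the operator `α(W⁻¹)`, i.e. the series
`∑ₙ ∮_{X|σ..1} (-A^{a₁}, …, -A^{aₙ}) dα(T_{aₙ}) ∘ ⋯ ∘ dα(T_{a₁})`. -/
def transport (C : DifferentialCrossedModule g h) (A : DiffForm E M g 1) (X : ℝ → M) (σ : ℝ) :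
    h →L[ℝ] h :=
  pathExp (fun y => C.dαCLM (A.toFun (X y) ![velocity X y])) 1 σ

/-- The path space `k`-form `∮_A(η)` of an `h`-valued `(k+1)`-form `η` at the path `X`, evaluated
on `k` vector fields `D i` along `X`: contract `η` with the velocity of `X`, transport to the end
of the path and integrate. -/
def chenForm (C : DifferentialCrossedModule g h) (A : DiffForm E M g 1) {k : ℕ}
    (η : DiffForm E M h (k + 1)) (X : ℝ → M)
    (D : Fin k → ∀ σ : ℝ, TangentSpace 𝓘(ℝ, E) (X σ)) : h :=
  ∫ σ in (0 : ℝ)..1, transport C A X σ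
    (η.toFun (X σ) (Matrix.vecCons (velocity X σ) fun i => D i σ))

/-- The standard connection 1-form `∮_A(B)` on path space, at `X`, on the tangent vector `D`. -/
def standardConnection (C : DifferentialCrossedModule g h) (P : OneTwoForm E M g h) (X : ℝ → M)
    (D : ∀ σ : ℝ, TangentSpace 𝓘(ℝ, E) (X σ)) : h :=
  chenForm C P.A P.B X fun _ => D

/-- A realization of the Lie algebra `h` inside an associative algebra with the commutator
bracket, for instance a faithful matrix representation. -/
structure FaithfulRep (h R : Type*) [FinDimLieAlgebra h] [NormedRing R] [NormedAlgebra ℝ R] where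
  toLin : h →ₗ[ℝ] R
  injective : Function.Injective toLin
  map_lie : ∀ x y : h, toLin ⁅x, y⁆ = toLin x * toLin y - toLin y * toLin x

variable {R : Type*} [NormedRing R] [NormedAlgebra ℝ R]

/-- The path space line holonomy `P exp ∫_S ∮_A(B)` along a curve `S` in path space. -/
def holonomy (C : DifferentialCrossedModule g h) (ρ : FaithfulRep h R) (P : OneTwoForm E M g h)
    (S : ℝ → ℝ → M) : R :=
  pathExp (fun τ => ρ.toLin
    (standardConnection C P (S τ) fun σ => velocity (fun τ' => S τ' σ) τ)) 0 1

/-- The infinitesimal gauge transform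
`(1 - ε ∮_A(a))_{S 0} · P exp ∫_S ∮_A(B) · (1 + ε ∮_A(a))_{S 1}` of the holonomy. -/
def gaugeTransformedHolonomy (C : DifferentialCrossedModule g h) (ρ : FaithfulRep h R)
    (P : OneTwoForm E M g h) (a : DiffForm E M h 1) (S : ℝ → ℝ → M) (ε : ℝ) : R :=
  (1 - ε • ρ.toLin (chenForm C P.A a (S 0) fun i => i.elim0)) * holonomy C ρ P S *
    (1 + ε • ρ.toLin (chenForm C P.A a (S 1) fun i => i.elim0))

/-- To first order in `ε`, the gauge transform by `a` of the holonomy of `∮_A(B)` along every curve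
in every based path space is the holonomy of `∮_{A'}(B')`, where `A' = A + ε dt(a)` and
`B' = B - ε d_A a`. -/
def YieldsTransformedConnection [IsManifold 𝓘(ℝ, E) ∞ M] (C : DifferentialCrossedModule g h)
    (ρ : FaithfulRep h R) (P : OneTwoForm E M g h) (a : DiffForm E M h 1) : Prop :=
  ∀ (s t : M) (S : ℝ → ℝ → M), IsPathSpaceCurve E s t S →
    (fun ε : ℝ => gaugeTransformedHolonomy C ρ P a S ε - holonomy C ρ (P.transform C a ε) S)
      =O[𝓝 0] fun ε : ℝ => ε ^ 2

/-- To first order in `ε`, the gauge transform by `a` of the holonomy of `∮_A(B)` is the holonomy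
of some standard connection 1-form on path space, which may depend on `ε` in any way. -/
def YieldsSomeStandardConnection (C : DifferentialCrossedModule g h)
    (ρ : FaithfulRep h R) (P : OneTwoForm E M g h) (a : DiffForm E M h 1) : Prop :=
  ∃ Q : ℝ → OneTwoForm E M g h, ∀ (s t : M) (S : ℝ → ℝ → M), IsPathSpaceCurve E s t S →
    (fun ε : ℝ => gaugeTransformedHolonomy C ρ P a S ε - holonomy C ρ (Q ε) S)
      =o[𝓝[≠] 0] fun ε : ℝ => ε

end

end

/-! Write `U` for parallel transport to the end of a path, `X` for the value of `∮_A(B)` on the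
velocity of a curve of paths, and `α` for `∮_A(a)` along that curve. Both directions rest on one
formula, `hasDerivAt_chenForm_zero`: moving a path changes `∮_A(a)` by a boundary term at the
initial point, by the integral of `U (d_A a)`, and by the variation of `U`, which is the action of
the curvature swept out between a point and the end of the path.

Sufficiency. If the fake curvature acts trivially, the curvature acts on `h` as the bracket with
`B`, up to orientation. An integration by parts (`integral_pathExpDeriv_bracket_comm`) then
exchanges `a` and `B` in the curvature term at the cost of `[X, α]`, so that `α' = X₁ - [X, α]`,
where `X₁` is the `ε`-derivative of the transformed connection. This is the infinitesimal gauge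
equation, and a Gronwall estimate (`pathExp_gauge_isBigO`) integrates it to an equality of
holonomies up to `ε ^ 2`.

Necessity. The test paths of `ProbeFrame` lie in one chart: `η` moves their initial point, `μ`
extends them near the end in direction `u`, and `τ` varies this last part in direction `v`. A
standard connection sees only the place where the path varies with `τ` and the rest of the path from
there on. Its holonomy is therefore independent of `η`, whatever the competing family is
(`integral_connection_plane`, `holonomy_plane`). Hence the first order gauge variation `W α(T) -
α(0) W` is independent of `η`. Its `η`-derivative consists of boundary terms alone and gives `W *
(U_T ζ) = (U_0 ζ) * W` with `ζ = a(u)` (`pathExp_transport_eq`). The `T`-derivative at `0` says that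
the transported fake curvature, integrated along the path, kills `ζ`; dividing by `sin μ` and
letting `μ → 0` leaves `dα (F (v, u)) ζ = 0` for the fake curvature `F` at one point
(`dα_fakeCurvature_eq_zero`). Since `a(u)` can be prescribed when `u ≠ 0`, a nontrivial action is an
obstruction. -/

noncomputable section

/-! ### Estimates for ordinary differential equations and parametric integrals -/

section
variable {E : Type*} [NormedAddCommGroup E] [NormedSpace ℝ E]

/-- Gronwall with the rate enlarged to `K + 1`: this avoids the separate case `K = 0` and allows `ε
/ (K + 1)` to be replaced by `ε`. -/
theorem norm_le_of_norm_deriv_le_unit {y y' : ℝ → E} {δ K ε : ℝ} (hK : 0 ≤ K) (hε : 0 ≤ ε)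
    (hδ : ‖y 0‖ ≤ δ) (hy : ∀ s ∈ Icc (0 : ℝ) 1, HasDerivAt y (y' s) s)
    (hb : ∀ s ∈ Icc (0 : ℝ) 1, ‖y' s‖ ≤ K * ‖y s‖ + ε) : ‖y 1‖ ≤ (δ + ε) * Real.exp (K + 1) := by
  have h := norm_le_gronwallBound_of_norm_deriv_right_le (f := y) (f' := y') (δ := δ) (K := K + 1)
    (ε := ε) (a := 0) (b := 1) (fun s hs => (hy s hs).continuousAt.continuousWithinAt)
    (fun s hs => (hy s (Ico_subset_Icc_self hs)).hasDerivWithinAt) hδ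
    (fun s hs => (hb s (Ico_subset_Icc_self hs)).trans (by nlinarith [norm_nonneg (y s)])) 1
    (by simp)
  refine h.trans ?_
  rw [gronwallBound_of_K_ne_0 (by positivity)]
  have h1 : ε / (K + 1) ≤ ε := div_le_self hε (by linarith)
  have h2 : 0 ≤ Real.exp ((K + 1) * (1 - 0)) - 1 := by
    have := Real.add_one_le_exp ((K + 1) * (1 - 0)); linarith
  have h3 := mul_le_mul_of_nonneg_right h1 h2
  simp only [sub_zero, mul_one] at *
  nlinarith

/-- The affine parametrization of the segment from `c` to `x` covers both orientations; transport
integrates backwards from the end of the path, so `x < c` is needed. -/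
theorem norm_le_of_norm_deriv_le {y y' : ℝ → E} {c x δ K ε : ℝ} (hK : 0 ≤ K) (hε : 0 ≤ ε)
    (hδ : ‖y c‖ ≤ δ) (hy : ∀ z ∈ uIcc c x, HasDerivAt y (y' z) z)
    (hb : ∀ z ∈ uIcc c x, ‖y' z‖ ≤ K * ‖y z‖ + ε) :
    ‖y x‖ ≤ (δ + |x - c| * ε) * Real.exp (|x - c| * K + 1) := by
  have hmem : ∀ s ∈ Icc (0 : ℝ) 1, c + s * (x - c) ∈ uIcc c x := fun s hs => by
    rw [← segment_eq_uIcc]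
    exact ⟨1 - s, s, by linarith [hs.2], hs.1, by ring, by simp only [smul_eq_mul]; ring⟩
  have h := norm_le_of_norm_deriv_le_unit (y := fun s => y (c + s * (x - c)))
    (y' := fun s => (x - c) • y' (c + s * (x - c))) (δ := δ) (K := |x - c| * K) (ε := |x - c| * ε)
    (by positivity) (by positivity) (by simpa using hδ) (fun s hs => ?_) (fun s hs => ?_)
  · simpa using h
  · refine (hy _ (hmem s hs)).scomp s (((hasDerivAt_id s).mul_const (x - c)).const_add c |>.congr_deriv ?_)
    simp
  · rw [norm_smul, Real.norm_eq_abs]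
    have := mul_le_mul_of_nonneg_left (hb _ (hmem s hs)) (abs_nonneg (x - c))
    linarith

/-- Differentiation under the integral sign for a continuously differentiable integrand. -/
theorem hasDerivAt_intervalIntegral_param {F F' : ℝ → ℝ → E} {p a b : ℝ}
    (hF : Continuous (Function.uncurry F)) (hF' : Continuous (Function.uncurry F'))
    (h : ∀ q, ∀ t ∈ uIcc a b, HasDerivAt (fun q => F q t) (F' q t) q) :
    HasDerivAt (fun q => ∫ t in a..b, F q t) (∫ t in a..b, F' p t) p := by
  obtain ⟨K, hK⟩ := ((isCompact_closedBall p 1).prod (isCompact_uIcc (a := a) (b := b))).exists_bound_of_continuousOn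
    hF'.continuousOn
  have hc : ∀ G : ℝ → ℝ → E, Continuous (Function.uncurry G) → ∀ q, Continuous (G q) :=
    fun G hG q => hG.comp (Continuous.prodMk_right q)
  refine (intervalIntegral.hasDerivAt_integral_of_dominated_loc_of_deriv_le (F := F) (F' := F')
    (bound := fun _ => K) (s := Metric.closedBall p 1) (Metric.closedBall_mem_nhds p one_pos)
    (Eventually.of_forall fun q => (hc F hF q).aestronglyMeasurable)
    ((hc F hF p).intervalIntegrable _ _) (hc F' hF' p).aestronglyMeasurable ?_
    intervalIntegrable_const ?_).2
  · exact Eventually.of_forall fun t ht q hq => hK (q, t) ⟨hq, uIoc_subset_uIcc ht⟩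
  · exact Eventually.of_forall fun t ht q _ => h q t (uIoc_subset_uIcc ht)

/-- The first order Taylor expansion is uniform in a compact set of parameters. -/
theorem eventually_norm_sub_sub_smul_le {f f' : ℝ → ℝ → E} {p a b : ℝ}
    (hf' : Continuous (Function.uncurry f')) (h : ∀ q t, HasDerivAt (fun q => f q t) (f' q t) q)
    {ε : ℝ} (hε : 0 < ε) :
    ∀ᶠ q in 𝓝 p, ∀ t ∈ uIcc a b, ‖f q t - f p t - (q - p) • f' p t‖ ≤ ε * |q - p| := by
  have hopen : IsOpen {z : ℝ × ℝ | ‖f' z.1 z.2 - f' p z.2‖ < ε} := by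
    refine isOpen_lt ?_ continuous_const
    exact (hf'.sub (hf'.comp (continuous_const.prodMk continuous_snd))).norm
  obtain ⟨u, v, hu, -, hpu, hv, huv⟩ := generalized_tube_lemma (isCompact_singleton (x := p))
    (isCompact_uIcc (a := a) (b := b)) hopen (by
      rintro ⟨q, t⟩ ⟨hq, -⟩
      obtain rfl : q = p := hq
      simpa using hε)
  obtain ⟨r, hr, hru⟩ := Metric.isOpen_iff.1 hu p (hpu rfl)
  filter_upwards [Metric.ball_mem_nhds p hr] with q hq t ht
  -- The mean value inequality is applied to `f` minus its linear part; the tube lemma has made the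
  -- derivative of this difference small uniformly in `t`.
  have := Convex.norm_image_sub_le_of_norm_hasDerivWithin_le (f := fun q => f q t - q • f' p t)
    (f' := fun q => f' q t - f' p t) (s := Metric.ball p r) (x := p) (y := q) (C := ε)
    (fun q _ => ((h q t).sub (by simpa using (hasDerivAt_id q).smul_const (f' p t))).hasDerivWithinAt)
    (fun q hq => (huv (show (q, t) ∈ u ×ˢ v from ⟨hru hq, hv ht⟩)).le) (convex_ball p r)
    (Metric.mem_ball_self hr) hq
  refine le_of_eq_of_le ?_ this
  congr 1
  rw [sub_smul]; abel
end

/-! ### The path-ordered exponential -/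

section
variable {R : Type*} [NormedRing R] [NormedAlgebra ℝ R]

/-- Uniqueness for `y' = y f`, from Gronwall with zero data. -/
theorem eq_zero_of_hasDerivAt_mul {f y : ℝ → R} (hf : Continuous f) {c : ℝ} (hc : y c = 0)
    (hy : ∀ z, HasDerivAt y (y z * f z) z) (x : ℝ) : y x = 0 := by
  obtain ⟨K, hK⟩ := (isCompact_uIcc (a := c) (b := x)).exists_bound_of_continuousOn hf.continuousOn
  have hK0 : 0 ≤ K := (norm_nonneg _).trans (hK c left_mem_uIcc)
  have := norm_le_of_norm_deriv_le (y := y) (c := c) (x := x) (δ := 0) (K := K) (ε := 0) hK0 le_rfl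
    (by simp [hc]) (fun z _ => hy z) (fun z hz => by
      rw [add_zero, mul_comm K]
      exact (norm_mul_le _ _).trans (mul_le_mul_of_nonneg_left (hK z hz) (norm_nonneg _)))
  simpa using this

theorem continuous_uncurry_pathExpTerm {f : ℝ → ℝ → R} (hf : Continuous (Function.uncurry f))
    (c : ℝ) (n : ℕ) : Continuous (Function.uncurry fun p x => pathExpTerm (f p) c n x) := by
  induction n with
  | zero => exact continuous_const
  | succ n ih =>
    exact intervalIntegral.continuous_parametric_primitive_of_continuous
      (f := fun p y => pathExpTerm (f p) c n y * f p y) (ih.mul hf)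

theorem continuous_pathExpTerm {f : ℝ → R} (hf : Continuous f) (c : ℝ) (n : ℕ) :
    Continuous (pathExpTerm f c n) :=
  (continuous_uncurry_pathExpTerm (f := fun _ => f) (hf.comp continuous_snd) c n).comp
    (Continuous.prodMk_right (0 : ℝ))

/-- Substitution in each integral. It reduces bounds on an arbitrary oriented interval to `[0, 1]`,
and lets test curves be run through with speed `T`. -/
theorem pathExpTerm_scale (f : ℝ → R) (c T : ℝ) (n : ℕ) (s : ℝ) :
    pathExpTerm (fun s => T • f (c + T * s)) 0 n s = pathExpTerm f c n (c + T * s) := by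
  induction n generalizing s with
  | zero => rfl
  | succ n ih =>
    simp only [pathExpTerm, ih, mul_smul_comm, intervalIntegral.integral_smul]
    rw [intervalIntegral.smul_integral_comp_add_mul (fun z => pathExpTerm f c n z * f z) T c]
    simp

theorem pathExp_scale (f : ℝ → R) (T : ℝ) :
    pathExp (fun s => T • f (T * s)) 0 1 = pathExp f 0 T := by
  simpa [pathExp] using tsum_congr fun n => pathExpTerm_scale f 0 T n 1

/-- The factor `s ^ n / n!` is the volume of the simplex of ordered parameters. -/
theorem norm_pathExpTerm_unit_le {f : ℝ → R} {K : ℝ}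
    (hK : ∀ s ∈ Icc (0 : ℝ) 1, ‖f s‖ ≤ K) (n : ℕ) {s : ℝ} (hs : s ∈ Icc (0 : ℝ) 1) :
    ‖pathExpTerm f 0 n s‖ ≤ ‖(1 : R)‖ * (K ^ n * s ^ n / n.factorial) := by
  have hK0 : 0 ≤ K := (norm_nonneg _).trans (hK s hs)
  induction n generalizing s with
  | zero => simp [pathExpTerm]
  | succ n ih =>
    have h := intervalIntegral.norm_integral_le_of_norm_le (μ := MeasureTheory.volume) hs.1
      (f := fun y => pathExpTerm f 0 n y * f y)
      (g := fun y => ‖(1 : R)‖ * (K ^ (n + 1) / n.factorial) * y ^ n)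
      (Eventually.of_forall fun y hy => ?_) (Continuous.intervalIntegrable (by fun_prop) _ _)
    · refine h.trans (le_of_eq ?_)
      rw [intervalIntegral.integral_const_mul, integral_pow, Nat.factorial_succ]
      push_cast
      field_simp
      simp
    · have hy' : y ∈ Icc (0 : ℝ) 1 := ⟨hy.1.le, hy.2.trans hs.2⟩
      calc ‖pathExpTerm f 0 n y * f y‖ ≤ ‖(1 : R)‖ * (K ^ n * y ^ n / n.factorial) * K :=
            (norm_mul_le _ _).trans
              (mul_le_mul (ih hy') (hK y hy') (norm_nonneg _) (by have := hy'.1; positivity))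
        _ = _ := by ring

theorem norm_pathExpTerm_le {f : ℝ → R} {c x K r : ℝ} (hr : |x - c| ≤ r)
    (hK : ∀ z ∈ uIcc c x, ‖f z‖ ≤ K) (n : ℕ) :
    ‖pathExpTerm f c n x‖ ≤ ‖(1 : R)‖ * ((r * K) ^ n / n.factorial) := by
  have hK0 : 0 ≤ K := (norm_nonneg _).trans (hK c left_mem_uIcc)
  have hmem : ∀ s ∈ Icc (0 : ℝ) 1, c + (x - c) * s ∈ uIcc c x := fun s hs => by
    rw [← segment_eq_uIcc]
    exact ⟨1 - s, s, by linarith [hs.2], hs.1, by ring, by simp only [smul_eq_mul]; ring⟩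
  have h := norm_pathExpTerm_unit_le (f := fun s => (x - c) • f (c + (x - c) * s))
    (K := r * K) (fun s hs => ?_) n (right_mem_Icc.2 zero_le_one)
  · rw [pathExpTerm_scale] at h
    simpa using h
  · rw [norm_smul]
    exact mul_le_mul hr (hK _ (hmem s hs)) (norm_nonneg _) ((abs_nonneg _).trans hr)

theorem summable_pathExpTerm_bound (N K : ℝ) :
    Summable fun n : ℕ => N * (K ^ n / n.factorial) :=
  (Real.summable_pow_div_factorial K).mul_left N

@[simp]
theorem pathExp_self (f : ℝ → R) (c : ℝ) : pathExp f c c = 1 := by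
  rw [pathExp, tsum_eq_single 0]
  · rfl
  · intro n hn
    obtain ⟨m, rfl⟩ := Nat.exists_eq_succ_of_ne_zero hn
    simp [pathExpTerm]

theorem pathExp_zero (c x : ℝ) : pathExp (fun _ => (0 : R)) c x = 1 := by
  rw [pathExp, tsum_eq_single 0]
  · rfl
  · intro n hn
    obtain ⟨m, rfl⟩ := Nat.exists_eq_succ_of_ne_zero hn
    simp [pathExpTerm]

/-- Every iterated integral samples `f` only between the end points. This is what makes transport
from a point to the end blind to the earlier part of the path. -/
theorem pathExp_congr {f f' : ℝ → R} {c x : ℝ} (h : ∀ z ∈ uIoc c x, f z = f' z) :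
    pathExp f c x = pathExp f' c x := by
  refine tsum_congr fun n => ?_
  induction n generalizing x with
  | zero => rfl
  | succ n ih =>
    refine intervalIntegral.integral_congr_ae (Eventually.of_forall fun z hz => ?_)
    have hsub : uIoc c z ⊆ uIoc c x := by
      rcases le_total c x with hcx | hcx
      · rw [uIoc_of_le hcx] at hz ⊢
        rw [uIoc_of_le hz.1.le]
        exact Ioc_subset_Ioc_right hz.2
      · rw [uIoc_of_ge hcx] at hz ⊢
        rw [uIoc_of_ge hz.2]
        exact Ioc_subset_Ioc_left hz.1.le
    show pathExpTerm f c n z * f z = pathExpTerm f' c n z * f' z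
    rw [h z hz, ih fun w hw => h w (hsub hw)]

variable [CompleteSpace R]

theorem hasDerivAt_pathExp {f : ℝ → R} (hf : Continuous f) (c x : ℝ) :
    HasDerivAt (pathExp f c) (pathExp f c x * f x) x := by
  set r := |x - c| + 1 with hr
  obtain ⟨K, hK⟩ := (isCompact_closedBall c r).exists_bound_of_continuousOn hf.continuousOn
  have hsub : ∀ y ∈ Metric.ball c r, uIcc c y ⊆ Metric.closedBall c r := fun y hy =>
    (convex_closedBall c r).ordConnected.uIcc_subset (Metric.mem_closedBall_self (by positivity))
      (Metric.ball_subset_closedBall hy)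
  have hbd : ∀ n, ∀ y ∈ Metric.ball c r,
      ‖pathExpTerm f c n y‖ ≤ ‖(1 : R)‖ * ((r * K) ^ n / n.factorial) := fun n y hy =>
    norm_pathExpTerm_le (by simpa [Real.dist_eq] using (Metric.mem_ball.1 hy).le)
      (fun z hz => hK z (hsub y hy hz)) n
  have hx : x ∈ Metric.ball c r := by simp [Real.dist_eq, hr]
  have hsum : Summable fun n => pathExpTerm f c n x :=
    Summable.of_norm_bounded (summable_pathExpTerm_bound _ _) fun n => hbd n x hx
  -- Differentiation lowers the index by one: the constant term contributes `0`, and the remaining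
  -- derivatives sum to the series times `f`.
  let g' : ℕ → ℝ → R := fun n y => Nat.rec 0 (fun m _ => pathExpTerm f c m y * f y) n
  have h := hasDerivAt_tsum_of_isPreconnected (g := pathExpTerm f c) (g' := g')
    (u := fun n => Nat.rec 0 (fun m _ => ‖(1 : R)‖ * ((r * K) ^ m / m.factorial) * K) n)
    (t := Metric.ball c r) (y₀ := x) (y := x) ?_ Metric.isOpen_ball
    (convex_ball c r).isPreconnected ?_ ?_ hx hsum hx
  · refine h.congr_deriv ?_
    have hg : Summable fun n => g' n x := by
      refine (summable_nat_add_iff 1).1 ?_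
      exact hsum.mul_right (f x)
    rw [hg.tsum_eq_zero_add]
    show 0 + ∑' n, pathExpTerm f c n x * f x = _
    rw [zero_add, hsum.tsum_mul_right, pathExp]
  · refine (summable_nat_add_iff 1).1 ?_
    exact (summable_pathExpTerm_bound _ _).mul_right K
  · intro n y _
    cases n with
    | zero => exact hasDerivAt_const y _
    | succ n =>
      exact (((continuous_pathExpTerm hf c n).mul hf).integral_hasStrictDerivAt c y).hasDerivAt
  · intro n y hy
    cases n with
    | zero => simp [g']
    | succ n =>
      refine (norm_mul_le _ _).trans (mul_le_mul (hbd n y hy)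
        (hK y (Metric.ball_subset_closedBall hy)) (norm_nonneg _) ?_)
      exact (norm_nonneg _).trans (hbd n y hy)

theorem continuous_pathExp {f : ℝ → R} (hf : Continuous f) (c : ℝ) : Continuous (pathExp f c) :=
  continuous_iff_continuousAt.2 fun x => (hasDerivAt_pathExp hf c x).continuousAt

/-- The exponential majorant is uniform on a product neighbourhood, so the series converges
uniformly there. -/
theorem continuous_uncurry_pathExp {f : ℝ → ℝ → R} (hf : Continuous (Function.uncurry f))
    (c : ℝ) : Continuous (Function.uncurry fun p x => pathExp (f p) c x) := by
  refine continuous_iff_continuousAt.2 fun ⟨p, x⟩ => ?_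
  set r := |x - c| + 1 with hr
  obtain ⟨K, hK⟩ := ((isCompact_closedBall p 1).prod
    (isCompact_closedBall c r)).exists_bound_of_continuousOn hf.continuousOn
  have hx : x ∈ Metric.ball c r := by simp [Real.dist_eq, hr]
  refine ContinuousOn.continuousAt (s := Metric.closedBall p 1 ×ˢ Metric.ball c r) ?_
    (prod_mem_nhds (Metric.closedBall_mem_nhds p one_pos) (Metric.isOpen_ball.mem_nhds hx))
  refine continuousOn_tsum (fun n => (continuous_uncurry_pathExpTerm hf c n).continuousOn)
    (summable_pathExpTerm_bound ‖(1 : R)‖ (r * K)) ?_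
  rintro n ⟨q, y⟩ ⟨hq, hy⟩
  refine norm_pathExpTerm_le
    (by simpa [Real.dist_eq] using (Metric.mem_ball.1 hy).le) (fun z hz => hK (q, z) ⟨hq, ?_⟩) n
  exact (convex_closedBall c r).ordConnected.uIcc_subset
    (Metric.mem_closedBall_self (by positivity)) (Metric.ball_subset_closedBall hy) hz

/-- As functions of `c` both sides solve `y' = y f` and agree at `c = b`. The points may lie in any
order, so reversing an interval inverts the exponential. -/
theorem pathExp_mul_pathExp {f : ℝ → R} (hf : Continuous f) (a b c : ℝ) :
    pathExp f a b * pathExp f b c = pathExp f a c := by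
  refine sub_eq_zero.1 (eq_zero_of_hasDerivAt_mul (c := b)
    (y := fun c => pathExp f a b * pathExp f b c - pathExp f a c) hf (by simp) (fun z => ?_) c)
  refine (((hasDerivAt_pathExp hf b z).const_mul _).sub (hasDerivAt_pathExp hf a z)).congr_deriv ?_
  rw [sub_mul, mul_assoc]

theorem pathExp_mul_pathExp_swap {f : ℝ → R} (hf : Continuous f) (a b : ℝ) :
    pathExp f a b * pathExp f b a = 1 := by
  rw [pathExp_mul_pathExp hf, pathExp_self]

/-- The path-ordered exponential as a unit. -/
def pathExpUnit {f : ℝ → R} (hf : Continuous f) (a b : ℝ) : Rˣ :=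
  ⟨pathExp f a b, pathExp f b a, pathExp_mul_pathExp_swap hf a b, pathExp_mul_pathExp_swap hf b a⟩

theorem pathExp_swap_eq_inverse {f : ℝ → R} (hf : Continuous f) (a b : ℝ) :
    pathExp f b a = Ring.inverse (pathExp f a b) :=
  (Ring.inverse_unit (pathExpUnit hf a b)).symm

theorem hasDerivAt_pathExp_left {f : ℝ → R} (hf : Continuous f) (c x : ℝ) :
    HasDerivAt (fun x => pathExp f x c) (-(f x * pathExp f x c)) x := by
  have h := (hasFDerivAt_ringInverse (𝕜 := ℝ) (pathExpUnit hf c x)).comp_hasDerivAt x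
    (hasDerivAt_pathExp hf c x)
  have he : (fun x => pathExp f x c) = Ring.inverse ∘ pathExp f c :=
    funext fun x => pathExp_swap_eq_inverse hf c x
  rw [he]
  refine h.congr_deriv ?_
  rw [neg_apply, ContinuousLinearMap.mulLeftRight_apply]
  show -(pathExp f x c * (pathExp f c x * f x) * pathExp f x c) = -(f x * pathExp f x c)
  rw [← mul_assoc (pathExp f x c), pathExp_mul_pathExp_swap hf, one_mul]

theorem continuous_uncurry_pathExp_left {f : ℝ → ℝ → R} (hf : Continuous (Function.uncurry f))
    (c : ℝ) : Continuous (Function.uncurry fun p x => pathExp (f p) x c) := by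
  have hfp : ∀ p, Continuous (f p) := fun p => hf.comp (Continuous.prodMk_right p)
  have he : (Function.uncurry fun p x => pathExp (f p) x c) =
      Ring.inverse ∘ (Function.uncurry fun p x => pathExp (f p) c x) :=
    funext fun ⟨p, x⟩ => pathExp_swap_eq_inverse (hfp p) c x
  rw [he]
  refine continuous_iff_continuousAt.2 fun ⟨p, x⟩ => ?_
  exact ContinuousAt.comp (NormedRing.inverse_continuousAt (pathExpUnit (hfp p) c x))
    (continuous_uncurry_pathExp hf c).continuousAt

theorem continuous_pathExp_left {f : ℝ → R} (hf : Continuous f) (c : ℝ) :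
    Continuous fun x => pathExp f x c :=
  continuous_iff_continuousAt.2 fun x => (hasDerivAt_pathExp_left hf c x).continuousAt

theorem norm_pathExp_le {f : ℝ → R} (hf : Continuous f) {c x K : ℝ} (hx : |x - c| ≤ 1)
    (hK : ∀ z ∈ uIcc c x, ‖f z‖ ≤ K) : ‖pathExp f c x‖ ≤ ‖(1 : R)‖ * Real.exp (K + 1) := by
  have hK0 : 0 ≤ K := (norm_nonneg _).trans (hK c left_mem_uIcc)
  refine (norm_le_of_norm_deriv_le (y := pathExp f c) (c := c) (x := x) (δ := ‖(1 : R)‖) (K := K)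
    (ε := 0) hK0 le_rfl (by simp) (fun z _ => hasDerivAt_pathExp hf c z) (fun z hz => ?_)).trans ?_
  · rw [add_zero, mul_comm K]
    exact (norm_mul_le _ _).trans (mul_le_mul_of_nonneg_left (hK z hz) (norm_nonneg _))
  · rw [mul_zero, add_zero]
    gcongr
    exact mul_le_of_le_one_left hK0 hx

/-- The derivative of the path-ordered exponential `P exp ∫_c^x f` in the direction `φ`. -/
def pathExpDeriv (f φ : ℝ → R) (c x : ℝ) : R :=
  (∫ y in c..x, pathExp f c y * φ y * pathExp f y c) * pathExp f c x

/-- Variation of constants: `pathExpDeriv` solves the linearization of `W' = W f` in direction `φ`.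
The later estimates use it only through this equation and its zero initial value. -/
theorem hasDerivAt_pathExpDeriv {f φ : ℝ → R} (hf : Continuous f) (hφ : Continuous φ) (c x : ℝ) :
    HasDerivAt (pathExpDeriv f φ c) (pathExpDeriv f φ c x * f x + pathExp f c x * φ x) x := by
  have h1 := ((((continuous_pathExp hf c).mul hφ).mul
    (continuous_pathExp_left hf c)).integral_hasStrictDerivAt c x).hasDerivAt
  refine (h1.mul (hasDerivAt_pathExp hf c x)).congr_deriv ?_
  simp only [Pi.mul_apply]
  rw [mul_assoc _ (pathExp f x c), pathExp_mul_pathExp_swap hf, pathExpDeriv, mul_one,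
    mul_assoc, add_comm]

/-- The difference `y` of the exponentials `W'`, `W` satisfies `y' = y f' + W (f' - f)`; Gronwall
gives the Lipschitz bound. -/
theorem norm_pathExp_sub_le {f f' : ℝ → R} (hf : Continuous f) (hf' : Continuous f') {c x K δ : ℝ}
    (hx : |x - c| ≤ 1) (hK : ∀ z ∈ uIcc c x, ‖f z‖ ≤ K) (hK' : ∀ z ∈ uIcc c x, ‖f' z‖ ≤ K)
    (hδ : ∀ z ∈ uIcc c x, ‖f' z - f z‖ ≤ δ) :
    ‖pathExp f' c x - pathExp f c x‖ ≤ ‖(1 : R)‖ * Real.exp (2 * (K + 1)) * δ := by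
  have hK0 : 0 ≤ K := (norm_nonneg _).trans (hK c left_mem_uIcc)
  have hδ0 : 0 ≤ δ := (norm_nonneg _).trans (hδ c left_mem_uIcc)
  refine (norm_le_of_norm_deriv_le (y := fun x => pathExp f' c x - pathExp f c x)
    (c := c) (x := x) (δ := 0) (K := K)
    (ε := ‖(1 : R)‖ * Real.exp (K + 1) * δ) hK0 (by positivity) (by simp)
    (fun z _ => (hasDerivAt_pathExp hf' c z).sub (hasDerivAt_pathExp hf c z))
    (fun z hz => ?_)).trans ?_
  · have hz1 : |z - c| ≤ 1 := (abs_sub_left_of_mem_uIcc hz).trans hx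
    have hsub : uIcc c z ⊆ uIcc c x := uIcc_subset_uIcc_left hz
    have hu := norm_pathExp_le hf hz1 fun w hw => hK w (hsub hw)
    calc ‖pathExp f' c z * f' z - pathExp f c z * f z‖
        = ‖(pathExp f' c z - pathExp f c z) * f' z + pathExp f c z * (f' z - f z)‖ := by
          congr 1; noncomm_ring
      _ ≤ ‖pathExp f' c z - pathExp f c z‖ * K + ‖(1 : R)‖ * Real.exp (K + 1) * δ := by
          refine (norm_add_le _ _).trans (add_le_add ((norm_mul_le _ _).trans ?_)
            ((norm_mul_le _ _).trans ?_))
          · exact mul_le_mul_of_nonneg_left (hK' z hz) (norm_nonneg _)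
          · exact mul_le_mul hu (hδ z hz) (norm_nonneg _) (by positivity)
      _ = _ := by ring
  · have he : Real.exp (2 * (K + 1)) = Real.exp (K + 1) * Real.exp (K + 1) := by
      rw [← Real.exp_add]; ring_nf
    rw [he, zero_add]
    have h1 : |x - c| * (‖(1 : R)‖ * Real.exp (K + 1) * δ) ≤ ‖(1 : R)‖ * Real.exp (K + 1) * δ :=
      mul_le_of_le_one_left (by positivity) hx
    have h2 : Real.exp (|x - c| * K + 1) ≤ Real.exp (K + 1) := by
      gcongr
      exact mul_le_of_le_one_left hK0 hx
    calc _ ≤ (‖(1 : R)‖ * Real.exp (K + 1) * δ) * Real.exp (K + 1) := by gcongr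
      _ = _ := by ring

/-- The remainder `y` satisfies `y' = y f + (W' - W) (f' - f) + W (f' - f - ψ)`, with both
inhomogeneous terms controlled by the Lipschitz bound. The error `κ` allows `ψ` to be merely a first
order approximation of `f' - f`; for affine families it is `0`. -/
theorem norm_pathExp_sub_sub_pathExpDeriv_le {f f' ψ : ℝ → R} (hf : Continuous f)
    (hf' : Continuous f') (hψ : Continuous ψ) {c x K δ κ : ℝ}
    (hx : |x - c| ≤ 1) (hK : ∀ z ∈ uIcc c x, ‖f z‖ ≤ K) (hK' : ∀ z ∈ uIcc c x, ‖f' z‖ ≤ K)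
    (hδ : ∀ z ∈ uIcc c x, ‖f' z - f z‖ ≤ δ) (hκ : ∀ z ∈ uIcc c x, ‖f' z - f z - ψ z‖ ≤ κ) :
    ‖pathExp f' c x - pathExp f c x - pathExpDeriv f ψ c x‖ ≤
      ‖(1 : R)‖ * Real.exp (3 * (K + 1)) * (δ ^ 2 + κ) := by
  have hK0 : 0 ≤ K := (norm_nonneg _).trans (hK c left_mem_uIcc)
  have hδ0 : 0 ≤ δ := (norm_nonneg _).trans (hδ c left_mem_uIcc)
  have hκ0 : 0 ≤ κ := (norm_nonneg _).trans (hκ c left_mem_uIcc)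
  have he1 : Real.exp (K + 1) ≤ Real.exp (2 * (K + 1)) := by gcongr; linarith
  refine (norm_le_of_norm_deriv_le
    (y := fun x => pathExp f' c x - pathExp f c x - pathExpDeriv f ψ c x)
    (c := c) (x := x) (δ := 0) (K := K)
    (ε := ‖(1 : R)‖ * Real.exp (2 * (K + 1)) * (δ ^ 2 + κ)) hK0 (by positivity)
    (by simp [pathExpDeriv])
    (fun z _ => ((hasDerivAt_pathExp hf' c z).sub (hasDerivAt_pathExp hf c z)).sub
      (hasDerivAt_pathExpDeriv hf hψ c z))
    (fun z hz => ?_)).trans ?_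
  · have hz1 : |z - c| ≤ 1 := (abs_sub_left_of_mem_uIcc hz).trans hx
    have hsub : uIcc c z ⊆ uIcc c x := uIcc_subset_uIcc_left hz
    have hu := norm_pathExp_le hf hz1 fun w hw => hK w (hsub hw)
    have hd := norm_pathExp_sub_le hf hf' hz1 (fun w hw => hK w (hsub hw))
      (fun w hw => hK' w (hsub hw)) (fun w hw => hδ w (hsub hw))
    calc _ = ‖(pathExp f' c z - pathExp f c z - pathExpDeriv f ψ c z) * f z +
          ((pathExp f' c z - pathExp f c z) * (f' z - f z) +
            pathExp f c z * (f' z - f z - ψ z))‖ := by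
          congr 1; noncomm_ring
      _ ≤ ‖pathExp f' c z - pathExp f c z - pathExpDeriv f ψ c z‖ * K +
          (‖(1 : R)‖ * Real.exp (2 * (K + 1)) * δ * δ + ‖(1 : R)‖ * Real.exp (2 * (K + 1)) * κ) := by
          refine (norm_add_le _ _).trans (add_le_add ((norm_mul_le _ _).trans ?_)
            ((norm_add_le _ _).trans (add_le_add ((norm_mul_le _ _).trans ?_)
              ((norm_mul_le _ _).trans ?_))))
          · exact mul_le_mul_of_nonneg_left (hK z hz) (norm_nonneg _)
          · exact mul_le_mul hd (hδ z hz) (norm_nonneg _) (by positivity)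
          · exact mul_le_mul (hu.trans (by gcongr)) (hκ z hz) (norm_nonneg _) (by positivity)
      _ = _ := by ring
  · have he : Real.exp (3 * (K + 1)) = Real.exp (2 * (K + 1)) * Real.exp (K + 1) := by
      rw [← Real.exp_add]; ring_nf
    rw [he, zero_add]
    have h1 : |x - c| * (‖(1 : R)‖ * Real.exp (2 * (K + 1)) * (δ ^ 2 + κ)) ≤
        ‖(1 : R)‖ * Real.exp (2 * (K + 1)) * (δ ^ 2 + κ) :=
      mul_le_of_le_one_left (by positivity) hx
    have h2 : Real.exp (|x - c| * K + 1) ≤ Real.exp (K + 1) := by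
      gcongr
      exact mul_le_of_le_one_left hK0 hx
    calc _ ≤ (‖(1 : R)‖ * Real.exp (2 * (K + 1)) * (δ ^ 2 + κ)) * Real.exp (K + 1) := by
          gcongr
      _ = _ := by ring

theorem hasDerivAt_pathExp_param {f f' : ℝ → ℝ → R} (hf : Continuous (Function.uncurry f))
    (hf' : Continuous (Function.uncurry f')) (h : ∀ q t, HasDerivAt (fun q => f q t) (f' q t) q)
    (p : ℝ) {c x : ℝ} (hx : |x - c| ≤ 1) :
    HasDerivAt (fun q => pathExp (f q) c x) (pathExpDeriv (f p) (f' p) c x) p := by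
  have hfc : ∀ q, Continuous (f q) := fun q => hf.comp (Continuous.prodMk_right q)
  have hfc' : ∀ q, Continuous (f' q) := fun q => hf'.comp (Continuous.prodMk_right q)
  obtain ⟨K, hK⟩ := ((isCompact_closedBall p 1).prod
    (isCompact_uIcc (a := c) (b := x))).exists_bound_of_continuousOn hf.continuousOn
  obtain ⟨K', hK'⟩ := ((isCompact_uIcc (a := c) (b := x))).exists_bound_of_continuousOn
    (hfc' p).continuousOn
  have hK0 : 0 ≤ K' := (norm_nonneg _).trans (hK' c left_mem_uIcc)
  set B := ‖(1 : R)‖ * Real.exp (3 * (K + 1)) with hB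
  have hB0 : 0 ≤ B := by positivity
  rw [hasDerivAt_iff_isLittleO, isLittleO_iff]
  intro ε hε
  -- The bound `η ≤ 1` makes `K' + 1` a Lipschitz constant of the integrand; the other bound gives
  -- `B * η ≤ ε / 2`. The other half of `ε` absorbs the quadratic term, by the choice of
  -- neighbourhood in `h1`.
  set η := min 1 (ε / (2 * (B + 1))) with hη
  have hη0 : 0 < η := lt_min one_pos (div_pos hε (by linarith))
  have h1 : ∀ᶠ q in 𝓝 p, |q - p| < ε / (2 * (B + 1) * (K' + 1) ^ 2) :=
    Metric.ball_mem_nhds p (by positivity)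
  filter_upwards [eventually_norm_sub_sub_smul_le (p := p) (a := c) (b := x) hf' h hη0,
    Metric.closedBall_mem_nhds p one_pos, h1] with q hq hq1 hq2
  have hlin : pathExpDeriv (f p) (fun t => (q - p) • f' p t) c x =
      (q - p) • pathExpDeriv (f p) (f' p) c x := by
    simp [pathExpDeriv]
  rw [← hlin]
  refine (norm_pathExp_sub_sub_pathExpDeriv_le (K := K) (δ := (K' + 1) * |q - p|)
    (κ := η * |q - p|) (hfc p) (hfc q) ((hfc' p).const_smul (q - p))
    hx (fun z hz => hK (p, z) ⟨Metric.mem_closedBall_self zero_le_one, hz⟩)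
    (fun z hz => hK (q, z) ⟨hq1, hz⟩) (fun z hz => ?_) hq).trans ?_
  · have := norm_add_le (f q z - f p z - (q - p) • f' p z) ((q - p) • f' p z)
    rw [sub_add_cancel, norm_smul, Real.norm_eq_abs] at this
    have h2 := hq z hz
    have h3 : η ≤ 1 := min_le_left _ _
    nlinarith [hK' z hz, abs_nonneg (q - p)]
  · rw [Real.norm_eq_abs]
    have h3 : B * η ≤ ε / 2 := by
      have h4 : η ≤ ε / (2 * (B + 1)) := min_le_right _ _
      calc B * η ≤ (B + 1) * (ε / (2 * (B + 1))) := by gcongr; linarith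
        _ = ε / 2 := by field_simp
    have h5 : B * (K' + 1) ^ 2 * |q - p| ≤ ε / 2 := by
      calc _ ≤ (B + 1) * (K' + 1) ^ 2 * (ε / (2 * (B + 1) * (K' + 1) ^ 2)) := by
            gcongr; linarith
        _ = ε / 2 := by field_simp
    calc B * (((K' + 1) * |q - p|) ^ 2 + η * |q - p|)
        = (B * (K' + 1) ^ 2 * |q - p| + B * η) * |q - p| := by ring
      _ ≤ ε * |q - p| := by
        gcongr
        linarith

theorem continuous_uncurry_pathExpDeriv {f φ : ℝ → ℝ → R} (hf : Continuous (Function.uncurry f))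
    (hφ : Continuous (Function.uncurry φ)) (c : ℝ) :
    Continuous (Function.uncurry fun p x => pathExpDeriv (f p) (φ p) c x) := by
  refine Continuous.mul ?_ (continuous_uncurry_pathExp hf c)
  exact intervalIntegral.continuous_parametric_primitive_of_continuous
    (f := fun p y => pathExp (f p) c y * φ p y * pathExp (f p) y c)
    (((continuous_uncurry_pathExp hf c).mul hφ).mul (continuous_uncurry_pathExp_left hf c))

end

/-! ### Pullbacks of differential forms to a normed space -/

section
variable {E F M V : Type*} [NormedAddCommGroup E] [NormedSpace ℝ E] [NormedAddCommGroup F]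
  [NormedSpace ℝ F] [TopologicalSpace M]
  [ChartedSpace E M] [NormedAddCommGroup V] [NormedSpace ℝ V] {k : ℕ}

/-- The pullback of a field of alternating forms along a map from a normed space. -/
def formPullback (X : F → M) (η : ∀ x : M, TangentSpace 𝓘(ℝ, E) x [⋀^Fin k]→L[ℝ] V) (p : F) :
    F [⋀^Fin k]→L[ℝ] V :=
  (η (X p)).compContinuousLinearMap (mfderiv 𝓘(ℝ, F) 𝓘(ℝ, E) X p)

variable [IsManifold 𝓘(ℝ, E) ∞ M]

theorem contDiffAt_extChartAt_comp {X : F → M} (hX : ContMDiff 𝓘(ℝ, F) 𝓘(ℝ, E) ∞ X) (x₀ : M) {p : F}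
    (hp : X p ∈ (extChartAt 𝓘(ℝ, E) x₀).source) :
    ContDiffAt ℝ ∞ (fun q => extChartAt 𝓘(ℝ, E) x₀ (X q)) p :=
  ((contMDiffAt_extChartAt' (I := 𝓘(ℝ, E)) (n := ∞) (by simpa using hp)).comp p (hX p)).contDiffAt

/-- Near `p` the map `X` factors through the chart, so the chain rule turns a pullback from `M` into
one between normed spaces. -/
theorem formPullback_eventuallyEq {X : F → M} (hX : ContMDiff 𝓘(ℝ, F) 𝓘(ℝ, E) ∞ X)
    (η : ∀ x : M, TangentSpace 𝓘(ℝ, E) x [⋀^Fin k]→L[ℝ] V) (x₀ : M) {p : F}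
    (hp : X p ∈ (extChartAt 𝓘(ℝ, E) x₀).source) :
    formPullback X η =ᶠ[𝓝 p] fun q =>
      (chartRep η x₀ (extChartAt 𝓘(ℝ, E) x₀ (X q))).compContinuousLinearMap
        (fderiv ℝ (fun q => extChartAt 𝓘(ℝ, E) x₀ (X q)) q) := by
  set φ := extChartAt 𝓘(ℝ, E) x₀ with hφ
  let ηE : M → E [⋀^Fin k]→L[ℝ] V := η
  have hop : IsOpen φ.source := isOpen_extChartAt_source x₀
  have ht : IsOpen φ.target := isOpen_extChartAt_target x₀
  have hev : ∀ᶠ q in 𝓝 p, X q ∈ φ.source :=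
    hX.continuous.continuousAt.preimage_mem_nhds (hop.mem_nhds hp)
  filter_upwards [hev.eventually_nhds] with q hq'
  have hq : X q ∈ φ.source := hq'.self_of_nhds
  have hsm : MDifferentiableAt 𝓘(ℝ, E) 𝓘(ℝ, E) φ.symm (φ (X q)) :=
    ((contMDiffOn_extChartAt_symm (n := ∞) x₀).contMDiffAt
      (ht.mem_nhds (φ.map_source hq))).mdifferentiableAt (by simp)
  have hc : ContMDiffAt 𝓘(ℝ, F) 𝓘(ℝ, E) ∞ (fun q => φ (X q)) q :=
    (contMDiffAt_extChartAt' (I := 𝓘(ℝ, E)) (n := ∞) (by simpa [hφ] using hq)).comp q (hX q)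
  have hcomp : (mfderiv 𝓘(ℝ, E) 𝓘(ℝ, E) φ.symm (φ (X q)) : E →L[ℝ] E) ∘L
      fderiv ℝ (fun q => φ (X q)) q = (mfderiv 𝓘(ℝ, F) 𝓘(ℝ, E) X q : F →L[ℝ] E) := by
    refine (congrArg (fun L : F →L[ℝ] E => (mfderiv 𝓘(ℝ, E) 𝓘(ℝ, E) φ.symm (φ (X q)) :
      E →L[ℝ] E).comp L) (mfderiv_eq_fderiv (f := fun q => φ (X q)) (x := q)).symm).trans ?_
    refine (mfderiv_comp q hsm (hc.mdifferentiableAt (by simp))).symm.trans ?_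
    refine Filter.EventuallyEq.mfderiv_eq ?_
    filter_upwards [hq'] with w hw
    exact φ.left_inv hw
  show (ηE (X q)).compContinuousLinearMap (mfderiv 𝓘(ℝ, F) 𝓘(ℝ, E) X q : F →L[ℝ] E) =
    ((ηE (φ.symm (φ (X q)))).compContinuousLinearMap
      (mfderiv 𝓘(ℝ, E) 𝓘(ℝ, E) φ.symm (φ (X q)) : E →L[ℝ] E)).compContinuousLinearMap
        (fderiv ℝ (fun q => φ (X q)) q)
  rw [φ.left_inv hq, ← hcomp]
  rfl

theorem IsSmoothForm.contDiff_formPullback_apply [CompleteSpace V]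
    {η : ∀ x : M, TangentSpace 𝓘(ℝ, E) x [⋀^Fin k]→L[ℝ] V} (hη : IsSmoothForm η) {X : F → M}
    (hX : ContMDiff 𝓘(ℝ, F) 𝓘(ℝ, E) ∞ X) (v : Fin k → F) :
    ContDiff ℝ ∞ fun p => formPullback X η p v := by
  refine contDiff_iff_contDiffAt.2 fun p => ?_
  have hp := mem_extChartAt_source (I := 𝓘(ℝ, E)) (X p)
  refine ContDiffAt.congr_of_eventuallyEq ?_
    ((formPullback_eventuallyEq hX η (X p) hp).mono fun q hq => congrArg (· v) hq)
  have hc := contDiffAt_extChartAt_comp hX (X p) hp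
  have h1 : ContDiffAt ℝ ∞ (fun q => chartRep η (X p) (extChartAt 𝓘(ℝ, E) (X p) (X q))) p :=
    ContDiffAt.comp p ((hη (X p)).contDiffAt ((isOpen_extChartAt_target (X p)).mem_nhds
      ((extChartAt 𝓘(ℝ, E) (X p)).map_source hp))) hc
  have h2 : ContDiffAt ℝ ∞ (fderiv ℝ (fun q => extChartAt 𝓘(ℝ, E) (X p) (X q))) p :=
    hc.fderiv_right (by simp)
  have h3 : ContDiffAt ℝ ∞ (fun q => (ContinuousAlternatingMap.toContinuousMultilinearMapCLM ℝ
      (chartRep η (X p) (extChartAt 𝓘(ℝ, E) (X p) (X q)))).compContinuousLinearMap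
      fun _ : Fin k => fderiv ℝ (fun q => extChartAt 𝓘(ℝ, E) (X p) (X q)) q) p := by
    refine ContDiffAt.comp p (ContinuousMultilinearMap.analyticAt_uncurry_compContinuousLinearMap).contDiffAt
      (ContDiffAt.prodMk (contDiffAt_pi.2 fun _ => h2)
        ((ContinuousLinearMap.contDiff _).contDiffAt.comp p h1))
  exact (ContinuousMultilinearMap.apply ℝ (fun _ : Fin k => F) V v).contDiff.contDiffAt.comp p h3

theorem IsSmoothForm.differentiable_formPullback
    {η : ∀ x : M, TangentSpace 𝓘(ℝ, E) x [⋀^Fin k]→L[ℝ] V} (hη : IsSmoothForm η) {X : F → M}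
    (hX : ContMDiff 𝓘(ℝ, F) 𝓘(ℝ, E) ∞ X) : Differentiable ℝ (formPullback X η) := fun p => by
  have hp := mem_extChartAt_source (I := 𝓘(ℝ, E)) (X p)
  refine DifferentiableAt.congr_of_eventuallyEq ?_ (formPullback_eventuallyEq hX η (X p) hp)
  have hc := contDiffAt_extChartAt_comp hX (X p) hp
  have h1 : ContDiffAt ℝ ∞ (fun q => chartRep η (X p) (extChartAt 𝓘(ℝ, E) (X p) (X q))) p :=
    ContDiffAt.comp p ((hη (X p)).contDiffAt ((isOpen_extChartAt_target (X p)).mem_nhds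
      ((extChartAt 𝓘(ℝ, E) (X p)).map_source hp))) hc
  have h2 : ContDiffAt ℝ ∞ (fderiv ℝ (fun q => extChartAt 𝓘(ℝ, E) (X p) (X q))) p :=
    hc.fderiv_right (by simp)
  exact (h1.differentiableAt (by simp)).continuousAlternatingMapCompContinuousLinearMap
    (h2.differentiableAt (by simp))

/-- Naturality of `d`: in the chart at `X p`, the one in which `exteriorDeriv` is computed at that
point, it is `extDeriv_pullback`. -/
theorem IsSmoothForm.extDeriv_formPullback
    {η : ∀ x : M, TangentSpace 𝓘(ℝ, E) x [⋀^Fin k]→L[ℝ] V} (hη : IsSmoothForm η) {X : F → M}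
    (hX : ContMDiff 𝓘(ℝ, F) 𝓘(ℝ, E) ∞ X) (p : F) :
    extDeriv (formPullback X η) p = formPullback X (_root_.exteriorDeriv η) p := by
  have hp := mem_extChartAt_source (I := 𝓘(ℝ, E)) (X p)
  have hc := contDiffAt_extChartAt_comp hX (X p) hp
  have hd : DifferentiableAt ℝ (chartRep η (X p)) (extChartAt 𝓘(ℝ, E) (X p) (X p)) :=
    ((hη (X p)).contDiffAt ((isOpen_extChartAt_target (X p)).mem_nhds
      ((extChartAt 𝓘(ℝ, E) (X p)).map_source hp))).differentiableAt (by simp)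
  rw [(formPullback_eventuallyEq hX η (X p) hp).extDeriv_eq, extDeriv_pullback (E := F) (F := E)
    (f := fun q => extChartAt 𝓘(ℝ, E) (X p) (X q)) hd hc (by
    rw [minSmoothness_of_isRCLikeNormedField]; exact WithTop.coe_le_coe.2 le_top)]
  have hcomp : fderiv ℝ (fun q => extChartAt 𝓘(ℝ, E) (X p) (X q)) p =
      (mfderiv 𝓘(ℝ, E) 𝓘(ℝ, E) (extChartAt 𝓘(ℝ, E) (X p)) (X p) : E →L[ℝ] E) ∘L
      (mfderiv 𝓘(ℝ, F) 𝓘(ℝ, E) X p : F →L[ℝ] E) := by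
    refine (mfderiv_eq_fderiv (f := fun q => extChartAt 𝓘(ℝ, E) (X p) (X q)) (x := p)).symm.trans ?_
    exact mfderiv_comp p ((contMDiffAt_extChartAt (I := 𝓘(ℝ, E)) (n := ∞)).mdifferentiableAt (by simp))
      ((hX p).mdifferentiableAt (by simp))
  rw [hcomp]
  rfl

end

/-- The exterior derivative of a 1-form on a normed space. -/
theorem extDeriv_one_apply {F V : Type*} [NormedAddCommGroup F] [NormedSpace ℝ F]
    [NormedAddCommGroup V] [NormedSpace ℝ V] {η : F → F [⋀^Fin 1]→L[ℝ] V} {p : F}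
    (hη : DifferentiableAt ℝ η p) (u v : F) :
    extDeriv η p ![u, v] =
      fderiv ℝ (fun q => η q ![v]) p u - fderiv ℝ (fun q => η q ![u]) p v := by
  rw [extDeriv_apply hη, Fin.sum_univ_two]
  have h0 : (0 : Fin 2).removeNth ![u, v] = ![v] := by ext i; fin_cases i; rfl
  have h1 : (1 : Fin 2).removeNth ![u, v] = ![u] := by ext i; fin_cases i; rfl
  simp [h0, h1, sub_eq_add_neg]

/-! ### Partial derivatives of functions of two real variables -/

section
variable {V : Type*} [NormedAddCommGroup V] [NormedSpace ℝ V]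

theorem ContDiff.hasDerivAt_uncurry_left {G : ℝ → ℝ → V} (hG : ContDiff ℝ ∞ (Function.uncurry G))
    (τ σ : ℝ) : HasDerivAt (fun τ => G τ σ) (fderiv ℝ (Function.uncurry G) (τ, σ) (1, 0)) τ :=
  ((hG.differentiable (by simp)) (τ, σ)).hasFDerivAt.comp_hasDerivAt τ
    (f := fun τ => (τ, σ)) ((hasDerivAt_id τ).prodMk (hasDerivAt_const τ σ))

theorem ContDiff.hasDerivAt_uncurry_right {G : ℝ → ℝ → V} (hG : ContDiff ℝ ∞ (Function.uncurry G))
    (τ σ : ℝ) : HasDerivAt (G τ) (fderiv ℝ (Function.uncurry G) (τ, σ) (0, 1)) σ :=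
  ((hG.differentiable (by simp)) (τ, σ)).hasFDerivAt.comp_hasDerivAt σ
    (f := fun σ => (τ, σ)) ((hasDerivAt_const σ τ).prodMk (hasDerivAt_id σ))

theorem ContDiff.continuous_fderiv_uncurry {G : ℝ → ℝ → V}
    (hG : ContDiff ℝ ∞ (Function.uncurry G)) (v : ℝ × ℝ) :
    Continuous (Function.uncurry fun τ σ => fderiv ℝ (Function.uncurry G) (τ, σ) v) :=
  (hG.continuous_fderiv (by simp)).clm_apply continuous_const

end

/-! ### Variation of transport and of Chen integrals -/

section
variable {R : Type*} [NormedRing R] [NormedAlgebra ℝ R] [CompleteSpace R]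

/-- The derivative of the path-ordered exponential in a direction which is the sum of a curvature
`F` and of the covariant derivative of `k`. -/
theorem pathExpDeriv_eq_of_curvature {f k k' φ F : ℝ → R} (hf : Continuous f)
    (hφ : Continuous φ) (hF : Continuous F)
    (hk : ∀ x, HasDerivAt k (k' x) x) (hcurv : ∀ x, φ x = F x + k' x - k x * f x + f x * k x)
    {c : ℝ} (hc : k c = 0) (x : ℝ) :
    pathExpDeriv f φ c x = pathExp f c x * k x + pathExpDeriv f F c x := by
  have hU := continuous_pathExp hf c
  have hv := continuous_pathExp_left hf c
  have hint : ∀ ψ : ℝ → R, Continuous ψ → IntervalIntegrable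
      (fun y => pathExp f c y * ψ y * pathExp f y c) MeasureTheory.volume c x := fun ψ hψ =>
    ((hU.mul hψ).mul hv).intervalIntegrable _ _
  -- With `U = pathExp f c`, the derivative of `U k U⁻¹` is `U (k' - k f + f k) U⁻¹`, which is `U (φ
  -- - F) U⁻¹`; the boundary value at `c` vanishes.
  have key : ∫ y in c..x, (pathExp f c y * φ y * pathExp f y c -
      pathExp f c y * F y * pathExp f y c) = pathExp f c x * k x * pathExp f x c := by
    rw [intervalIntegral.integral_eq_sub_of_hasDerivAt
      (f := fun y => pathExp f c y * k y * pathExp f y c)]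
    · simp [hc]
    · intro y _
      refine (((hasDerivAt_pathExp hf c y).mul (hk y)).mul
        (hasDerivAt_pathExp_left hf c y)).congr_deriv ?_
      simp only [Pi.mul_apply]
      rw [hcurv y]
      noncomm_ring
    · exact (hint φ hφ).sub (hint F hF)
  rw [intervalIntegral.integral_sub (hint φ hφ) (hint F hF), sub_eq_iff_eq_add] at key
  rw [pathExpDeriv, key, add_mul, mul_assoc, pathExp_mul_pathExp_swap hf, mul_one, pathExpDeriv]

end

section
variable {V : Type*} [NormedAddCommGroup V] [NormedSpace ℝ V] [CompleteSpace V]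

/-- Integrating `(U b)' = U b' + U f b` completes `a'` to the covariant expression `D` and leaves a
boundary value at `0`; the variation of `U` supplies `U k a` and the curvature term. For the
application, `a` and `b` are the components of a 1-form along the path and across it, `f` and `k`
those of the connection. -/
theorem integral_pathExp_variation {f k k' φ F : ℝ → V →L[ℝ] V} {a b a' b' D : ℝ → V}
    (hf : Continuous f) (hφ : Continuous φ) (hF : Continuous F) (hk : ∀ x, HasDerivAt k (k' x) x)
    (hcurv : ∀ x, φ x = F x + k' x - k x * f x + f x * k x) (hk1 : k 1 = 0)
    (ha : Continuous a) (ha' : Continuous a') (hb : ∀ x, HasDerivAt b (b' x) x)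
    (hb' : Continuous b') (hb1 : b 1 = 0)
    (hD : ∀ x, D x = a' x - b' x + k x (a x) - f x (b x)) :
    ∫ x in (0 : ℝ)..1, (pathExpDeriv f φ 1 x (a x) + pathExp f 1 x (a' x)) =
      -(pathExp f 1 0 (b 0)) +
        ∫ x in (0 : ℝ)..1, (pathExp f 1 x (D x) + pathExpDeriv f F 1 x (a x)) := by
  have hU := continuous_pathExp hf 1
  have hbc : Continuous b := continuous_iff_continuousAt.2 fun x => (hb x).continuousAt
  have key : ∫ x in (0 : ℝ)..1, (pathExp f 1 x (b' x) + (pathExp f 1 x * f x) (b x)) =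
      -(pathExp f 1 0 (b 0)) := by
    rw [intervalIntegral.integral_eq_sub_of_hasDerivAt (f := fun y => pathExp f 1 y (b y))]
    · simp [hb1]
    · intro y _
      refine ((hasDerivAt_pathExp hf 1 y).clm_apply (hb y)).congr_deriv ?_
      rw [add_comm]
    · exact ((hU.clm_apply hb').add ((hU.mul hf).clm_apply hbc)).intervalIntegrable _ _
  rw [← key, ← intervalIntegral.integral_add]
  · refine intervalIntegral.integral_congr fun x _ => ?_
    rw [pathExpDeriv_eq_of_curvature hf hφ hF hk hcurv hk1 x, hD x]
    simp only [add_apply, mul_apply_eq_comp, map_add, map_sub]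
    abel
  · exact ((hU.clm_apply hb').add ((hU.mul hf).clm_apply hbc)).intervalIntegrable _ _
  · have hkc : Continuous k := continuous_iff_continuousAt.2 fun x => (hk x).continuousAt
    have hDc : Continuous D := by
      rw [funext hD]
      exact ((ha'.sub hb').add (hkc.clm_apply ha)).sub (hf.clm_apply hbc)
    have hdc : Continuous (pathExpDeriv f F 1) := continuous_iff_continuousAt.2 fun x =>
      (hasDerivAt_pathExpDeriv hf hF 1 x).continuousAt
    exact ((hU.clm_apply hDc).add (hdc.clm_apply ha)).intervalIntegrable _ _

end

/-! ### Forms pulled back to the plane of a curve of paths -/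

instance {L : Type*} [FinDimLieAlgebra L] : CompleteSpace L := FiniteDimensional.complete ℝ L

section
variable {E M V V₁ V₂ : Type*} [NormedAddCommGroup E] [NormedSpace ℝ E] [TopologicalSpace M]
  [ChartedSpace E M] [NormedAddCommGroup V] [NormedSpace ℝ V] [NormedAddCommGroup V₁]
  [NormedSpace ℝ V₁] [NormedAddCommGroup V₂] [NormedSpace ℝ V₂] {k : ℕ}

/-- The component along the constant vectors `v` of the pullback of a form along a map of the
plane. -/
def DiffForm.planePart (η : DiffForm E M V k) (S : ℝ → ℝ → M) (v : Fin k → ℝ × ℝ) (τ σ : ℝ) : V :=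
  formPullback (Function.uncurry S) η.toFun (τ, σ) v

/-- A curve in path space, as a map of the plane, without conditions on the end points. -/
def SmoothPlane (E : Type*) {M : Type*} [NormedAddCommGroup E] [NormedSpace ℝ E]
    [TopologicalSpace M] [ChartedSpace E M] (S : ℝ → ℝ → M) : Prop :=
  ContMDiff 𝓘(ℝ, ℝ × ℝ) 𝓘(ℝ, E) ∞ (Function.uncurry S)

theorem SmoothPlane.velocity_right {S : ℝ → ℝ → M} (hS : SmoothPlane E S) (τ σ : ℝ) :
    velocity (E := E) (S τ) σ =
      mfderiv 𝓘(ℝ, ℝ × ℝ) 𝓘(ℝ, E) (Function.uncurry S) (τ, σ) ((0 : ℝ), (1 : ℝ)) := by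
  have h := HasMFDerivAt.comp σ (f := fun σ : ℝ => (τ, σ)) (I := 𝓘(ℝ, ℝ)) (I' := 𝓘(ℝ, ℝ × ℝ))
    ((hS (τ, σ)).mdifferentiableAt (by simp)).hasMFDerivAt
    (((hasDerivAt_const σ τ).prodMk (hasDerivAt_id σ)).hasFDerivAt.hasMFDerivAt)
  have h2 := h.mfderiv
  unfold velocity
  exact (congrArg (fun L : ℝ →L[ℝ] E => L 1) h2).trans (congrArg
    (mfderiv 𝓘(ℝ, ℝ × ℝ) 𝓘(ℝ, E) (Function.uncurry S) (τ, σ) : ℝ × ℝ →L[ℝ] E)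
    (one_smul ℝ ((0 : ℝ), (1 : ℝ))))

theorem SmoothPlane.velocity_left {S : ℝ → ℝ → M} (hS : SmoothPlane E S) (τ σ : ℝ) :
    velocity (E := E) (fun τ => S τ σ) τ =
      mfderiv 𝓘(ℝ, ℝ × ℝ) 𝓘(ℝ, E) (Function.uncurry S) (τ, σ) ((1 : ℝ), (0 : ℝ)) := by
  have h := HasMFDerivAt.comp τ (f := fun τ : ℝ => (τ, σ)) (I := 𝓘(ℝ, ℝ)) (I' := 𝓘(ℝ, ℝ × ℝ))
    ((hS (τ, σ)).mdifferentiableAt (by simp)).hasMFDerivAt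
    (((hasDerivAt_id τ).prodMk (hasDerivAt_const τ σ)).hasFDerivAt.hasMFDerivAt)
  have h2 := h.mfderiv
  unfold velocity
  exact (congrArg (fun L : ℝ →L[ℝ] E => L 1) h2).trans (congrArg
    (mfderiv 𝓘(ℝ, ℝ × ℝ) 𝓘(ℝ, E) (Function.uncurry S) (τ, σ) : ℝ × ℝ →L[ℝ] E)
    (one_smul ℝ ((1 : ℝ), (0 : ℝ))))

namespace DiffForm
variable {S : ℝ → ℝ → M}

theorem planePart_add (η η' : DiffForm E M V k) (v : Fin k → ℝ × ℝ) (τ σ : ℝ) :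
    (η + η').planePart S v τ σ = η.planePart S v τ σ + η'.planePart S v τ σ := rfl

theorem planePart_sub (η η' : DiffForm E M V k) (v : Fin k → ℝ × ℝ) (τ σ : ℝ) :
    (η - η').planePart S v τ σ = η.planePart S v τ σ - η'.planePart S v τ σ := rfl

theorem planePart_smul (c : ℝ) (η : DiffForm E M V k) (v : Fin k → ℝ × ℝ) (τ σ : ℝ) :
    (c • η).planePart S v τ σ = c • η.planePart S v τ σ := rfl

theorem planePart_map (L : V →L[ℝ] V₁) (η : DiffForm E M V k) (v : Fin k → ℝ × ℝ) (τ σ : ℝ) :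
    (η.map L).planePart S v τ σ = L (η.planePart S v τ σ) := rfl

theorem planePart_wedge (β : V₁ →L[ℝ] V₂ →L[ℝ] V) (a : DiffForm E M V₁ 1) (b : DiffForm E M V₂ 1)
    (v w : ℝ × ℝ) (τ σ : ℝ) : (wedge β a b).planePart S ![v, w] τ σ =
      β (a.planePart S ![v] τ σ) (b.planePart S ![w] τ σ) -
        β (a.planePart S ![w] τ σ) (b.planePart S ![v] τ σ) := by
  exact DFunLike.congr_fun (wedge11_comp β (a.toFun (S τ σ)) (b.toFun (S τ σ))
    (mfderiv 𝓘(ℝ, ℝ × ℝ) 𝓘(ℝ, E) (Function.uncurry S) (τ, σ))) ![v, w]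

theorem planePart_swap (η : DiffForm E M V 2) (v w : ℝ × ℝ) (τ σ : ℝ) :
    η.planePart S ![w, v] τ σ = -η.planePart S ![v, w] τ σ := by
  have h := (formPullback (Function.uncurry S) η.toFun (τ, σ)).map_swap ![v, w]
    (i := 0) (j := 1) (by simp)
  refine Eq.trans (congrArg
    (formPullback (Function.uncurry S) η.toFun (τ, σ)).toAlternatingMap ?_) h
  ext i <;> fin_cases i <;> simp

theorem toFun_velocity (hS : SmoothPlane E S) (η : DiffForm E M V 1) (τ σ : ℝ) :
    η.toFun (S τ σ) ![velocity (S τ) σ] = η.planePart S ![(0, 1)] τ σ := by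
  rw [hS.velocity_right]
  show _ = η.toFun (S τ σ) (_ ∘ _)
  congr 1
  ext i
  fin_cases i
  rfl

theorem toFun_velocity_elim (hS : SmoothPlane E S) (η : DiffForm E M V 1) (τ σ : ℝ)
    (D : Fin 0 → TangentSpace 𝓘(ℝ, E) (S τ σ)) :
    η.toFun (S τ σ) (Matrix.vecCons (velocity (S τ) σ) D) = η.planePart S ![(0, 1)] τ σ := by
  rw [← toFun_velocity hS, Subsingleton.elim D ![]]

theorem toFun_velocity_velocity (hS : SmoothPlane E S) (η : DiffForm E M V 2) (τ σ : ℝ) :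
    η.toFun (S τ σ) (Matrix.vecCons (velocity (S τ) σ) fun _ : Fin 1 => velocity (fun τ => S τ σ) τ) =
      η.planePart S ![(0, 1), (1, 0)] τ σ := by
  rw [hS.velocity_right, hS.velocity_left]
  show _ = η.toFun (S τ σ) (_ ∘ _)
  congr 1
  ext i
  fin_cases i <;> rfl

variable [IsManifold 𝓘(ℝ, E) ∞ M]

theorem contDiff_planePart [CompleteSpace V] (hS : SmoothPlane E S) (η : DiffForm E M V k)
    (v : Fin k → ℝ × ℝ) : ContDiff ℝ ∞ (Function.uncurry (η.planePart S v)) :=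
  η.smooth.contDiff_formPullback_apply hS v

theorem continuous_planePart [CompleteSpace V] (hS : SmoothPlane E S) (η : DiffForm E M V k)
    (v : Fin k → ℝ × ℝ) : Continuous (Function.uncurry (η.planePart S v)) :=
  (contDiff_planePart hS η v).continuous

/-- The coordinate fields of the plane are constant, so no bracket term appears. -/
theorem planePart_d (hS : SmoothPlane E S) (η : DiffForm E M V 1) (τ σ : ℝ) :
    η.d.planePart S ![(1, 0), (0, 1)] τ σ =
      fderiv ℝ (Function.uncurry (η.planePart S ![(0, 1)])) (τ, σ) (1, 0) -
        fderiv ℝ (Function.uncurry (η.planePart S ![(1, 0)])) (τ, σ) (0, 1) := by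
  have h := η.smooth.extDeriv_formPullback hS (τ, σ)
  have h2 := extDeriv_one_apply (η.smooth.differentiable_formPullback hS (τ, σ))
    ((1 : ℝ), (0 : ℝ)) ((0 : ℝ), (1 : ℝ))
  rw [h] at h2
  exact h2

end DiffForm

end

/-! ### Crossed module identities -/

namespace DifferentialCrossedModule
variable {g h : Type*} [FinDimLieAlgebra g] [FinDimLieAlgebra h]

@[simp]
theorem dαCLM_apply (C : DifferentialCrossedModule g h) (x : g) (y : h) :
    C.dαCLM x y = C.dα x y := rfl

@[simp]
theorem dtCLM_apply (C : DifferentialCrossedModule g h) (y : h) : C.dtCLM y = C.dt y := rfl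

@[simp]
theorem bracketCLM_apply (x y : g) : bracketCLM g x y = ⁅x, y⁆ := rfl

theorem dαCLM_lie (C : DifferentialCrossedModule g h) (x y : g) :
    C.dαCLM ⁅x, y⁆ = C.dαCLM x * C.dαCLM y - C.dαCLM y * C.dαCLM x := by
  ext z
  simp

/-- The Peiffer identity: elements of `dt(h)` act by inner derivations. Through it both `dt(B)` in
the fake curvature and `dt(a)` in the transformed connection become brackets. -/
theorem dαCLM_dt (C : DifferentialCrossedModule g h) (y : h) :
    C.dαCLM (C.dt y) = bracketCLM h y := by
  ext z
  simp [C.peiffer]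

theorem dαCLM_bracket (C : DifferentialCrossedModule g h) (x : g) (y z : h) :
    C.dαCLM x ⁅y, z⁆ = ⁅C.dαCLM x y, z⁆ + ⁅y, C.dαCLM x z⁆ := by
  simp only [dαCLM_apply]
  rw [LieDerivation.apply_lie_eq_add, add_comm]

end DifferentialCrossedModule

/-- The path-ordered exponential of derivations is an automorphism of Lie algebras. -/
theorem pathExp_derivation_lie {h : Type*} [FinDimLieAlgebra h] {f : ℝ → h →L[ℝ] h}
    (hf : Continuous f) (hder : ∀ x y z, f x ⁅y, z⁆ = ⁅f x y, z⁆ + ⁅y, f x z⁆) (c x : ℝ) (y z : h) :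
    pathExp f c x ⁅y, z⁆ = ⁅pathExp f c x y, pathExp f c x z⁆ := by
  have hinv : ∀ a b w, pathExp f a b (pathExp f b a w) = w := fun a b w => by
    rw [← mul_apply_eq_comp, pathExp_mul_pathExp_swap hf]; rfl
  -- The bracket conjugated by transport has zero derivative in `s`, by the derivation property of
  -- `f`, and at `s = c` it is the original bracket.
  have hconst : ∀ y z s, pathExp f c s (bracketCLM h (pathExp f s c y) (pathExp f s c z)) =
      bracketCLM h y z := fun y z s => by
    have hd : ∀ s, HasDerivAt (fun s => pathExp f c s
        (bracketCLM h (pathExp f s c y) (pathExp f s c z))) 0 s := fun s => by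
      have hv := hasDerivAt_pathExp_left hf c s
      have h1 : ∀ w, HasDerivAt (fun s => pathExp f s c w) (-(f s * pathExp f s c) w) s := fun w =>
        (hv.clm_apply (hasDerivAt_const s w)).congr_deriv (by simp)
      have h2 := ((bracketCLM h).hasFDerivAt.comp_hasDerivAt s (h1 y)).clm_apply (h1 z)
      refine ((hasDerivAt_pathExp hf c s).clm_apply h2).congr_deriv ?_
      simp only [mul_apply_eq_comp, map_neg, neg_apply, Function.comp_apply,
        DifferentialCrossedModule.bracketCLM_apply, hder, map_add]
      abel
    have := is_const_of_deriv_eq_zero (fun s => (hd s).differentiableAt) (fun s => (hd s).deriv) s c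
    simpa using this
  have := hconst (pathExp f c x y) (pathExp f c x z) x
  rw [hinv, hinv] at this
  exact this

/-! ### Variation of transport and of Chen integrals along a curve of paths -/

section
variable {E M g h : Type*} [NormedAddCommGroup E] [NormedSpace ℝ E] [TopologicalSpace M]
  [ChartedSpace E M] [FinDimLieAlgebra g] [FinDimLieAlgebra h]

/-- The endomorphism of `h` by which the component of the connection `A` along the constant
vector `v` of the plane acts. -/
def connEnd (C : DifferentialCrossedModule g h) (A : DiffForm E M g 1) (S : ℝ → ℝ → M)
    (v : ℝ × ℝ) (τ σ : ℝ) : h →L[ℝ] h :=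
  C.dαCLM (A.planePart S ![v] τ σ)

variable {C : DifferentialCrossedModule g h} {A : DiffForm E M g 1} {S : ℝ → ℝ → M}

theorem transport_eq (hS : SmoothPlane E S) (τ σ : ℝ) :
    transport C A (S τ) σ = pathExp (connEnd C A S (0, 1) τ) 1 σ := by
  unfold transport connEnd
  congr 1
  exact funext fun y => congrArg _ (DiffForm.toFun_velocity hS A τ y)

theorem chenForm_zero_eq (hS : SmoothPlane E S) (a : DiffForm E M h 1) (τ : ℝ) :
    (chenForm C A a (S τ) fun i => i.elim0) = ∫ σ in (0 : ℝ)..1,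
      pathExp (connEnd C A S (0, 1) τ) 1 σ (a.planePart S ![(0, 1)] τ σ) := by
  refine intervalIntegral.integral_congr fun σ _ => ?_
  refine (congrArg _ (DiffForm.toFun_velocity_elim hS a τ σ _)).trans ?_
  rw [transport_eq hS]

theorem standardConnection_eq (hS : SmoothPlane E S) (P : OneTwoForm E M g h) (τ : ℝ) :
    (standardConnection C P (S τ) fun σ => velocity (fun τ' => S τ' σ) τ) = ∫ σ in (0 : ℝ)..1,
      pathExp (connEnd C P.A S (0, 1) τ) 1 σ (P.B.planePart S ![(0, 1), (1, 0)] τ σ) := by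
  refine intervalIntegral.integral_congr fun σ _ => ?_
  refine (congrArg _ (DiffForm.toFun_velocity_velocity hS P.B τ σ)).trans ?_
  rw [transport_eq hS]

theorem connEnd_derivation (v : ℝ × ℝ) (τ σ : ℝ) (y z : h) :
    connEnd C A S v τ σ ⁅y, z⁆ = ⁅connEnd C A S v τ σ y, z⁆ + ⁅y, connEnd C A S v τ σ z⁆ :=
  C.dαCLM_bracket _ y z

variable [IsManifold 𝓘(ℝ, E) ∞ M]

theorem contDiff_connEnd (hS : SmoothPlane E S) (v : ℝ × ℝ) :
    ContDiff ℝ ∞ (Function.uncurry (connEnd C A S v)) :=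
  C.dαCLM.contDiff.comp (DiffForm.contDiff_planePart hS A ![v])

theorem continuous_uncurry_connEnd (hS : SmoothPlane E S) (v : ℝ × ℝ) :
    Continuous (Function.uncurry (connEnd C A S v)) := (contDiff_connEnd hS v).continuous

theorem continuous_connEnd (hS : SmoothPlane E S) (v : ℝ × ℝ) (τ : ℝ) :
    Continuous (connEnd C A S v τ) :=
  (continuous_uncurry_connEnd hS v).comp (Continuous.prodMk_right τ)

theorem continuous_planePart_right {V : Type*} [NormedAddCommGroup V] [NormedSpace ℝ V]
    [CompleteSpace V] {k : ℕ} (hS : SmoothPlane E S) (η : DiffForm E M V k) (v : Fin k → ℝ × ℝ)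
    (τ : ℝ) : Continuous (η.planePart S v τ) :=
  (η.continuous_planePart hS v).comp (Continuous.prodMk_right τ)

theorem fderiv_connEnd (hS : SmoothPlane E S) (v w z : ℝ × ℝ) :
    fderiv ℝ (Function.uncurry (connEnd C A S v)) z w =
      C.dαCLM (fderiv ℝ (Function.uncurry (A.planePart S ![v])) z w) := by
  have h := (C.dαCLM.hasFDerivAt.comp z
    ((A.contDiff_planePart hS ![v]).differentiable (by simp) z).hasFDerivAt).fderiv
  exact DFunLike.congr_fun h w

/-- The endomorphism by which the curvature acts, on the coordinate vectors of the plane. -/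
def curvEnd (C : DifferentialCrossedModule g h) (A : DiffForm E M g 1) (S : ℝ → ℝ → M)
    (τ σ : ℝ) : h →L[ℝ] h :=
  C.dαCLM ((curvature A).planePart S ![(1, 0), (0, 1)] τ σ)

/-- The factor `1 / 2` disappears because the wedge of `A` with itself produces the bracket twice.
-/
theorem curvature_planePart (v w : ℝ × ℝ) (τ σ : ℝ) :
    (curvature A).planePart S ![v, w] τ σ = A.d.planePart S ![v, w] τ σ +
      ⁅A.planePart S ![v] τ σ, A.planePart S ![w] τ σ⁆ := by
  rw [curvature, DiffForm.planePart_add, DiffForm.planePart_smul, DiffForm.planePart_wedge]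
  simp only [DifferentialCrossedModule.bracketCLM_apply]
  rw [← lie_skew (A.planePart S ![w] τ σ), sub_neg_eq_add, ← two_smul ℝ, smul_smul]
  norm_num

theorem covDeriv_planePart (a : DiffForm E M h 1) (v w : ℝ × ℝ) (τ σ : ℝ) :
    (covDeriv C A a).planePart S ![v, w] τ σ = a.d.planePart S ![v, w] τ σ +
      (connEnd C A S v τ σ (a.planePart S ![w] τ σ) -
        connEnd C A S w τ σ (a.planePart S ![v] τ σ)) := by
  rw [covDeriv, DiffForm.planePart_add, DiffForm.planePart_wedge]
  rfl

/-- The structure equation `F = ∂_τ A_σ - ∂_σ A_τ + [A_τ, A_σ]` under `dα`, in the shape of the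
hypothesis `hcurv` of `pathExpDeriv_eq_of_curvature` with `k = A_τ`. -/
theorem curvEnd_identity (hS : SmoothPlane E S) (τ σ : ℝ) :
    fderiv ℝ (Function.uncurry (connEnd C A S (0, 1))) (τ, σ) (1, 0) = curvEnd C A S τ σ +
      fderiv ℝ (Function.uncurry (connEnd C A S (1, 0))) (τ, σ) (0, 1) -
      connEnd C A S (1, 0) τ σ * connEnd C A S (0, 1) τ σ +
      connEnd C A S (0, 1) τ σ * connEnd C A S (1, 0) τ σ := by
  rw [curvEnd, curvature_planePart, DiffForm.planePart_d hS, map_add, map_sub, C.dαCLM_lie,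
    fderiv_connEnd hS, fderiv_connEnd hS]
  simp only [connEnd]
  abel

theorem continuous_curvEnd (hS : SmoothPlane E S) (τ : ℝ) : Continuous (curvEnd C A S τ) :=
  C.dαCLM.continuous.comp (continuous_planePart_right hS _ _ τ)

theorem hasDerivAt_transport (hS : SmoothPlane E S) {τ σ : ℝ} (hσ : |σ - 1| ≤ 1)
    (hk : connEnd C A S (1, 0) τ 1 = 0) :
    HasDerivAt (fun τ => pathExp (connEnd C A S (0, 1) τ) 1 σ)
      (pathExp (connEnd C A S (0, 1) τ) 1 σ * connEnd C A S (1, 0) τ σ +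
        pathExpDeriv (connEnd C A S (0, 1) τ) (curvEnd C A S τ) 1 σ) τ := by
  have hf := contDiff_connEnd (C := C) (A := A) hS (0, 1)
  have hk' := contDiff_connEnd (C := C) (A := A) hS (1, 0)
  have hφ := hf.continuous_fderiv_uncurry (1, 0)
  refine (hasDerivAt_pathExp_param hf.continuous hφ (fun q t => hf.hasDerivAt_uncurry_left q t)
    τ hσ).congr_deriv ?_
  exact pathExpDeriv_eq_of_curvature (continuous_connEnd hS _ τ)
    (hφ.comp (Continuous.prodMk_right τ)) (continuous_curvEnd hS τ)
    (fun x => hk'.hasDerivAt_uncurry_right τ x) (fun x => curvEnd_identity hS τ x) hk σ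

/-- Both hypotheses concern only the final point. The boundary term at the initial point is kept: it
vanishes on based path spaces, but it carries all the information once the initial point moves. -/
theorem hasDerivAt_chenForm_zero (hS : SmoothPlane E S) (a : DiffForm E M h 1) {τ : ℝ}
    (hk : connEnd C A S (1, 0) τ 1 = 0) (ha1 : a.planePart S ![(1, 0)] τ 1 = 0) :
    HasDerivAt (fun τ => ∫ σ in (0 : ℝ)..1,
        pathExp (connEnd C A S (0, 1) τ) 1 σ (a.planePart S ![(0, 1)] τ σ))
      (-(pathExp (connEnd C A S (0, 1) τ) 1 0 (a.planePart S ![(1, 0)] τ 0)) +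
        ∫ σ in (0 : ℝ)..1, (pathExp (connEnd C A S (0, 1) τ) 1 σ
            ((covDeriv C A a).planePart S ![(1, 0), (0, 1)] τ σ) +
          pathExpDeriv (connEnd C A S (0, 1) τ) (curvEnd C A S τ) 1 σ
            (a.planePart S ![(0, 1)] τ σ))) τ := by
  have hf := contDiff_connEnd (C := C) (A := A) hS (0, 1)
  have hk' := contDiff_connEnd (C := C) (A := A) hS (1, 0)
  have hφ := hf.continuous_fderiv_uncurry (1, 0)
  have haσ := a.contDiff_planePart hS ![(0, 1)]
  have haτ := a.contDiff_planePart hS ![(1, 0)]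
  have hU := continuous_uncurry_pathExp hf.continuous 1
  have hUd := continuous_uncurry_pathExpDeriv hf.continuous hφ 1
  have haσ' := haσ.continuous_fderiv_uncurry (1, 0)
  have haτ' := haτ.continuous_fderiv_uncurry (0, 1)
  have hder := hasDerivAt_intervalIntegral_param (p := τ) (a := 0) (b := 1)
    (F := fun q t => pathExp (connEnd C A S (0, 1) q) 1 t (a.planePart S ![(0, 1)] q t))
    (F' := fun q t => pathExpDeriv (connEnd C A S (0, 1) q)
        (fun t => fderiv ℝ (Function.uncurry (connEnd C A S (0, 1))) (q, t) (1, 0)) 1 t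
        (a.planePart S ![(0, 1)] q t) + pathExp (connEnd C A S (0, 1) q) 1 t
        (fderiv ℝ (Function.uncurry (a.planePart S ![(0, 1)])) (q, t) (1, 0)))
    (hU.clm_apply haσ.continuous) ((hUd.clm_apply haσ.continuous).add (hU.clm_apply haσ'))
    (fun q t ht => ?_)
  · refine hder.congr_deriv ?_
    refine integral_pathExp_variation (continuous_connEnd hS _ τ)
      (hφ.comp (Continuous.prodMk_right τ)) (continuous_curvEnd hS τ)
      (fun x => hk'.hasDerivAt_uncurry_right τ x) (fun x => curvEnd_identity hS τ x) hk
      (continuous_planePart_right hS a _ τ) (haσ'.comp (Continuous.prodMk_right τ))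
      (fun x => haτ.hasDerivAt_uncurry_right τ x) (haτ'.comp (Continuous.prodMk_right τ)) ha1
      (fun x => ?_)
    rw [covDeriv_planePart, DiffForm.planePart_d hS]
    abel
  · rw [uIcc_of_le zero_le_one] at ht
    exact (hasDerivAt_pathExp_param hf.continuous hφ (fun q t => hf.hasDerivAt_uncurry_left q t) q
      (by rw [abs_le]; constructor <;> linarith [ht.1, ht.2])).clm_apply
        (haσ.hasDerivAt_uncurry_left q t)

end

/-! ### First order gauge transformations of holonomies -/

section
variable {R : Type*} [NormedRing R] [NormedAlgebra ℝ R] [CompleteSpace R]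

/-- The equation for `α` says that `(1 - ε α 0) W (1 + ε α)`, with `W = pathExp X 0`, satisfies the
equation `Z' = Z Y` up to `ε ^ 2`. Its difference from `pathExp (Y ε) 0` is then controlled by
Gronwall. -/
theorem pathExp_gauge_isBigO {X X₁ α : ℝ → R} {Y : ℝ → ℝ → R} {K : ℝ} (hX : Continuous X)
    (hY : ∀ ε, Continuous (Y ε))
    (hα : ∀ τ ∈ Icc (0 : ℝ) 1, HasDerivAt α (X₁ τ - (X τ * α τ - α τ * X τ)) τ)
    (hXK : ∀ τ ∈ Icc (0 : ℝ) 1, ‖X τ‖ ≤ K) (hX₁K : ∀ τ ∈ Icc (0 : ℝ) 1, ‖X₁ τ‖ ≤ K)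
    (hαK : ∀ τ ∈ Icc (0 : ℝ) 1, ‖α τ‖ ≤ K)
    (hYK : ∀ ε : ℝ, |ε| ≤ 1 → ∀ τ ∈ Icc (0 : ℝ) 1, ‖Y ε τ - X τ - ε • X₁ τ‖ ≤ K * ε ^ 2) :
    (fun ε : ℝ => (1 - ε • α 0) * pathExp X 0 1 * (1 + ε • α 1) - pathExp (Y ε) 0 1)
      =O[𝓝 0] fun ε : ℝ => ε ^ 2 := by
  have hK0 : 0 ≤ K := (norm_nonneg _).trans (hXK 0 (left_mem_Icc.2 zero_le_one))
  set N := ‖(1 : R)‖ with hN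
  have hN0 : 0 ≤ N := norm_nonneg _
  set B := (N + K) * (N * Real.exp (K + 1)) with hB
  have hB0 : 0 ≤ B := by positivity
  refine IsBigO.of_bound ((K ^ 2 + B * (K + 2 * K ^ 2)) * Real.exp (3 * K + 1)) ?_
  filter_upwards [Metric.closedBall_mem_nhds (0 : ℝ) one_pos] with ε hε
  have hε1 : |ε| ≤ 1 := by simpa using hε
  have hε2 : ε ^ 2 ≤ |ε| := by rw [← sq_abs]; nlinarith [abs_nonneg ε]
  have hnε : ∀ {x : R} {k : ℝ}, ‖x‖ ≤ k → ‖ε • x‖ ≤ |ε| * k := fun hx => by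
    rw [norm_smul, Real.norm_eq_abs]; gcongr
  have hYX : ∀ τ ∈ Icc (0 : ℝ) 1, ‖Y ε τ - X τ‖ ≤ |ε| * (2 * K) := fun τ hτ => by
    have h1 := norm_add_le (Y ε τ - X τ - ε • X₁ τ) (ε • X₁ τ)
    rw [sub_add_cancel] at h1
    nlinarith [hYK ε hε1 τ hτ, hnε (hX₁K τ hτ)]
  have hY3 : ∀ τ ∈ Icc (0 : ℝ) 1, ‖Y ε τ‖ ≤ 3 * K := fun τ hτ => by
    have h1 := norm_add_le (Y ε τ - X τ) (X τ)
    rw [sub_add_cancel] at h1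
    nlinarith [hYX τ hτ, hXK τ hτ]
  have h01 : uIcc (0 : ℝ) 1 = Icc 0 1 := uIcc_of_le zero_le_one
  have key := norm_le_of_norm_deriv_le
    (y := fun τ => (1 - ε • α 0) * pathExp X 0 τ * (1 + ε • α τ) - pathExp (Y ε) 0 τ)
    (y' := fun τ => ((1 - ε • α 0) * (pathExp X 0 τ * X τ) * (1 + ε • α τ) +
      (1 - ε • α 0) * pathExp X 0 τ * (ε • (X₁ τ - (X τ * α τ - α τ * X τ)))) -
      pathExp (Y ε) 0 τ * Y ε τ)
    (c := 0) (x := 1) (δ := K ^ 2 * ε ^ 2) (K := 3 * K) (ε := B * (K + 2 * K ^ 2) * ε ^ 2)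
    (by positivity) (by positivity) ?_ (fun τ hτ => ?_) (fun τ hτ => ?_)
  · simp only [sub_zero, abs_one, one_mul] at key
    refine key.trans (le_of_eq ?_)
    rw [Real.norm_eq_abs, abs_of_nonneg (sq_nonneg ε)]
    ring
  · have h0 : (0 : ℝ) ∈ Icc (0 : ℝ) 1 := left_mem_Icc.2 zero_le_one
    -- The two infinitesimal factors are inverse only to first order; this is the initial error.
    have he : (1 - ε • α 0) * pathExp X 0 0 * (1 + ε • α 0) - pathExp (Y ε) 0 0 =
        -(ε ^ 2 • (α 0 * α 0)) := by
      simp only [pathExp_self, mul_one, mul_add, sub_mul, smul_mul_assoc, one_mul, mul_smul_comm,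
        smul_sub, smul_smul, sq]
      abel
    rw [he, norm_neg, norm_smul, Real.norm_eq_abs, abs_of_nonneg (sq_nonneg ε), mul_comm, sq K]
    exact mul_le_mul_of_nonneg_right ((norm_mul_le _ _).trans
      (mul_le_mul (hαK 0 h0) (hαK 0 h0) (norm_nonneg _) hK0)) (sq_nonneg ε)
  · rw [h01] at hτ
    exact ((((hasDerivAt_pathExp hX 0 τ).const_mul _).mul
      (((hα τ hτ).const_smul ε).const_add 1))).sub (hasDerivAt_pathExp (hY ε) 0 τ)
  · rw [h01] at hτ
    have hτ1 : |τ - 0| ≤ 1 := by rw [sub_zero, abs_of_nonneg hτ.1]; exact hτ.2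
    have hW := norm_pathExp_le hX hτ1 (K := K) fun z hz => hXK z (by
      rw [uIcc_of_le hτ.1] at hz
      exact ⟨hz.1, hz.2.trans hτ.2⟩)
    have hZ : ‖(1 - ε • α 0) * pathExp X 0 τ‖ ≤ B := by
      refine (norm_mul_le _ _).trans (mul_le_mul ?_ hW (norm_nonneg _) (by positivity))
      refine (norm_sub_le _ _).trans (add_le_add le_rfl ?_)
      refine (hnε (hαK 0 (left_mem_Icc.2 zero_le_one))).trans ?_
      nlinarith
    set Z := (1 - ε • α 0) * pathExp X 0 τ with hZdef
    -- All terms linear in `ε` cancel, by the equation for `α`. What remains is the Gronwall term,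
    -- the second order error of `Y`, and `ε α (Y - X)`, itself of second order.
    have he : (1 - ε • α 0) * (pathExp X 0 τ * X τ) * (1 + ε • α τ) +
        Z * (ε • (X₁ τ - (X τ * α τ - α τ * X τ))) - pathExp (Y ε) 0 τ * Y ε τ =
        (Z * (1 + ε • α τ) - pathExp (Y ε) 0 τ) * Y ε τ +
        Z * (-(Y ε τ - X τ - ε • X₁ τ) + -(ε • (α τ * (Y ε τ - X τ)))) := by
      rw [← mul_assoc, ← hZdef]
      simp only [mul_add, add_mul, mul_sub, sub_mul, smul_mul_assoc, mul_smul_comm, smul_sub,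
        mul_one, mul_assoc, mul_neg]
      abel
    rw [he]
    refine (norm_add_le _ _).trans (add_le_add ((norm_mul_le _ _).trans ?_)
      ((norm_mul_le _ _).trans ?_))
    · rw [mul_comm]
      exact mul_le_mul_of_nonneg_right (hY3 τ hτ) (norm_nonneg _)
    · rw [mul_assoc]
      refine mul_le_mul hZ ?_ (norm_nonneg _) hB0
      refine (norm_add_le _ _).trans ?_
      rw [norm_neg, norm_neg]
      have h1 : ‖ε • (α τ * (Y ε τ - X τ))‖ ≤ |ε| * (K * (|ε| * (2 * K))) :=
        hnε ((norm_mul_le _ _).trans (mul_le_mul (hαK τ hτ) (hYX τ hτ) (norm_nonneg _) hK0))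
      have h2 := hYK ε hε1 τ hτ
      have h3 : |ε| * (K * (|ε| * (2 * K))) = 2 * K ^ 2 * ε ^ 2 := by rw [← sq_abs ε]; ring
      linarith
end

/-! ### Inner derivations and the exchange of `a` and `B` in iterated integrals -/

section
variable {h : Type*} [FinDimLieAlgebra h]

/-- Integration by parts for the bracket of the two primitives based at `1`. The boundary value at
`1` is zero; at `0` the signs of the primitives cancel and give the bracket of the full integrals.
-/
theorem integral_lie_primitive {p q : ℝ → h} (hp : Continuous p) (hq : Continuous q) :
    (∫ x in (0 : ℝ)..1, ⁅∫ y in (1 : ℝ)..x, p y, q x⁆) + ⁅∫ x in (0 : ℝ)..1, p x, ∫ x in (0 : ℝ)..1, q x⁆ =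
      ∫ x in (0 : ℝ)..1, ⁅∫ y in (1 : ℝ)..x, q y, p x⁆ := by
  let β := bracketCLM h
  have hprim : ∀ {r : ℝ → h}, Continuous r → Continuous fun x => ∫ y in (1 : ℝ)..x, r y := fun hr =>
    intervalIntegral.continuous_primitive (fun a b => hr.intervalIntegrable a b) 1
  have hc : ∀ {r s : ℝ → h}, Continuous r → Continuous s → Continuous fun x => β (r x) (s x) :=
    fun hr hs => (β.continuous.comp hr).clm_apply hs
  have key : ∫ x in (0 : ℝ)..1, (β (∫ y in (1 : ℝ)..x, p y) (q x) + β (p x) (∫ y in (1 : ℝ)..x, q y)) =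
      -β (∫ x in (0 : ℝ)..1, p x) (∫ x in (0 : ℝ)..1, q x) := by
    rw [intervalIntegral.integral_eq_sub_of_hasDerivAt
      (f := fun x => β (∫ y in (1 : ℝ)..x, p y) (∫ y in (1 : ℝ)..x, q y))]
    · rw [intervalIntegral.integral_symm 0 1, intervalIntegral.integral_symm (f := q) 0 1]
      simp
    · intro x _
      refine ((β.hasFDerivAt.comp_hasDerivAt x (hp.integral_hasStrictDerivAt 1 x).hasDerivAt).clm_apply
        (hq.integral_hasStrictDerivAt 1 x).hasDerivAt).congr_deriv ?_
      rw [add_comm]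
      rfl
    · exact ((hc (hprim hp) hq).add (hc hp (hprim hq))).intervalIntegrable _ _
  rw [intervalIntegral.integral_add ((hc (hprim hp) hq).intervalIntegrable _ _)
    ((hc hp (hprim hq)).intervalIntegrable _ _), eq_neg_iff_add_eq_zero, add_right_comm,
    ← eq_neg_iff_add_eq_zero, ← intervalIntegral.integral_neg] at key
  refine key.trans (intervalIntegral.integral_congr fun x _ => ?_)
  exact lie_skew _ _

/-- Conjugating an inner derivation by a Lie algebra automorphism transports its generator. -/
theorem pathExp_conj_bracket {f : ℝ → h →L[ℝ] h} (hf : Continuous f)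
    (hder : ∀ x y z, f x ⁅y, z⁆ = ⁅f x y, z⁆ + ⁅y, f x z⁆) (c x : ℝ) (y : h) :
    pathExp f c x * bracketCLM h y * pathExp f x c = bracketCLM h (pathExp f c x y) := by
  ext z
  simp only [mul_apply_eq_comp, DifferentialCrossedModule.bracketCLM_apply]
  rw [pathExp_derivation_lie hf hder, ← mul_apply_eq_comp (pathExp f c x) (pathExp f x c),
    pathExp_mul_pathExp_swap hf]
  rfl

theorem pathExpDeriv_bracket {f : ℝ → h →L[ℝ] h} (hf : Continuous f)
    (hder : ∀ x y z, f x ⁅y, z⁆ = ⁅f x y, z⁆ + ⁅y, f x z⁆) {b : ℝ → h} (hb : Continuous b)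
    (c x : ℝ) :
    pathExpDeriv f (fun x => bracketCLM h (b x)) c x =
      bracketCLM h (∫ y in c..x, pathExp f c y (b y)) * pathExp f c x := by
  rw [pathExpDeriv]
  congr 1
  rw [← ContinuousLinearMap.intervalIntegral_comp_comm (bracketCLM h)
    (((continuous_pathExp hf c).clm_apply hb).intervalIntegrable _ _)]
  exact intervalIntegral.integral_congr fun y _ => pathExp_conj_bracket hf hder c y (b y)

/-- Exchanging the roles of `a` and `b` in the first variation of transport. -/
theorem integral_pathExpDeriv_bracket_comm {f : ℝ → h →L[ℝ] h} (hf : Continuous f)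
    (hder : ∀ x y z, f x ⁅y, z⁆ = ⁅f x y, z⁆ + ⁅y, f x z⁆) {a b : ℝ → h} (ha : Continuous a)
    (hb : Continuous b) :
    (∫ x in (0 : ℝ)..1, pathExpDeriv f (fun x => bracketCLM h (b x)) 1 x (a x)) +
        ⁅∫ x in (0 : ℝ)..1, pathExp f 1 x (b x), ∫ x in (0 : ℝ)..1, pathExp f 1 x (a x)⁆ =
      ∫ x in (0 : ℝ)..1, pathExpDeriv f (fun x => bracketCLM h (a x)) 1 x (b x) := by
  have hU := continuous_pathExp hf 1
  simp only [pathExpDeriv_bracket hf hder ha, pathExpDeriv_bracket hf hder hb]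
  exact integral_lie_primitive (hU.clm_apply hb) (hU.clm_apply ha)

end

/-! ### First order expansion of the transformed connection -/

section
variable {E M g h : Type*} [NormedAddCommGroup E] [NormedSpace ℝ E] [TopologicalSpace M]
  [ChartedSpace E M] [FinDimLieAlgebra g] [FinDimLieAlgebra h]
  {C : DifferentialCrossedModule g h} {S : ℝ → ℝ → M}

/-- Where a curve of paths is constant in the curve parameter, forms vanish on its velocity. -/
theorem DiffForm.planePart_left_eq_zero_of_eventually {V : Type*} [NormedAddCommGroup V]
    [NormedSpace ℝ V] (hS : SmoothPlane E S) (η : DiffForm E M V 1) {τ σ : ℝ} {t : M}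
    (hc : ∀ᶠ τ' in 𝓝 τ, S τ' σ = t) : η.planePart S ![(1, 0)] τ σ = 0 := by
  have hv : velocity (E := E) (fun τ => S τ σ) τ = 0 := by
    have h1 : (fun τ => S τ σ) =ᶠ[𝓝 τ] fun _ => t := hc
    have h2 : mfderiv 𝓘(ℝ, ℝ) 𝓘(ℝ, E) (fun τ => S τ σ) τ =
        (mfderiv 𝓘(ℝ, ℝ) 𝓘(ℝ, E) (fun _ : ℝ => t) τ : ℝ →L[ℝ] E) := h1.mfderiv_eq
    have h3 : (mfderiv 𝓘(ℝ, ℝ) 𝓘(ℝ, E) (fun _ : ℝ => t) τ : ℝ →L[ℝ] E) = 0 := mfderiv_const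
    exact congrArg (fun L : ℝ →L[ℝ] E => L 1) (h2.trans h3)
  have hcoord : (formPullback (Function.uncurry S) η.toFun (τ, σ)) ![(1, 0)] =
      η.toFun (S τ σ) ![velocity (fun τ => S τ σ) τ] := by
    rw [hS.velocity_left]
    show η.toFun (S τ σ) (_ ∘ _) = _
    congr 1
    ext i
    fin_cases i
    rfl
  rw [planePart, hcoord, hv]
  exact (η.toFun (S τ σ)).map_coord_zero 0 rfl

variable [IsManifold 𝓘(ℝ, E) ∞ M]

/-- A curve in path space is constrained only for `τ ∈ [0, 1]`, so at `τ = 0, 1` it need not be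
constant on a neighbourhood; those two values follow by continuity from the open interval. -/
theorem DiffForm.planePart_left_eq_zero {V : Type*} [NormedAddCommGroup V]
    [NormedSpace ℝ V] [CompleteSpace V] (hS : SmoothPlane E S) (η : DiffForm E M V 1) {σ : ℝ} {t : M}
    (hc : ∀ τ ∈ Icc (0 : ℝ) 1, S τ σ = t) :
    ∀ τ ∈ Icc (0 : ℝ) 1, η.planePart S ![(1, 0)] τ σ = 0 := by
  have hcont : Continuous fun τ => η.planePart S ![(1, 0)] τ σ :=
    (η.continuous_planePart hS _).comp (Continuous.prodMk_left σ)
  have hcl : IsClosed {τ | η.planePart S ![(1, 0)] τ σ = 0} := isClosed_eq hcont continuous_const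
  have hsub : Ioo (0 : ℝ) 1 ⊆ {τ | η.planePart S ![(1, 0)] τ σ = 0} := fun τ hτ =>
    η.planePart_left_eq_zero_of_eventually hS (t := t) (by
      filter_upwards [Ioo_mem_nhds hτ.1 hτ.2] with τ' hτ'
      exact hc τ' (Ioo_subset_Icc_self hτ'))
  rw [← closure_Ioo zero_ne_one]
  exact closure_minimal hsub hcl

/-- The derivative in `ε` of the transformed connection. -/
def connectionVariation (C : DifferentialCrossedModule g h) (P : OneTwoForm E M g h)
    (a : DiffForm E M h 1) (S : ℝ → ℝ → M) (τ : ℝ) : h :=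
  ∫ σ in (0 : ℝ)..1, (pathExp (connEnd C P.A S (0, 1) τ) 1 σ
      ((covDeriv C P.A a).planePart S ![(1, 0), (0, 1)] τ σ) +
    pathExpDeriv (connEnd C P.A S (0, 1) τ)
      (fun x => bracketCLM h (a.planePart S ![(0, 1)] τ x)) 1 σ
      (P.B.planePart S ![(0, 1), (1, 0)] τ σ))

/-- Exactly affine in `ε`, which permits `κ = 0` in the second order estimate for transport. -/
theorem connEnd_transform (P : OneTwoForm E M g h) (a : DiffForm E M h 1) (ε τ σ : ℝ) :
    connEnd C (P.transform C a ε).A S (0, 1) τ σ = connEnd C P.A S (0, 1) τ σ +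
      ε • bracketCLM h (a.planePart S ![(0, 1)] τ σ) := by
  rw [connEnd, OneTwoForm.transform, DiffForm.planePart_add, DiffForm.planePart_smul,
    DiffForm.planePart_map, map_add, map_smul, DifferentialCrossedModule.dtCLM_apply,
    C.dαCLM_dt]
  rfl

/-- The minus sign of `-ε d_A a` is absorbed by reversing the orientation of the plane. -/
theorem planePart_transform (P : OneTwoForm E M g h) (a : DiffForm E M h 1) (ε τ σ : ℝ) :
    (P.transform C a ε).B.planePart S ![(0, 1), (1, 0)] τ σ =
      P.B.planePart S ![(0, 1), (1, 0)] τ σ +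
        ε • (covDeriv C P.A a).planePart S ![(1, 0), (0, 1)] τ σ := by
  rw [OneTwoForm.transform, DiffForm.planePart_sub, DiffForm.planePart_smul,
    DiffForm.planePart_swap (covDeriv C P.A a) (1, 0) (0, 1), smul_neg, sub_neg_eq_add]

theorem dαCLM_fakeCurvature (P : OneTwoForm E M g h) (τ σ : ℝ) :
    C.dαCLM ((fakeCurvature C P).planePart S ![(1, 0), (0, 1)] τ σ) =
      curvEnd C P.A S τ σ - bracketCLM h (P.B.planePart S ![(0, 1), (1, 0)] τ σ) := by
  rw [fakeCurvature, DiffForm.planePart_add, DiffForm.planePart_map, map_add,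
    DifferentialCrossedModule.dtCLM_apply, C.dαCLM_dt,
    DiffForm.planePart_swap P.B (0, 1) (1, 0), map_neg, ← sub_eq_add_neg]
  rfl

/-- In the sufficiency argument the trivial action enters only here, replacing the curvature by a
bracket to which the exchange lemma applies. -/
theorem curvEnd_eq_bracket {P : OneTwoForm E M g h} (hP : FakeCurvatureActsTrivially C P)
    (τ σ : ℝ) : curvEnd C P.A S τ σ =
      bracketCLM h (P.B.planePart S ![(0, 1), (1, 0)] τ σ) := by
  rw [← sub_eq_zero, ← dαCLM_fakeCurvature]
  ext z
  exact DFunLike.congr_fun (hP (S τ σ) _) z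

theorem continuous_integral_transport (hS : SmoothPlane E S) (A : DiffForm E M g 1)
    {k : ℕ} (η : DiffForm E M h k) (v : Fin k → ℝ × ℝ) :
    Continuous fun τ => ∫ σ in (0 : ℝ)..1, pathExp (connEnd C A S (0, 1) τ) 1 σ
      (η.planePart S v τ σ) :=
  intervalIntegral.continuous_parametric_intervalIntegral_of_continuous' (f := fun τ σ =>
    pathExp (connEnd C A S (0, 1) τ) 1 σ (η.planePart S v τ σ))
    ((continuous_uncurry_pathExp (continuous_uncurry_connEnd hS _) 1).clm_apply
      (η.continuous_planePart hS v)) 0 1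

theorem continuous_bracket_planePart (hS : SmoothPlane E S) (a : DiffForm E M h 1) (v : ℝ × ℝ) :
    Continuous (Function.uncurry fun τ σ => bracketCLM h (a.planePart S ![v] τ σ)) :=
  (bracketCLM h).continuous.comp (a.continuous_planePart hS ![v])

theorem continuous_connectionVariation (hS : SmoothPlane E S) (P : OneTwoForm E M g h)
    (a : DiffForm E M h 1) : Continuous (connectionVariation C P a S) := by
  have hf := continuous_uncurry_connEnd (C := C) (A := P.A) hS (0, 1)
  exact intervalIntegral.continuous_parametric_intervalIntegral_of_continuous'
    (f := fun τ σ => (pathExp (connEnd C P.A S (0, 1) τ) 1 σ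
      ((covDeriv C P.A a).planePart S ![(1, 0), (0, 1)] τ σ) +
    pathExpDeriv (connEnd C P.A S (0, 1) τ)
      (fun x => bracketCLM h (a.planePart S ![(0, 1)] τ x)) 1 σ
      (P.B.planePart S ![(0, 1), (1, 0)] τ σ)))
    (((continuous_uncurry_pathExp hf 1).clm_apply (DiffForm.continuous_planePart hS _ _)).add
      ((continuous_uncurry_pathExpDeriv hf (continuous_bracket_planePart hS a _) 1).clm_apply
        (DiffForm.continuous_planePart hS _ _))) 0 1

/-- If the fake curvature acts trivially, the gauge variation of the connection by `∮_A(a)` is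
the variation of the standard connection. -/
theorem hasDerivAt_chenForm_of_actsTrivially (hS : SmoothPlane E S) {P : OneTwoForm E M g h}
    (hP : FakeCurvatureActsTrivially C P) (a : DiffForm E M h 1) {τ : ℝ}
    (hA1 : P.A.planePart S ![(1, 0)] τ 1 = 0) (ha0 : a.planePart S ![(1, 0)] τ 0 = 0)
    (ha1 : a.planePart S ![(1, 0)] τ 1 = 0) :
    HasDerivAt (fun τ => ∫ σ in (0 : ℝ)..1,
        pathExp (connEnd C P.A S (0, 1) τ) 1 σ (a.planePart S ![(0, 1)] τ σ))
      (connectionVariation C P a S τ -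
        ⁅∫ σ in (0 : ℝ)..1, pathExp (connEnd C P.A S (0, 1) τ) 1 σ
            (P.B.planePart S ![(0, 1), (1, 0)] τ σ),
          ∫ σ in (0 : ℝ)..1, pathExp (connEnd C P.A S (0, 1) τ) 1 σ
            (a.planePart S ![(0, 1)] τ σ)⁆) τ := by
  have hk : connEnd C P.A S (1, 0) τ 1 = 0 := by rw [connEnd, hA1, map_zero]
  refine (hasDerivAt_chenForm_zero hS a hk ha1).congr_deriv ?_
  have hf := continuous_connEnd (C := C) (A := P.A) hS (0, 1) τ
  have hac := continuous_planePart_right hS a ![(0, 1)] τ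
  have hbc := continuous_planePart_right hS P.B ![(0, 1), (1, 0)] τ
  have hec := continuous_planePart_right hS (covDeriv C P.A a) ![(1, 0), (0, 1)] τ
  have hUe := (continuous_pathExp hf 1).clm_apply hec
  have hD : ∀ φ : ℝ → h →L[ℝ] h, Continuous φ →
      Continuous (pathExpDeriv (connEnd C P.A S (0, 1) τ) φ 1) := fun φ hφ =>
    continuous_iff_continuousAt.2 fun x => (hasDerivAt_pathExpDeriv hf hφ 1 x).continuousAt
  have hφa : Continuous fun x => bracketCLM h (a.planePart S ![(0, 1)] τ x) :=
    (bracketCLM h).continuous.comp hac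
  have hφb : Continuous fun x => bracketCLM h (P.B.planePart S ![(0, 1), (1, 0)] τ x) :=
    (bracketCLM h).continuous.comp hbc
  rw [ha0, map_zero, neg_zero, zero_add, funext (curvEnd_eq_bracket hP τ), connectionVariation,
    intervalIntegral.integral_add (hUe.intervalIntegrable _ _)
      (((hD _ hφb).clm_apply hac).intervalIntegrable _ _),
    intervalIntegral.integral_add (hUe.intervalIntegrable _ _)
      (((hD _ hφa).clm_apply hbc).intervalIntegrable _ _),
    add_sub_assoc]
  congr 1
  rw [eq_sub_iff_add_eq]
  exact integral_pathExpDeriv_bracket_comm hf (fun x y z => connEnd_derivation _ _ _ _ _) hac hbc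

/-- Transport and 2-form both change with `ε`; the bound is uniform in `τ` by compactness of the
unit square. -/
theorem exists_norm_connection_sub_le (hS : SmoothPlane E S) (P : OneTwoForm E M g h)
    (a : DiffForm E M h 1) : ∃ K : ℝ, 0 ≤ K ∧ ∀ ε : ℝ, |ε| ≤ 1 → ∀ τ ∈ Icc (0 : ℝ) 1,
      ‖(∫ σ in (0 : ℝ)..1, pathExp (connEnd C (P.transform C a ε).A S (0, 1) τ) 1 σ
          ((P.transform C a ε).B.planePart S ![(0, 1), (1, 0)] τ σ)) -
        (∫ σ in (0 : ℝ)..1, pathExp (connEnd C P.A S (0, 1) τ) 1 σ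
          (P.B.planePart S ![(0, 1), (1, 0)] τ σ)) -
        ε • connectionVariation C P a S τ‖ ≤ K * ε ^ 2 := by
  have hcpt := (isCompact_Icc (a := (0 : ℝ)) (b := 1)).prod (isCompact_Icc (a := (0 : ℝ)) (b := 1))
  have hf := continuous_uncurry_connEnd (C := C) (A := P.A) hS (0, 1)
  have hφ := continuous_bracket_planePart hS a (0, 1)
  have hb := P.B.continuous_planePart hS ![(0, 1), (1, 0)]
  have he := (covDeriv C P.A a).continuous_planePart hS ![(1, 0), (0, 1)]
  obtain ⟨K₁, hK₁⟩ := hcpt.exists_bound_of_continuousOn hf.continuousOn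
  obtain ⟨K₂, hK₂⟩ := hcpt.exists_bound_of_continuousOn hφ.continuousOn
  obtain ⟨K₃, hK₃⟩ := hcpt.exists_bound_of_continuousOn hb.continuousOn
  obtain ⟨K₄, hK₄⟩ := hcpt.exists_bound_of_continuousOn he.continuousOn
  have h00 : ((0 : ℝ), (0 : ℝ)) ∈ Icc (0 : ℝ) 1 ×ˢ Icc (0 : ℝ) 1 := by simp
  have hp₁ := (norm_nonneg _).trans (hK₁ _ h00)
  have hp₂ := (norm_nonneg _).trans (hK₂ _ h00)
  have hp₃ := (norm_nonneg _).trans (hK₃ _ h00)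
  have hp₄ := (norm_nonneg _).trans (hK₄ _ h00)
  set N := ‖(1 : h →L[ℝ] h)‖ * Real.exp (3 * (K₁ + K₂ + 1)) with hN
  set N' := ‖(1 : h →L[ℝ] h)‖ * Real.exp (2 * (K₁ + K₂ + 1)) with hN'
  have hN0 : 0 ≤ N := by positivity
  have hN0' : 0 ≤ N' := by positivity
  refine ⟨N * K₂ ^ 2 * K₃ + N' * K₂ * K₄, by positivity, fun ε hε τ hτ => ?_⟩
  have hfτ := continuous_connEnd (C := C) (A := P.A) hS (0, 1) τ
  have hfε := continuous_connEnd (C := C) (A := (P.transform C a ε).A) hS (0, 1) τ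
  have hφτ : Continuous fun σ => bracketCLM h (a.planePart S ![(0, 1)] τ σ) :=
    hφ.comp (Continuous.prodMk_right τ)
  have hbτ := continuous_planePart_right hS P.B ![(0, 1), (1, 0)] τ
  have hbε := continuous_planePart_right hS (P.transform C a ε).B ![(0, 1), (1, 0)] τ
  have heτ := continuous_planePart_right hS (covDeriv C P.A a) ![(1, 0), (0, 1)] τ
  have hDc : Continuous (pathExpDeriv (connEnd C P.A S (0, 1) τ)
      (fun σ => bracketCLM h (a.planePart S ![(0, 1)] τ σ)) 1) :=
    continuous_iff_continuousAt.2 fun x => (hasDerivAt_pathExpDeriv hfτ hφτ 1 x).continuousAt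
  have hi₁ := ((continuous_pathExp hfε 1).clm_apply hbε).intervalIntegrable
    (μ := MeasureTheory.volume) 0 1
  have hi₂ := ((continuous_pathExp hfτ 1).clm_apply hbτ).intervalIntegrable
    (μ := MeasureTheory.volume) 0 1
  have hi₃ : IntervalIntegrable (fun σ => ε • (pathExp (connEnd C P.A S (0, 1) τ) 1 σ
      ((covDeriv C P.A a).planePart S ![(1, 0), (0, 1)] τ σ) +
    pathExpDeriv (connEnd C P.A S (0, 1) τ)
      (fun x => bracketCLM h (a.planePart S ![(0, 1)] τ x)) 1 σ
      (P.B.planePart S ![(0, 1), (1, 0)] τ σ))) MeasureTheory.volume 0 1 :=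
    ((((continuous_pathExp hfτ 1).clm_apply heτ).add
      (hDc.clm_apply hbτ)).const_smul ε).intervalIntegrable _ _
  rw [connectionVariation, ← intervalIntegral.integral_smul,
    ← intervalIntegral.integral_sub hi₁ hi₂, ← intervalIntegral.integral_sub (hi₁.sub hi₂) hi₃]
  refine (intervalIntegral.norm_integral_le_of_norm_le_const (C := (N * K₂ ^ 2 * K₃ + N' * K₂ * K₄) *
    ε ^ 2) fun σ hσ => ?_).trans (by simp)
  have hσ' : σ ∈ Icc (0 : ℝ) 1 := by
    rw [uIoc_of_le zero_le_one] at hσ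
    exact Ioc_subset_Icc_self hσ
  have hσ1 : |σ - 1| ≤ 1 := by rw [abs_le]; constructor <;> linarith [hσ'.1, hσ'.2]
  have hz : ∀ z ∈ uIcc 1 σ, z ∈ Icc (0 : ℝ) 1 := fun z hz => by
    rw [uIcc_of_ge hσ'.2] at hz
    exact ⟨hσ'.1.trans hz.1, hz.2⟩
  have hsub : ∀ z, connEnd C (P.transform C a ε).A S (0, 1) τ z - connEnd C P.A S (0, 1) τ z =
      ε • bracketCLM h (a.planePart S ![(0, 1)] τ z) := fun z => by
    rw [connEnd_transform, add_sub_cancel_left]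
  have hδ : ∀ z ∈ uIcc 1 σ, ‖connEnd C (P.transform C a ε).A S (0, 1) τ z -
      connEnd C P.A S (0, 1) τ z‖ ≤ |ε| * K₂ := fun z hzz => by
    rw [hsub, norm_smul, Real.norm_eq_abs]
    exact mul_le_mul_of_nonneg_left (hK₂ (τ, z) ⟨hτ, hz z hzz⟩) (abs_nonneg ε)
  have hB₁ : ∀ z ∈ uIcc 1 σ, ‖connEnd C P.A S (0, 1) τ z‖ ≤ K₁ + K₂ := fun z hzz =>
    (hK₁ (τ, z) ⟨hτ, hz z hzz⟩).trans (by linarith)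
  have hB₂ : ∀ z ∈ uIcc 1 σ, ‖connEnd C (P.transform C a ε).A S (0, 1) τ z‖ ≤ K₁ + K₂ :=
    fun z hzz => by
    have h1 := norm_add_le (connEnd C (P.transform C a ε).A S (0, 1) τ z -
      connEnd C P.A S (0, 1) τ z) (connEnd C P.A S (0, 1) τ z)
    rw [sub_add_cancel] at h1
    have h2 := mul_le_of_le_one_left hp₂ hε
    linarith [hδ z hzz, hK₁ (τ, z) ⟨hτ, hz z hzz⟩, show ‖connEnd C P.A S (0, 1) τ z‖ ≤ K₁ from
      hK₁ (τ, z) ⟨hτ, hz z hzz⟩]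
  have hd1 := norm_pathExp_sub_le hfτ hfε hσ1 hB₁ hB₂ hδ
  have hd2 := norm_pathExp_sub_sub_pathExpDeriv_le (ψ := fun z => ε • bracketCLM h
    (a.planePart S ![(0, 1)] τ z)) (κ := 0) hfτ hfε (hφτ.const_smul ε) hσ1 hB₁ hB₂ hδ
    (fun z _ => by rw [hsub]; simp)
  have hlin : pathExpDeriv (connEnd C P.A S (0, 1) τ) (fun z => ε • bracketCLM h
      (a.planePart S ![(0, 1)] τ z)) 1 σ = ε • pathExpDeriv (connEnd C P.A S (0, 1) τ)
      (fun z => bracketCLM h (a.planePart S ![(0, 1)] τ z)) 1 σ := by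
    simp [pathExpDeriv]
  rw [hlin] at hd2
  set Uε := pathExp (connEnd C (P.transform C a ε).A S (0, 1) τ) 1 σ
  set U := pathExp (connEnd C P.A S (0, 1) τ) 1 σ
  set D := pathExpDeriv (connEnd C P.A S (0, 1) τ)
      (fun z => bracketCLM h (a.planePart S ![(0, 1)] τ z)) 1 σ
  set b := P.B.planePart S ![(0, 1), (1, 0)] τ σ with hbdef
  set e := (covDeriv C P.A a).planePart S ![(1, 0), (0, 1)] τ σ with hedef
  have hbK : ‖b‖ ≤ K₃ := hK₃ (τ, σ) ⟨hτ, hσ'⟩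
  have heK : ‖e‖ ≤ K₄ := hK₄ (τ, σ) ⟨hτ, hσ'⟩
  -- Product rule with exact remainder: the first summand is quadratic by the linearization
  -- estimate, the second because `Uε - U` is already of order `ε`.
  have hfin : Uε ((P.transform C a ε).B.planePart S ![(0, 1), (1, 0)] τ σ) - U b - ε • (U e + D b) =
      (Uε - U - ε • D) b + ε • (Uε - U) e := by
    rw [planePart_transform, ← hbdef, ← hedef]
    simp only [map_add, map_smul, sub_apply, smul_apply, smul_add, smul_sub]
    abel
  rw [hfin]
  refine (norm_add_le _ _).trans ?_
  rw [norm_smul, Real.norm_eq_abs]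
  have h1 := ((Uε - U - ε • D).le_opNorm b).trans (mul_le_mul hd2 hbK (norm_nonneg _) (by positivity))
  have h2 := ((Uε - U).le_opNorm e).trans (mul_le_mul hd1 heK (norm_nonneg _) (by positivity))
  have h3 := mul_le_mul_of_nonneg_left h2 (abs_nonneg ε)
  have h4 : |ε| * (‖(1 : h →L[ℝ] h)‖ * Real.exp (2 * (K₁ + K₂ + 1)) * (|ε| * K₂) * K₄) =
      N' * K₂ * K₄ * ε ^ 2 := by rw [← sq_abs ε, hN']; ring
  have h5 : ‖(1 : h →L[ℝ] h)‖ * Real.exp (3 * (K₁ + K₂ + 1)) * ((|ε| * K₂) ^ 2 + 0) * K₃ =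
      N * K₂ ^ 2 * K₃ * ε ^ 2 := by rw [← sq_abs ε, hN]; ring
  rw [h5] at h1
  rw [h4] at h3
  linarith

end

/-! ### Trivially acting fake curvature -/

section
variable {E M g h R : Type*} [NormedAddCommGroup E] [NormedSpace ℝ E] [TopologicalSpace M]
  [ChartedSpace E M] [FinDimLieAlgebra g] [FinDimLieAlgebra h] [NormedRing R] [NormedAlgebra ℝ R]
  {C : DifferentialCrossedModule g h}

/-- The faithful representation as a continuous linear map. -/
def FaithfulRep.toCLM (ρ : FaithfulRep h R) : h →L[ℝ] R := LinearMap.toContinuousLinearMap ρ.toLin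

theorem FaithfulRep.toCLM_apply (ρ : FaithfulRep h R) (x : h) : ρ.toCLM x = ρ.toLin x := rfl

theorem holonomy_eq {S : ℝ → ℝ → M} (hS : SmoothPlane E S) (ρ : FaithfulRep h R)
    (P : OneTwoForm E M g h) : holonomy C ρ P S = pathExp (fun τ => ρ.toCLM
      (∫ σ in (0 : ℝ)..1, pathExp (connEnd C P.A S (0, 1) τ) 1 σ
        (P.B.planePart S ![(0, 1), (1, 0)] τ σ))) 0 1 := by
  unfold holonomy
  congr 1
  exact funext fun τ => congrArg ρ.toLin (standardConnection_eq hS P τ)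

theorem FakeCurvatureActsTrivially.yieldsTransformedConnection [CompleteSpace R]
    [IsManifold 𝓘(ℝ, E) ∞ M] {P : OneTwoForm E M g h}
    (hP : FakeCurvatureActsTrivially C P) (ρ : FaithfulRep h R) (a : DiffForm E M h 1) :
    YieldsTransformedConnection C ρ P a := by
  rintro s t S ⟨hS, hpath⟩
  replace hS : SmoothPlane E S := hS
  have h0 : ∀ τ ∈ Icc (0 : ℝ) 1, S τ 0 = s := fun τ hτ => (hpath τ hτ).2.1.self_of_nhds
  have h1 : ∀ τ ∈ Icc (0 : ℝ) 1, S τ 1 = t := fun τ hτ => (hpath τ hτ).2.2.self_of_nhds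
  obtain ⟨K, hK0, hK⟩ := exists_norm_connection_sub_le (C := C) hS P a
  let X : ℝ → h := fun τ => ∫ σ in (0 : ℝ)..1, pathExp (connEnd C P.A S (0, 1) τ) 1 σ
    (P.B.planePart S ![(0, 1), (1, 0)] τ σ)
  let α : ℝ → h := fun τ => ∫ σ in (0 : ℝ)..1, pathExp (connEnd C P.A S (0, 1) τ) 1 σ
    (a.planePart S ![(0, 1)] τ σ)
  have hX : Continuous X := continuous_integral_transport hS P.A P.B _
  have hα : Continuous α := continuous_integral_transport hS P.A a _
  have hX₁ : Continuous (connectionVariation C P a S) := continuous_connectionVariation hS P a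
  have hbound : ∀ {Z : ℝ → h}, Continuous Z → ∃ K, ∀ τ ∈ Icc (0 : ℝ) 1, ‖ρ.toCLM (Z τ)‖ ≤ K :=
    fun hZ => isCompact_Icc.exists_bound_of_continuousOn (ρ.toCLM.continuous.comp hZ).continuousOn
  obtain ⟨K₁, hK₁⟩ := hbound hX
  obtain ⟨K₂, hK₂⟩ := hbound hX₁
  obtain ⟨K₃, hK₃⟩ := hbound hα
  let L := max (max K₁ K₂) (max K₃ (‖ρ.toCLM‖ * K))
  have hL₁ : K₁ ≤ L := (le_max_left _ _).trans (le_max_left _ _)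
  have hL₂ : K₂ ≤ L := (le_max_right _ _).trans (le_max_left _ _)
  have hL₃ : K₃ ≤ L := (le_max_left _ _).trans (le_max_right _ _)
  have hL₄ : ‖ρ.toCLM‖ * K ≤ L := (le_max_right _ _).trans (le_max_right _ _)
  have key := pathExp_gauge_isBigO (R := R) (X := fun τ => ρ.toCLM (X τ))
    (X₁ := fun τ => ρ.toCLM (connectionVariation C P a S τ)) (α := fun τ => ρ.toCLM (α τ))
    (Y := fun ε τ => ρ.toCLM (∫ σ in (0 : ℝ)..1,
      pathExp (connEnd C (P.transform C a ε).A S (0, 1) τ) 1 σ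
        ((P.transform C a ε).B.planePart S ![(0, 1), (1, 0)] τ σ)))
    (K := L) (ρ.toCLM.continuous.comp hX)
    (fun ε => ρ.toCLM.continuous.comp (continuous_integral_transport hS _ _ _))
    (fun τ hτ => ?_) (fun τ hτ => (hK₁ τ hτ).trans hL₁) (fun τ hτ => (hK₂ τ hτ).trans hL₂)
    (fun τ hτ => (hK₃ τ hτ).trans hL₃) (fun ε hε τ hτ => ?_)
  · refine key.congr_left fun ε => ?_
    rw [gaugeTransformedHolonomy, holonomy_eq hS, holonomy_eq hS, chenForm_zero_eq hS,
      chenForm_zero_eq hS]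
    rfl
  · refine (ρ.toCLM.hasFDerivAt.comp_hasDerivAt τ (hasDerivAt_chenForm_of_actsTrivially hS hP a
      (P.A.planePart_left_eq_zero hS h1 τ hτ) (a.planePart_left_eq_zero hS h0 τ hτ)
      (a.planePart_left_eq_zero hS h1 τ hτ))).congr_deriv ?_
    rw [map_sub]
    congr 1
    exact ρ.map_lie _ _
  · rw [← map_smul, ← map_sub, ← map_sub]
    refine (ρ.toCLM.le_opNorm _).trans ?_
    calc _ ≤ ‖ρ.toCLM‖ * (K * ε ^ 2) :=
          mul_le_mul_of_nonneg_left (hK ε hε τ hτ) (norm_nonneg _)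
      _ = ‖ρ.toCLM‖ * K * ε ^ 2 := by ring
      _ ≤ L * ε ^ 2 := mul_le_mul_of_nonneg_right hL₄ (sq_nonneg ε)

end

/-! ### Forms with prescribed values and planes in a chart -/

section
variable {E M V : Type*} [NormedAddCommGroup E] [NormedSpace ℝ E] [TopologicalSpace M]
  [ChartedSpace E M] [NormedAddCommGroup V] [NormedSpace ℝ V] {k : ℕ}

variable [IsManifold 𝓘(ℝ, E) ∞ M]

/-- A smooth function as a 0-form. -/
def DiffForm.ofFunction (f : M → V) (hf : ContMDiff 𝓘(ℝ, E) 𝓘(ℝ, V) ∞ f) : DiffForm E M V 0 where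
  toFun x := ContinuousAlternatingMap.constOfIsEmpty ℝ (TangentSpace 𝓘(ℝ, E) x) (Fin 0) (f x)
  smooth x₀ := by
    have h1 : ContDiffOn ℝ ∞ (fun y => f ((extChartAt 𝓘(ℝ, E) x₀).symm y))
        (extChartAt 𝓘(ℝ, E) x₀).target :=
      (hf.comp_contMDiffOn (contMDiffOn_extChartAt_symm (n := ∞) x₀)).contDiffOn
    exact (ContinuousAlternatingMap.constOfIsEmptyLIE ℝ E V (Fin 0)).contDiff.comp_contDiffOn h1

theorem DiffForm.chartRep_ofFunction_d (f : M → V) (hf : ContMDiff 𝓘(ℝ, E) 𝓘(ℝ, V) ∞ f) (x₀ : M)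
    {y : E} (hy : y ∈ (extChartAt 𝓘(ℝ, E) x₀).target) (u : E) :
    chartRep (DiffForm.ofFunction f hf).d.toFun x₀ y ![u] =
      fderiv ℝ (fun y => f ((extChartAt 𝓘(ℝ, E) x₀).symm y)) y u := by
  have h1 : chartRep (DiffForm.ofFunction f hf).d.toFun x₀ y =
      extDeriv (chartRep (DiffForm.ofFunction f hf).toFun x₀) y :=
    chartRep_exteriorDeriv (DiffForm.ofFunction f hf).smooth x₀ hy
  have h2 : chartRep (DiffForm.ofFunction f hf).toFun x₀ = fun y =>
      ContinuousAlternatingMap.constOfIsEmpty ℝ E (Fin 0)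
        (f ((extChartAt 𝓘(ℝ, E) x₀).symm y)) := rfl
  rw [h1, h2, extDeriv_constOfIsEmpty]
  rfl

/-- An exact form suffices: the differential of a bump function times a linear functional `l` with
`l u = 1`, times `ζ`. -/
theorem exists_diffForm_chartRep_eq [FiniteDimensional ℝ E] [T2Space M] (x₀ : M) {u : E}
    (hu : u ≠ 0) (ζ : V) : ∃ a : DiffForm E M V 1,
      chartRep a.toFun x₀ (extChartAt 𝓘(ℝ, E) x₀ x₀) ![u] = ζ := by
  obtain ⟨l, hl⟩ := SeparatingDual.exists_eq_one (R := ℝ) hu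
  let b : SmoothBumpFunction 𝓘(ℝ, E) x₀ := Classical.choice inferInstance
  let f : M → V := fun x => b x • l (extChartAt 𝓘(ℝ, E) x₀ x) • ζ
  have hf : ContMDiff 𝓘(ℝ, E) 𝓘(ℝ, V) ∞ f := by
    refine b.contMDiff_smul ?_
    have h1 : ContDiff ℝ ∞ fun y : E => l y • ζ := l.contDiff.smul contDiff_const
    exact h1.contMDiff.comp_contMDiffOn (contMDiffOn_extChartAt (I := 𝓘(ℝ, E)) (n := ∞) (x := x₀))
  refine ⟨(DiffForm.ofFunction f hf).d, ?_⟩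
  set φ := extChartAt 𝓘(ℝ, E) x₀ with hφ
  have hy₀ : φ x₀ ∈ φ.target := φ.map_source (mem_extChartAt_source x₀)
  rw [DiffForm.chartRep_ofFunction_d f hf x₀ hy₀]
  have hev : (fun y => f (φ.symm y)) =ᶠ[𝓝 (φ x₀)] fun y => l y • ζ := by
    have hc : ContinuousAt φ.symm (φ x₀) := continuousAt_extChartAt_symm x₀
    have h1 : ∀ᶠ y in 𝓝 (φ x₀), b (φ.symm y) = 1 := by
      refine hc.eventually (p := fun x => b x = 1) ?_
      rw [hφ, extChartAt_to_inv]
      exact b.eventuallyEq_one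
    filter_upwards [h1, (isOpen_extChartAt_target x₀).mem_nhds hy₀] with y hy1 hy2
    show b (φ.symm y) • l (φ (φ.symm y)) • ζ = l y • ζ
    rw [hy1, one_smul, φ.right_inv hy2]
  rw [hev.fderiv_eq]
  have h2 : HasFDerivAt (fun y : E => l y • ζ) (l.smulRight ζ) (φ x₀) := (l.smulRight ζ).hasFDerivAt
  rw [h2.fderiv, ContinuousLinearMap.smulRight_apply, hl, one_smul]

/-- The image in `M` of a map of the plane into the target of a chart. -/
def chartPlane (x₀ : M) (c : ℝ → ℝ → E) (τ σ : ℝ) : M := (extChartAt 𝓘(ℝ, E) x₀).symm (c τ σ)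

variable {x₀ : M} {c : ℝ → ℝ → E}

theorem smoothPlane_chartPlane (hc : ContDiff ℝ ∞ (Function.uncurry c))
    (ht : ∀ τ σ, c τ σ ∈ (extChartAt 𝓘(ℝ, E) x₀).target) : SmoothPlane E (chartPlane x₀ c) :=
  (contMDiffOn_extChartAt_symm (I := 𝓘(ℝ, E)) (n := ∞) x₀).comp_contMDiff hc.contMDiff
    fun z => ht z.1 z.2

theorem planePart_chartPlane (hc : ContDiff ℝ ∞ (Function.uncurry c))
    (ht : ∀ τ σ, c τ σ ∈ (extChartAt 𝓘(ℝ, E) x₀).target) (η : DiffForm E M V k)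
    (v : Fin k → ℝ × ℝ) (τ σ : ℝ) : η.planePart (chartPlane x₀ c) v τ σ =
      chartRep η.toFun x₀ (c τ σ) (fun i => fderiv ℝ (Function.uncurry c) (τ, σ) (v i)) := by
  have h1 : mfderiv 𝓘(ℝ, ℝ × ℝ) 𝓘(ℝ, E) (Function.uncurry (chartPlane x₀ c)) (τ, σ) =
      (mfderiv 𝓘(ℝ, E) 𝓘(ℝ, E) (extChartAt 𝓘(ℝ, E) x₀).symm (c τ σ) : E →L[ℝ] E) ∘L
        fderiv ℝ (Function.uncurry c) (τ, σ) := by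
    refine (mfderiv_comp (I' := 𝓘(ℝ, E)) (τ, σ) (((contMDiffOn_extChartAt_symm (n := ∞) x₀).contMDiffAt
      ((isOpen_extChartAt_target x₀).mem_nhds (ht τ σ))).mdifferentiableAt (by simp))
      (hc.contMDiff.mdifferentiable (by simp) (τ, σ))).trans ?_
    exact congrArg (fun L : ℝ × ℝ →L[ℝ] E => (mfderiv 𝓘(ℝ, E) 𝓘(ℝ, E)
      (extChartAt 𝓘(ℝ, E) x₀).symm (c τ σ) : E →L[ℝ] E).comp L) mfderiv_eq_fderiv
  unfold DiffForm.planePart formPullback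
  rw [h1]
  rfl

theorem planePart_chartPlane_one (hc : ContDiff ℝ ∞ (Function.uncurry c))
    (ht : ∀ τ σ, c τ σ ∈ (extChartAt 𝓘(ℝ, E) x₀).target) (η : DiffForm E M V 1)
    (v : ℝ × ℝ) (τ σ : ℝ) : η.planePart (chartPlane x₀ c) ![v] τ σ =
      chartRep η.toFun x₀ (c τ σ) ![fderiv ℝ (Function.uncurry c) (τ, σ) v] := by
  rw [planePart_chartPlane hc ht]
  congr 1
  ext i
  fin_cases i
  rfl

theorem planePart_chartPlane_two (hc : ContDiff ℝ ∞ (Function.uncurry c))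
    (ht : ∀ τ σ, c τ σ ∈ (extChartAt 𝓘(ℝ, E) x₀).target) (η : DiffForm E M V 2)
    (v w : ℝ × ℝ) (τ σ : ℝ) : η.planePart (chartPlane x₀ c) ![v, w] τ σ =
      chartRep η.toFun x₀ (c τ σ) ![fderiv ℝ (Function.uncurry c) (τ, σ) v,
        fderiv ℝ (Function.uncurry c) (τ, σ) w] := by
  rw [planePart_chartPlane hc ht]
  congr 1
  ext i
  fin_cases i <;> rfl

end

theorem alternating_one_smul {F V : Type*} [NormedAddCommGroup F] [NormedSpace ℝ F]
    [NormedAddCommGroup V] [NormedSpace ℝ V] (η : F [⋀^Fin 2]→L[ℝ] V) (s t : ℝ) (u v : F) :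
    η ![s • u, t • v] = (s * t) • η ![u, v] := by
  have h := η.map_smul_univ ![s, t] ![u, v]
  rw [Fin.prod_univ_two] at h
  refine Eq.trans (congrArg η ?_) h
  ext i
  fin_cases i <;> rfl

theorem alternating_two_zero_left {F V : Type*} [NormedAddCommGroup F] [NormedSpace ℝ F]
    [NormedAddCommGroup V] [NormedSpace ℝ V] (η : F [⋀^Fin 2]→L[ℝ] V) (v : F) :
    η ![0, v] = 0 := η.map_coord_zero 0 rfl

theorem alternating_two_zero_right {F V : Type*} [NormedAddCommGroup F] [NormedSpace ℝ F]
    [NormedAddCommGroup V] [NormedSpace ℝ V] (η : F [⋀^Fin 2]→L[ℝ] V) (v : F) :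
    η ![v, 0] = 0 := η.map_coord_zero 1 rfl

theorem alternating_one_zero {F V : Type*} [NormedAddCommGroup F] [NormedSpace ℝ F]
    [NormedAddCommGroup V] [NormedSpace ℝ V] (η : F [⋀^Fin 1]→L[ℝ] V) :
    η ![0] = 0 := η.map_coord_zero 0 rfl

/-! ### Comparison of first order gauge transforms -/

/-- The difference is `ε • z - ε ^ 2 • q`; dividing by `ε` forces `z = 0`. -/
theorem eq_of_gauge_isLittleO {R : Type*} [NormedRing R] [NormedAlgebra ℝ R] {W a b a' b' : R}
    (h : (fun ε : ℝ => (1 - ε • a) * W * (1 + ε • b) - (1 - ε • a') * W * (1 + ε • b'))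
      =o[𝓝[≠] 0] fun ε : ℝ => ε) : W * b - a * W = W * b' - a' * W := by
  set z := W * b - a * W - (W * b' - a' * W) with hz
  set q := a * W * b - a' * W * b' with hq
  have h1 : (fun ε : ℝ => ε • z - ε ^ 2 • q) =o[𝓝[≠] 0] fun ε : ℝ => ε := by
    refine h.congr_left fun ε => ?_
    simp only [hz, hq, mul_add, sub_mul, smul_mul_assoc, mul_smul_comm, smul_sub, smul_smul, sq,
      mul_one, one_mul]
    abel
  have h2 : (fun ε : ℝ => ε ^ 2 • q) =o[𝓝[≠] 0] fun ε : ℝ => ε := by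
    have h3 : (fun ε : ℝ => ε ^ 2) =o[𝓝[≠] 0] fun ε : ℝ => ε := by
      simpa using ((isLittleO_pow_pow (𝕜 := ℝ) one_lt_two).mono nhdsWithin_le_nhds)
    have h4 : (fun _ : ℝ => q) =O[𝓝[≠] 0] fun _ : ℝ => (1 : ℝ) :=
      isBigO_const_const q one_ne_zero _
    simpa using h3.smul_isBigO h4
  have h5 : (fun ε : ℝ => ε • z) =o[𝓝[≠] 0] fun ε : ℝ => ε := by
    simpa using h1.add h2
  have h6 : Tendsto (fun ε : ℝ => ε⁻¹ • (ε • z)) (𝓝[≠] 0) (𝓝 0) := h5.tendsto_inv_smul_nhds_zero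
  have h7 : Tendsto (fun ε : ℝ => ε⁻¹ • (ε • z)) (𝓝[≠] 0) (𝓝 z) := by
    refine tendsto_const_nhds.congr' ?_
    filter_upwards [self_mem_nhdsWithin] with ε hε
    rw [inv_smul_smul₀ hε]
  exact sub_eq_zero.1 (tendsto_nhds_unique h7 h6)

/-! ### A family of test paths in a chart -/

/-- A smooth step from `-1` to `0` in `[1/8, 1/4]`. -/
def initialStep (σ : ℝ) : ℝ := Real.smoothTransition (8 * σ - 1) - 1

/-- A smooth step from `0` to `1` in `[5/8, 7/8]`. -/
def finalStep (σ : ℝ) : ℝ := Real.smoothTransition (4 * σ - 5 / 2)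

theorem contDiff_initialStep : ContDiff ℝ ∞ initialStep :=
  (Real.smoothTransition.contDiff.comp ((contDiff_const.mul contDiff_id).sub contDiff_const)).sub
    contDiff_const

theorem contDiff_finalStep : ContDiff ℝ ∞ finalStep :=
  Real.smoothTransition.contDiff.comp ((contDiff_const.mul contDiff_id).sub contDiff_const)

theorem initialStep_of_le {σ : ℝ} (h : σ ≤ 1 / 8) : initialStep σ = -1 := by
  rw [initialStep, Real.smoothTransition.zero_of_nonpos (by linarith), zero_sub]

theorem initialStep_of_ge {σ : ℝ} (h : 1 / 4 ≤ σ) : initialStep σ = 0 := by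
  rw [initialStep, Real.smoothTransition.one_of_one_le (by linarith), sub_self]

theorem finalStep_of_le {σ : ℝ} (h : σ ≤ 5 / 8) : finalStep σ = 0 :=
  Real.smoothTransition.zero_of_nonpos (by linarith)

theorem finalStep_of_ge {σ : ℝ} (h : 7 / 8 ≤ σ) : finalStep σ = 1 :=
  Real.smoothTransition.one_of_one_le (by linarith)

theorem abs_initialStep_le (σ : ℝ) : |initialStep σ| ≤ 1 := by
  have h1 := Real.smoothTransition.nonneg (8 * σ - 1)
  have h2 := Real.smoothTransition.le_one (8 * σ - 1)
  rw [initialStep, abs_le]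
  constructor <;> linarith

theorem finalStep_mem (σ : ℝ) : 0 ≤ finalStep σ ∧ finalStep σ ≤ 1 :=
  ⟨Real.smoothTransition.nonneg _, Real.smoothTransition.le_one _⟩

theorem deriv_initialStep_of_gt {σ : ℝ} (h : 1 / 4 < σ) : deriv initialStep σ = 0 := by
  have h1 : initialStep =ᶠ[𝓝 σ] fun _ => 0 := by
    filter_upwards [Ioi_mem_nhds h] with z hz
    exact initialStep_of_ge (le_of_lt hz)
  rw [h1.deriv_eq, deriv_const]

theorem deriv_finalStep_of_lt {σ : ℝ} (h : σ < 5 / 8) : deriv finalStep σ = 0 := by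
  have h1 : finalStep =ᶠ[𝓝 σ] fun _ => 0 := by
    filter_upwards [Iio_mem_nhds h] with z hz
    exact finalStep_of_le (le_of_lt hz)
  rw [h1.deriv_eq, deriv_const]

/-- A nonnegative bump function supported in `[5/8, 7/8]`. -/
def stepBump (σ : ℝ) : ℝ := finalStep σ * (1 - finalStep σ)

theorem contDiff_stepBump : ContDiff ℝ ∞ stepBump :=
  contDiff_finalStep.mul (contDiff_const.sub contDiff_finalStep)

theorem stepBump_of_le {σ : ℝ} (h : σ ≤ 5 / 8) : stepBump σ = 0 := by
  rw [stepBump, finalStep_of_le h, zero_mul]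

theorem stepBump_of_ge {σ : ℝ} (h : 7 / 8 ≤ σ) : stepBump σ = 0 := by
  rw [stepBump, finalStep_of_ge h, sub_self, mul_zero]

theorem deriv_stepBump_of_lt {σ : ℝ} (h : σ < 5 / 8) : deriv stepBump σ = 0 := by
  have h1 : stepBump =ᶠ[𝓝 σ] fun _ => 0 := by
    filter_upwards [Iio_mem_nhds h] with z hz
    exact stepBump_of_le (le_of_lt hz)
  rw [h1.deriv_eq, deriv_const]

theorem abs_stepBump_le (σ : ℝ) : |stepBump σ| ≤ 1 := by
  obtain ⟨h1, h2⟩ := finalStep_mem σ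
  rw [stepBump, abs_le]
  constructor <;> nlinarith

/-- Only nonvanishing matters later. The orientation from `1` to `0` is that of transport based at
the end of the path. -/
theorem integral_stepBump_mul_deriv : ∫ σ in (1 : ℝ)..0, stepBump σ * deriv finalStep σ = -(1 / 6) := by
  have hd : ∀ σ, HasDerivAt finalStep (deriv finalStep σ) σ := fun σ =>
    (contDiff_finalStep.differentiable (by simp) σ).hasDerivAt
  rw [intervalIntegral.integral_eq_sub_of_hasDerivAt
    (f := fun σ => finalStep σ ^ 2 / 2 - finalStep σ ^ 3 / 3)]
  · rw [finalStep_of_le (by norm_num), finalStep_of_ge (by norm_num)]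
    norm_num
  · intro σ _
    refine ((((hd σ).pow 2).div_const 2).sub (((hd σ).pow 3).div_const 3)).congr_deriv ?_
    rw [stepBump]
    simp
    ring
  · exact (contDiff_stepBump.continuous.mul
      (contDiff_finalStep.continuous_deriv (by simp))).intervalIntegrable _ _

section
variable {E : Type*} [NormedAddCommGroup E] [NormedSpace ℝ E]

/-- The family of test paths `σ ↦ probe y r u v η μ τ σ`: the first parameter moves the initial
point, the second the extent in the direction `u`, the third is a variation in the direction `v`. -/
def probe (y : E) (r : ℝ) (u v : E) (η μ τ σ : ℝ) : E :=
  y + r • ((Real.sin η * initialStep σ + Real.sin μ * finalStep σ) • u +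
    (Real.sin τ * stepBump σ) • v)

/-- The velocity of a test path. -/
def probeSpeed (r : ℝ) (u v : E) (η μ τ σ : ℝ) : E :=
  r • ((Real.sin η * deriv initialStep σ + Real.sin μ * deriv finalStep σ) • u +
    (Real.sin τ * deriv stepBump σ) • v)

variable {y : E} {r : ℝ} {u v : E}

theorem contDiff_probe {F : Type*} [NormedAddCommGroup F] [NormedSpace ℝ F] {e m t s : F → ℝ}
    (he : ContDiff ℝ ∞ e) (hm : ContDiff ℝ ∞ m) (ht : ContDiff ℝ ∞ t) (hs : ContDiff ℝ ∞ s) :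
    ContDiff ℝ ∞ fun z => probe y r u v (e z) (m z) (t z) (s z) :=
  contDiff_const.add (contDiff_const.smul
    (((((Real.contDiff_sin.comp he).mul (contDiff_initialStep.comp hs)).add
      ((Real.contDiff_sin.comp hm).mul (contDiff_finalStep.comp hs))).smul contDiff_const).add
      (((Real.contDiff_sin.comp ht).mul (contDiff_stepBump.comp hs)).smul contDiff_const)))

theorem hasDerivAt_probe (η μ τ σ : ℝ) :
    HasDerivAt (probe y r u v η μ τ) (probeSpeed r u v η μ τ σ) σ := by
  have h1 := (contDiff_initialStep.differentiable (by simp) σ).hasDerivAt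
  have h2 := (contDiff_finalStep.differentiable (by simp) σ).hasDerivAt
  have h3 := (contDiff_stepBump.differentiable (by simp) σ).hasDerivAt
  exact (((((h1.const_mul _).add (h2.const_mul _)).smul_const u).add
    ((h3.const_mul _).smul_const v)).const_smul r).const_add y

theorem hasDerivAt_probe_initial (η μ τ σ : ℝ) :
    HasDerivAt (fun η => probe y r u v η μ τ σ) ((r * Real.cos η * initialStep σ) • u) η := by
  refine ((((((Real.hasDerivAt_sin η).mul_const (initialStep σ)).add_const
    (Real.sin μ * finalStep σ)).smul_const u).add_const
    ((Real.sin τ * stepBump σ) • v)).const_smul r |>.const_add y).congr_deriv ?_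
  rw [smul_smul, mul_assoc]

theorem hasDerivAt_probe_variation (η μ T τ σ : ℝ) :
    HasDerivAt (fun τ => probe y r u v η μ (T * τ) σ)
      (T • (r * Real.cos (T * τ) * stepBump σ) • v) τ := by
  have h1 : HasDerivAt (fun τ => Real.sin (T * τ)) (Real.cos (T * τ) * T) τ :=
    (Real.hasDerivAt_sin (T * τ)).comp τ (by simpa using (hasDerivAt_id τ).const_mul T)
  refine (((((h1.mul_const (stepBump σ)).smul_const v).const_add
    ((Real.sin η * initialStep σ + Real.sin μ * finalStep σ) • u)).const_smul r).const_add
    y).congr_deriv ?_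
  rw [smul_smul, smul_smul]
  congr 1
  ring

/-- The path moves with `η` only before `1 / 4`, with `μ` and `τ` only after `5 / 8`; this
separation of supports drives the whole obstruction argument. -/
theorem probeSpeed_of_lt {η μ τ σ : ℝ} (h : 1 / 4 < σ) :
    probeSpeed r u v η μ τ σ = probeSpeed r u v 0 μ τ σ := by
  simp [probeSpeed, deriv_initialStep_of_gt h]

theorem probe_of_lt {η μ τ σ : ℝ} (h : 1 / 4 < σ) :
    probe y r u v η μ τ σ = probe y r u v 0 μ τ σ := by
  simp [probe, initialStep_of_ge h.le]

theorem probeSpeed_zero_of_lt {μ τ σ : ℝ} (h : σ < 5 / 8) : probeSpeed r u v 0 μ τ σ = 0 := by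
  simp [probeSpeed, deriv_finalStep_of_lt h, deriv_stepBump_of_lt h]

/-- Near the end points the path does not depend on `τ`, so the `τ`-curves stay in one based path
space. -/
theorem probe_of_le (η μ τ : ℝ) {σ : ℝ} (h : σ ≤ 1 / 8) :
    probe y r u v η μ τ σ = probe y r u v η μ 0 0 := by
  simp [probe, initialStep_of_le h, finalStep_of_le (h.trans (by norm_num)),
    stepBump_of_le (h.trans (by norm_num)), initialStep_of_le (σ := 0) (by norm_num),
    finalStep_of_le (σ := 0) (by norm_num)]

theorem probe_of_ge (η μ τ : ℝ) {σ : ℝ} (h : 7 / 8 ≤ σ) :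
    probe y r u v η μ τ σ = probe y r u v η μ 0 1 := by
  simp [probe, initialStep_of_ge ((by norm_num : (1 : ℝ) / 4 ≤ 7 / 8).trans h), finalStep_of_ge h,
    stepBump_of_ge h, initialStep_of_ge (σ := 1) (by norm_num),
    finalStep_of_ge (σ := 1) (by norm_num)]

theorem probe_zero_zero (μ τ : ℝ) : probe y r u v 0 μ τ 0 = y := by
  simp [probe, finalStep_of_le (σ := 0) (by norm_num), stepBump_of_le (σ := 0) (by norm_num)]

/-- The sines keep all real parameters bounded, so one scale `r` holds every test path inside the
chart, while derivatives at `0` are those of linear parameters. -/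
theorem norm_probe_sub_le (hr : 0 ≤ r) (η μ τ σ : ℝ) :
    ‖probe y r u v η μ τ σ - y‖ ≤ r * (2 * ‖u‖ + ‖v‖) := by
  have hs := Real.abs_sin_le_one
  rw [probe, add_sub_cancel_left, norm_smul, Real.norm_eq_abs, abs_of_nonneg hr]
  refine mul_le_mul_of_nonneg_left ((norm_add_le _ _).trans (add_le_add ?_ ?_)) hr
  · rw [norm_smul, Real.norm_eq_abs]
    refine mul_le_mul_of_nonneg_right ((abs_add_le _ _).trans ?_) (norm_nonneg _)
    have h1 : |Real.sin η * initialStep σ| ≤ 1 := by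
      rw [abs_mul]
      exact mul_le_one₀ (hs η) (abs_nonneg _) (abs_initialStep_le σ)
    have h2 : |Real.sin μ * finalStep σ| ≤ 1 := by
      rw [abs_mul, abs_of_nonneg (finalStep_mem σ).1]
      exact mul_le_one₀ (hs μ) (finalStep_mem σ).1 (finalStep_mem σ).2
    linarith
  · rw [norm_smul, Real.norm_eq_abs, abs_mul]
    exact mul_le_of_le_one_left (norm_nonneg _)
      (mul_le_one₀ (hs τ) (abs_nonneg _) (abs_stepBump_le σ))

theorem exists_probe_mem {s : Set E} (hs : s ∈ 𝓝 y) (u v : E) :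
    ∃ r > 0, ∀ η μ τ σ, probe y r u v η μ τ σ ∈ s := by
  obtain ⟨R, hR, hRs⟩ := Metric.mem_nhds_iff.1 hs
  have hp : 0 < 2 * ‖u‖ + ‖v‖ + 1 := by positivity
  refine ⟨R / (2 * ‖u‖ + ‖v‖ + 1), by positivity, fun η μ τ σ => hRs ?_⟩
  rw [mem_ball_iff_norm]
  refine (norm_probe_sub_le (by positivity) η μ τ σ).trans_lt ?_
  rw [div_mul_eq_mul_div, div_lt_iff₀ hp]
  nlinarith

end

/-! ### Forms along the planes of test paths -/

section
variable {E M V : Type*} [NormedAddCommGroup E] [NormedSpace ℝ E] [TopologicalSpace M]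
  [ChartedSpace E M] [NormedAddCommGroup V] [NormedSpace ℝ V] {k : ℕ}
  [IsManifold 𝓘(ℝ, E) ∞ M] {x₀ : M} {c : ℝ → ℝ → E}

theorem planePart_chartPlane_right (hc : ContDiff ℝ ∞ (Function.uncurry c))
    (ht : ∀ τ σ, c τ σ ∈ (extChartAt 𝓘(ℝ, E) x₀).target) (η : DiffForm E M V 1) {τ σ : ℝ} {w : E}
    (hw : HasDerivAt (c τ) w σ) : η.planePart (chartPlane x₀ c) ![(0, 1)] τ σ =
      chartRep η.toFun x₀ (c τ σ) ![w] := by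
  rw [planePart_chartPlane_one hc ht, (hc.hasDerivAt_uncurry_right τ σ).unique hw]

theorem planePart_chartPlane_left (hc : ContDiff ℝ ∞ (Function.uncurry c))
    (ht : ∀ τ σ, c τ σ ∈ (extChartAt 𝓘(ℝ, E) x₀).target) (η : DiffForm E M V 1) {τ σ : ℝ} {w : E}
    (hw : HasDerivAt (fun τ => c τ σ) w τ) : η.planePart (chartPlane x₀ c) ![(1, 0)] τ σ =
      chartRep η.toFun x₀ (c τ σ) ![w] := by
  rw [planePart_chartPlane_one hc ht, (hc.hasDerivAt_uncurry_left τ σ).unique hw]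

theorem planePart_chartPlane_right_left (hc : ContDiff ℝ ∞ (Function.uncurry c))
    (ht : ∀ τ σ, c τ σ ∈ (extChartAt 𝓘(ℝ, E) x₀).target) (η : DiffForm E M V 2) {τ σ : ℝ} {w z : E}
    (hw : HasDerivAt (c τ) w σ) (hz : HasDerivAt (fun τ => c τ σ) z τ) :
    η.planePart (chartPlane x₀ c) ![(0, 1), (1, 0)] τ σ =
      chartRep η.toFun x₀ (c τ σ) ![w, z] := by
  rw [planePart_chartPlane_two hc ht, (hc.hasDerivAt_uncurry_right τ σ).unique hw,
    (hc.hasDerivAt_uncurry_left τ σ).unique hz]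

theorem planePart_chartPlane_left_right (hc : ContDiff ℝ ∞ (Function.uncurry c))
    (ht : ∀ τ σ, c τ σ ∈ (extChartAt 𝓘(ℝ, E) x₀).target) (η : DiffForm E M V 2) {τ σ : ℝ} {w z : E}
    (hw : HasDerivAt (c τ) w σ) (hz : HasDerivAt (fun τ => c τ σ) z τ) :
    η.planePart (chartPlane x₀ c) ![(1, 0), (0, 1)] τ σ =
      chartRep η.toFun x₀ (c τ σ) ![z, w] := by
  rw [planePart_chartPlane_two hc ht, (hc.hasDerivAt_uncurry_right τ σ).unique hw,
    (hc.hasDerivAt_uncurry_left τ σ).unique hz]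

end

/-! ### The obstruction to standard gauge transformations -/

/-- A point of `M`, two vectors in the chart at this point, and a scale at which all test paths stay
in the chart. -/
structure ProbeFrame (E M : Type*) [NormedAddCommGroup E] [NormedSpace ℝ E] [TopologicalSpace M]
    [ChartedSpace E M] where
  base : M
  r : ℝ
  u : E
  v : E
  r_pos : 0 < r
  mem : ∀ η μ τ σ, probe (extChartAt 𝓘(ℝ, E) base base) r u v η μ τ σ ∈
    (extChartAt 𝓘(ℝ, E) base).target

namespace ProbeFrame

section
variable {E M : Type*} [NormedAddCommGroup E] [NormedSpace ℝ E] [TopologicalSpace M]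
  [ChartedSpace E M] (p : ProbeFrame E M)

/-- The test paths in the chart. -/
def path (η μ τ σ : ℝ) : E := probe (extChartAt 𝓘(ℝ, E) p.base p.base) p.r p.u p.v η μ τ σ

/-- The velocities of the test paths in the chart. -/
def speed (η μ τ σ : ℝ) : E := probeSpeed p.r p.u p.v η μ τ σ

/-- The curve of test paths in `M`, run through with speed `T`. -/
def plane (η μ T : ℝ) : ℝ → ℝ → M := chartPlane p.base fun τ σ => p.path η μ (T * τ) σ

variable {p}

theorem contDiff_path (η μ T : ℝ) :
    ContDiff ℝ ∞ (Function.uncurry fun τ σ => p.path η μ (T * τ) σ) :=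
  contDiff_probe (F := ℝ × ℝ) contDiff_const contDiff_const (contDiff_const.mul contDiff_fst)
    contDiff_snd

theorem contDiff_path_initial (μ τ : ℝ) :
    ContDiff ℝ ∞ (Function.uncurry fun η σ => p.path η μ τ σ) :=
  contDiff_probe (F := ℝ × ℝ) contDiff_fst contDiff_const contDiff_const contDiff_snd

theorem contDiff_path_extent (τ : ℝ) :
    ContDiff ℝ ∞ (Function.uncurry fun μ σ => p.path 0 μ τ σ) :=
  contDiff_probe (F := ℝ × ℝ) contDiff_const contDiff_fst contDiff_const contDiff_snd

variable [IsManifold 𝓘(ℝ, E) ∞ M]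

theorem smoothPlane (η μ T : ℝ) : SmoothPlane E (p.plane η μ T) :=
  smoothPlane_chartPlane (contDiff_path η μ T) fun _ _ => p.mem _ _ _ _

theorem isPathSpaceCurve (η μ T : ℝ) :
    IsPathSpaceCurve E (p.plane η μ T 0 0) (p.plane η μ T 0 1) (p.plane η μ T) := by
  refine ⟨smoothPlane η μ T, fun τ _ => ⟨?_, ?_, ?_⟩⟩
  · show ContMDiff 𝓘(ℝ, ℝ) 𝓘(ℝ, E) ∞ fun σ =>
      (extChartAt 𝓘(ℝ, E) p.base).symm (p.path η μ (T * τ) σ)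
    exact (contMDiffOn_extChartAt_symm (n := ∞) p.base).comp_contMDiff (contDiff_probe
      contDiff_const contDiff_const contDiff_const contDiff_id).contMDiff fun _ => p.mem _ _ _ _
  · filter_upwards [Iio_mem_nhds (show (0 : ℝ) < 1 / 8 by norm_num)] with σ hσ
    show (extChartAt 𝓘(ℝ, E) p.base).symm (probe _ _ _ _ η μ (T * τ) σ) =
      (extChartAt 𝓘(ℝ, E) p.base).symm (probe _ _ _ _ η μ (T * 0) 0)
    rw [probe_of_le η μ _ (le_of_lt hσ), mul_zero]
  · filter_upwards [Ioi_mem_nhds (show (7 : ℝ) / 8 < 1 by norm_num)] with σ hσ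
    show (extChartAt 𝓘(ℝ, E) p.base).symm (probe _ _ _ _ η μ (T * τ) σ) =
      (extChartAt 𝓘(ℝ, E) p.base).symm (probe _ _ _ _ η μ (T * 0) 1)
    rw [probe_of_ge η μ _ (le_of_lt hσ), mul_zero]

end

/-! ### Holonomies and gauge variations along test paths -/

section
variable {E M g h : Type*} [NormedAddCommGroup E] [NormedSpace ℝ E] [TopologicalSpace M]
  [ChartedSpace E M] [FinDimLieAlgebra g] [FinDimLieAlgebra h]
  (p : ProbeFrame E M) (C : DifferentialCrossedModule g h)

/-- The components of a 1-form on the velocities of test paths. -/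
def along {V : Type*} [NormedAddCommGroup V] [NormedSpace ℝ V] (a : DiffForm E M V 1)
    (η μ τ σ : ℝ) : V :=
  chartRep a.toFun p.base (p.path η μ τ σ) ![p.speed η μ τ σ]

/-- The connection along test paths. -/
def conn (A : DiffForm E M g 1) (η μ τ σ : ℝ) : h →L[ℝ] h := C.dαCLM (p.along A η μ τ σ)

/-- The Chen integral of a 1-form along a test path. -/
def chen (A : DiffForm E M g 1) (a : DiffForm E M h 1) (η μ τ : ℝ) : h :=
  ∫ σ in (0 : ℝ)..1, pathExp (p.conn C A η μ τ) 1 σ (p.along a η μ τ σ)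

/-- The standard connection on the variation of a test path. -/
def connection (Q : OneTwoForm E M g h) (μ τ : ℝ) : h :=
  ∫ σ in (0 : ℝ)..1, pathExp (p.conn C Q.A 0 μ τ) 1 σ
    (chartRep Q.B.toFun p.base (p.path 0 μ τ σ)
      ![p.speed 0 μ τ σ, (p.r * Real.cos τ * stepBump σ) • p.v])

variable {p C} [IsManifold 𝓘(ℝ, E) ∞ M]

theorem planePart_plane {V : Type*} [NormedAddCommGroup V] [NormedSpace ℝ V]
    (a : DiffForm E M V 1) (η μ T τ σ : ℝ) :
    a.planePart (p.plane η μ T) ![(0, 1)] τ σ = p.along a η μ (T * τ) σ :=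
  planePart_chartPlane_right (contDiff_path η μ T) (fun _ _ => p.mem _ _ _ _) a
    (hasDerivAt_probe η μ (T * τ) σ)

theorem connEnd_plane (A : DiffForm E M g 1) (η μ T τ : ℝ) :
    connEnd C A (p.plane η μ T) (0, 1) τ = p.conn C A η μ (T * τ) :=
  funext fun σ => congrArg C.dαCLM (planePart_plane A η μ T τ σ)

theorem chenForm_plane (A : DiffForm E M g 1) (a : DiffForm E M h 1) (η μ T τ : ℝ) :
    (chenForm C A a (p.plane η μ T τ) fun i => i.elim0) = p.chen C A a η μ (T * τ) := by
  rw [chenForm_zero_eq (smoothPlane η μ T), chen]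
  simp only [connEnd_plane, planePart_plane]

/-- The right side does not contain `η`: the variation vector vanishes for small `σ`, and from
larger `σ` transport to the end never meets the initial segment. -/
theorem integral_connection_plane (Q : OneTwoForm E M g h) (η μ T τ : ℝ) :
    ∫ σ in (0 : ℝ)..1, pathExp (connEnd C Q.A (p.plane η μ T) (0, 1) τ) 1 σ
      (Q.B.planePart (p.plane η μ T) ![(0, 1), (1, 0)] τ σ) =
      T • p.connection C Q μ (T * τ) := by
  rw [connection, ← intervalIntegral.integral_smul]
  refine intervalIntegral.integral_congr fun σ hσ => ?_
  rw [uIcc_of_le zero_le_one] at hσ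
  have h1 : Q.B.planePart (p.plane η μ T) ![(0, 1), (1, 0)] τ σ =
      T • chartRep Q.B.toFun p.base (p.path η μ (T * τ) σ)
        ![p.speed η μ (T * τ) σ, (p.r * Real.cos (T * τ) * stepBump σ) • p.v] := by
    have h2 := planePart_chartPlane_right_left (contDiff_path (p := p) η μ T)
      (fun _ _ => p.mem _ _ _ _) Q.B (hasDerivAt_probe η μ (T * τ) σ)
      (hasDerivAt_probe_variation η μ T τ σ)
    have h3 := alternating_one_smul (chartRep Q.B.toFun p.base (p.path η μ (T * τ) σ)) 1 T
      (p.speed η μ (T * τ) σ) ((p.r * Real.cos (T * τ) * stepBump σ) • p.v)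
    rw [one_smul, one_mul] at h3
    exact h2.trans h3
  simp only [h1, connEnd_plane, map_smul]
  congr 1
  rcases le_or_gt σ (1 / 4) with hle | hgt
  · rw [stepBump_of_le (hle.trans (by norm_num)), mul_zero, zero_smul, alternating_two_zero_right,
      alternating_two_zero_right, map_zero, map_zero]
  · have h4 : ∀ z, 1 / 4 < z → p.path η μ (T * τ) z = p.path 0 μ (T * τ) z := fun z hz =>
      probe_of_lt hz
    have h5 : ∀ z, 1 / 4 < z → p.speed η μ (T * τ) z = p.speed 0 μ (T * τ) z := fun z hz =>
      probeSpeed_of_lt hz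
    rw [h4 σ hgt, h5 σ hgt, pathExp_congr (f' := p.conn C Q.A 0 μ (T * τ)) fun z hz => ?_]
    rw [uIoc_of_ge hσ.2] at hz
    rw [conn, along, h4 z (hgt.trans hz.1), h5 z (hgt.trans hz.1)]
    rfl

variable {R : Type*} [NormedRing R] [NormedAlgebra ℝ R] {ρ : FaithfulRep h R}

theorem holonomy_plane (Q : OneTwoForm E M g h) (η μ T : ℝ) :
    holonomy C ρ Q (p.plane η μ T) = pathExp (fun τ => ρ.toCLM (p.connection C Q μ τ)) 0 T := by
  rw [holonomy_eq (smoothPlane η μ T)]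
  refine Eq.trans ?_ (pathExp_scale (fun τ => ρ.toCLM (p.connection C Q μ τ)) T)
  simp only [integral_connection_plane, map_smul]

theorem gaugeTransformedHolonomy_plane (P : OneTwoForm E M g h) (a : DiffForm E M h 1)
    (η μ T ε : ℝ) : gaugeTransformedHolonomy C ρ P a (p.plane η μ T) ε =
      (1 - ε • ρ.toCLM (p.chen C P.A a η μ 0)) *
        pathExp (fun τ => ρ.toCLM (p.connection C P μ τ)) 0 T *
        (1 + ε • ρ.toCLM (p.chen C P.A a η μ T)) := by
  rw [gaugeTransformedHolonomy, holonomy_plane, chenForm_plane, chenForm_plane, mul_zero, mul_one]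
  rfl

/-- The first order gauge variation does not depend on the initial segment of the paths if the
transformed holonomy is the holonomy of a standard connection. -/
theorem gauge_variation_eq {P : OneTwoForm E M g h} {a : DiffForm E M h 1}
    (H : YieldsSomeStandardConnection C ρ P a) (η μ T : ℝ) :
    pathExp (fun τ => ρ.toCLM (p.connection C P μ τ)) 0 T * ρ.toCLM (p.chen C P.A a η μ T) -
      ρ.toCLM (p.chen C P.A a η μ 0) * pathExp (fun τ => ρ.toCLM (p.connection C P μ τ)) 0 T =
    pathExp (fun τ => ρ.toCLM (p.connection C P μ τ)) 0 T * ρ.toCLM (p.chen C P.A a 0 μ T) -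
      ρ.toCLM (p.chen C P.A a 0 μ 0) * pathExp (fun τ => ρ.toCLM (p.connection C P μ τ)) 0 T := by
  obtain ⟨Q, hQ⟩ := H
  refine eq_of_gauge_isLittleO ?_
  -- The unknown holonomy of `Q ε` is the same for `η` and for `0`, so it cancels without anything
  -- being known about `Q`.
  refine ((hQ _ _ _ (isPathSpaceCurve (p := p) η μ T)).sub
    (hQ _ _ _ (isPathSpaceCurve (p := p) 0 μ T))).congr_left fun ε => ?_
  rw [gaugeTransformedHolonomy_plane, gaugeTransformedHolonomy_plane, holonomy_plane,
    holonomy_plane, sub_sub_sub_cancel_right]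

/-- At `η = 0` the plane swept out is degenerate everywhere, so no 2-form contributes; only the
boundary term at the initial point survives, and its sign is reversed by `initialStep 0 = -1`. -/
theorem hasDerivAt_chen_initial (A : DiffForm E M g 1) (a : DiffForm E M h 1) (μ τ : ℝ) :
    HasDerivAt (fun η => p.chen C A a η μ τ) (p.r • pathExp (p.conn C A 0 μ τ) 1 0
      (chartRep a.toFun p.base (extChartAt 𝓘(ℝ, E) p.base p.base) ![p.u])) 0 := by
  set c : ℝ → ℝ → E := fun η σ => p.path η μ τ σ with hcdef
  have hc : ContDiff ℝ ∞ (Function.uncurry c) := contDiff_path_initial μ τ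
  have ht : ∀ η σ, c η σ ∈ (extChartAt 𝓘(ℝ, E) p.base).target := fun _ _ => p.mem _ _ _ _
  have hS : SmoothPlane E (chartPlane p.base c) := smoothPlane_chartPlane hc ht
  have hσ : ∀ η σ, HasDerivAt (c η) (p.speed η μ τ σ) σ := fun η σ => hasDerivAt_probe η μ τ σ
  have hη : ∀ η σ, HasDerivAt (fun η => c η σ) ((p.r * Real.cos η * initialStep σ) • p.u) η :=
    fun η σ => hasDerivAt_probe_initial η μ τ σ
  have h1 : ∀ η, connEnd C A (chartPlane p.base c) (0, 1) η = p.conn C A η μ τ := fun η =>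
    funext fun σ => congrArg C.dαCLM (planePart_chartPlane_right hc ht A (hσ η σ))
  have h2 : ∀ η σ, a.planePart (chartPlane p.base c) ![(0, 1)] η σ = p.along a η μ τ σ :=
    fun η σ => planePart_chartPlane_right hc ht a (hσ η σ)
  have h3 : A.planePart (chartPlane p.base c) ![(1, 0)] 0 1 = 0 := by
    rw [planePart_chartPlane_left hc ht A (hη 0 1), initialStep_of_ge (by norm_num), mul_zero,
      zero_smul, alternating_one_zero]
  have h3' : a.planePart (chartPlane p.base c) ![(1, 0)] 0 1 = 0 := by
    rw [planePart_chartPlane_left hc ht a (hη 0 1), initialStep_of_ge (by norm_num), mul_zero,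
      zero_smul, alternating_one_zero]
  -- Before `5 / 8` the path is at rest, and from `1 / 4` on it does not move with `η`.
  have h7 : ∀ σ, p.speed 0 μ τ σ = 0 ∨ (p.r * Real.cos 0 * initialStep σ) • p.u = 0 := fun σ => by
    rcases lt_or_ge σ (5 / 8) with hlt | hge
    · exact Or.inl (probeSpeed_zero_of_lt hlt)
    · rw [initialStep_of_ge ((by norm_num : (1 : ℝ) / 4 ≤ 5 / 8).trans hge), mul_zero, zero_smul]
      exact Or.inr rfl
  have h4 : ∀ σ, (curvature A).planePart (chartPlane p.base c) ![(1, 0), (0, 1)] 0 σ = 0 := by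
    intro σ
    rw [planePart_chartPlane_left_right hc ht _ (hσ 0 σ) (hη 0 σ)]
    rcases h7 σ with h | h <;> rw [h]
    exacts [alternating_two_zero_right _ _, alternating_two_zero_left _ _]
  have h4' : ∀ σ, (covDeriv C A a).planePart (chartPlane p.base c) ![(1, 0), (0, 1)] 0 σ = 0 := by
    intro σ
    rw [planePart_chartPlane_left_right hc ht _ (hσ 0 σ) (hη 0 σ)]
    rcases h7 σ with h | h <;> rw [h]
    exacts [alternating_two_zero_right _ _, alternating_two_zero_left _ _]
  have h5 : a.planePart (chartPlane p.base c) ![(1, 0)] 0 0 =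
      -(p.r • chartRep a.toFun p.base (extChartAt 𝓘(ℝ, E) p.base p.base) ![p.u]) := by
    have h6 : c 0 0 = extChartAt 𝓘(ℝ, E) p.base p.base := probe_zero_zero μ τ
    rw [planePart_chartPlane_left hc ht a (hη 0 0), h6, initialStep_of_le (by norm_num),
      oneForm_smul, Real.cos_zero, mul_one, mul_neg_one, neg_smul]
  have hcurv : curvEnd C A (chartPlane p.base c) 0 = fun _ => 0 := funext fun σ => by
    rw [curvEnd, h4, map_zero]
  have key := hasDerivAt_chenForm_zero (C := C) (A := A) hS a (τ := 0)
    (by rw [connEnd, h3, map_zero]) h3'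
  simp only [h1, h2, h4', hcurv] at key
  refine key.congr_deriv ?_
  rw [h5]
  simp [pathExpDeriv]

/-- The `η`-derivative at `0` of `gauge_variation_eq`, whose right side is constant in `η`. -/
theorem pathExp_transport_eq {P : OneTwoForm E M g h} {a : DiffForm E M h 1}
    (H : YieldsSomeStandardConnection C ρ P a) (μ T : ℝ) :
    pathExp (fun τ => ρ.toCLM (p.connection C P μ τ)) 0 T *
        ρ.toCLM (pathExp (p.conn C P.A 0 μ T) 1 0
          (chartRep a.toFun p.base (extChartAt 𝓘(ℝ, E) p.base p.base) ![p.u])) =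
      ρ.toCLM (pathExp (p.conn C P.A 0 μ 0) 1 0
          (chartRep a.toFun p.base (extChartAt 𝓘(ℝ, E) p.base p.base) ![p.u])) *
        pathExp (fun τ => ρ.toCLM (p.connection C P μ τ)) 0 T := by
  set W := pathExp (fun τ => ρ.toCLM (p.connection C P μ τ)) 0 T with hW
  have hd : ∀ τ, HasDerivAt (fun η => ρ.toCLM (p.chen C P.A a η μ τ)) _ 0 := fun τ =>
    ρ.toCLM.hasFDerivAt.comp_hasDerivAt 0 (hasDerivAt_chen_initial (p := p) (C := C) P.A a μ τ)
  have h1 := ((hd T).const_mul W).sub ((hd 0).mul_const W)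
  have h2 := h1.unique ((hasDerivAt_const (0 : ℝ) _).congr_of_eventuallyEq
    (Eventually.of_forall fun η => gauge_variation_eq (p := p) H η μ T))
  rw [map_smul, map_smul, mul_smul_comm, smul_mul_assoc, ← smul_sub] at h2
  exact sub_eq_zero.1 ((smul_eq_zero.1 h2).resolve_left p.r_pos.ne')

end

end ProbeFrame

theorem pathExpDeriv_smul {R : Type*} [NormedRing R] [NormedAlgebra ℝ R] (k : ℝ) (f φ : ℝ → R)
    (c x : ℝ) : pathExpDeriv f (fun y => k • φ y) c x = k • pathExpDeriv f φ c x := by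
  simp only [pathExpDeriv, mul_smul_comm, smul_mul_assoc, intervalIntegral.integral_smul]

theorem pathExpDeriv_sub {R : Type*} [NormedRing R] [NormedAlgebra ℝ R] [CompleteSpace R]
    {f φ ψ : ℝ → R} (hf : Continuous f) (hφ : Continuous φ) (hψ : Continuous ψ) (c x : ℝ) :
    pathExpDeriv f (fun y => φ y - ψ y) c x = pathExpDeriv f φ c x - pathExpDeriv f ψ c x := by
  have hi : ∀ {χ : ℝ → R}, Continuous χ → IntervalIntegrable
      (fun y => pathExp f c y * χ y * pathExp f y c) MeasureTheory.volume c x := fun hχ =>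
    (((continuous_pathExp hf c).mul hχ).mul (continuous_pathExp_left hf c)).intervalIntegrable _ _
  simp only [pathExpDeriv, mul_sub, sub_mul]
  rw [intervalIntegral.integral_sub (hi hφ) (hi hψ), sub_mul]

theorem chartRep_self {E M V : Type*} [NormedAddCommGroup E] [NormedSpace ℝ E]
    [TopologicalSpace M] [ChartedSpace E M] [NormedAddCommGroup V] [NormedSpace ℝ V] {k : ℕ}
    [IsManifold 𝓘(ℝ, E) ∞ M] (η : ∀ x : M, TangentSpace 𝓘(ℝ, E) x [⋀^Fin k]→L[ℝ] V) (x : M)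
    (w : Fin k → E) : chartRep η x (extChartAt 𝓘(ℝ, E) x x) w = η x w := by
  let ηE : M → E [⋀^Fin k]→L[ℝ] V := η
  have : IsManifold 𝓘(ℝ, E) 1 M := IsManifold.of_le (n := ∞) (by simp)
  have h1 : (mfderiv 𝓘(ℝ, E) 𝓘(ℝ, E) (extChartAt 𝓘(ℝ, E) x).symm (extChartAt 𝓘(ℝ, E) x x) :
      E →L[ℝ] E) = ContinuousLinearMap.id ℝ E := by
    have h2 := mfderivWithin_range_extChartAt_symm (I := 𝓘(ℝ, E)) (x := x)
    simp only [modelWithCornersSelf_coe, range_id, mfderivWithin_univ] at h2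
    exact h2
  show (ηE ((extChartAt 𝓘(ℝ, E) x).symm (extChartAt 𝓘(ℝ, E) x x))).compContinuousLinearMap
    (mfderiv 𝓘(ℝ, E) 𝓘(ℝ, E) (extChartAt 𝓘(ℝ, E) x).symm (extChartAt 𝓘(ℝ, E) x x) :
      E →L[ℝ] E) w = ηE x w
  rw [h1, extChartAt_to_inv]
  rfl

/-! ### Localizing the obstruction to the fake curvature at one point -/

namespace ProbeFrame

variable {E M g h : Type*} [NormedAddCommGroup E] [NormedSpace ℝ E] [TopologicalSpace M]
  [ChartedSpace E M] [FinDimLieAlgebra g] [FinDimLieAlgebra h]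
  {p : ProbeFrame E M} {C : DifferentialCrossedModule g h}

/-- The action of the curvature of a 2-form on the frame, along test paths. -/
def frameEnd (p : ProbeFrame E M) (C : DifferentialCrossedModule g h) (F : DiffForm E M g 2)
    (μ σ : ℝ) : h →L[ℝ] h :=
  (stepBump σ * deriv finalStep σ) • C.dαCLM (chartRep F.toFun p.base (p.path 0 μ 0 σ) ![p.v, p.u])

theorem continuous_frameEnd (F : DiffForm E M g 2) :
    Continuous (Function.uncurry (p.frameEnd C F)) := by
  have h1 : Continuous fun z : ℝ × ℝ => chartRep F.toFun p.base (p.path 0 z.1 0 z.2) :=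
    (F.smooth p.base).continuousOn.comp_continuous (contDiff_path_extent (p := p) 0).continuous
      fun _ => p.mem _ _ _ _
  have h2 : Continuous fun z : ℝ × ℝ =>
      chartRep F.toFun p.base (p.path 0 z.1 0 z.2) ![p.v, p.u] :=
    (ContinuousAlternatingMap.apply ℝ E g ![p.v, p.u]).continuous.comp h1
  exact (((contDiff_stepBump.continuous.mul (contDiff_finalStep.continuous_deriv (by simp))).comp
    continuous_snd)).smul (C.dαCLM.continuous.comp h2)

variable [IsManifold 𝓘(ℝ, E) ∞ M]

theorem continuous_connection (P : OneTwoForm E M g h) (μ : ℝ) :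
    Continuous (p.connection C P μ) := by
  have h1 := continuous_integral_transport (C := C) (smoothPlane (p := p) 0 μ 1) P.A P.B
    ![(0, 1), (1, 0)]
  simpa only [integral_connection_plane, one_smul, one_mul] using h1

theorem connEnd_plane_left {A : DiffForm E M g 1} {μ τ σ : ℝ} (hσ : stepBump σ = 0) :
    connEnd C A (p.plane 0 μ 1) (1, 0) τ σ = 0 := by
  rw [connEnd, plane, planePart_chartPlane_left (contDiff_path 0 μ 1) (fun _ _ => p.mem _ _ _ _) A
    (hasDerivAt_probe_variation 0 μ 1 τ σ), hσ, mul_zero, zero_smul, smul_zero,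
    alternating_one_zero, map_zero]

theorem hasDerivAt_pathExp_conn (A : DiffForm E M g 1) (μ : ℝ) :
    HasDerivAt (fun τ => pathExp (p.conn C A 0 μ τ) 1 0)
      (pathExpDeriv (p.conn C A 0 μ 0) (curvEnd C A (p.plane 0 μ 1) 0) 1 0) 0 := by
  have h1 := hasDerivAt_transport (C := C) (A := A) (smoothPlane (p := p) 0 μ 1) (τ := 0) (σ := 0)
    (by simp) (connEnd_plane_left (stepBump_of_ge (by norm_num)))
  simpa only [connEnd_plane, one_mul, connEnd_plane_left (stepBump_of_le (σ := 0) (by norm_num)),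
    mul_zero, zero_add] using h1

/-- The derivative of `pathExp_transport_eq` at the trivial variation. -/
theorem pathExpDeriv_curvEnd_eq {R : Type*} [NormedRing R] [NormedAlgebra ℝ R] [CompleteSpace R]
    {ρ : FaithfulRep h R} {P : OneTwoForm E M g h} {a : DiffForm E M h 1}
    (H : YieldsSomeStandardConnection C ρ P a) (μ : ℝ) :
    pathExpDeriv (p.conn C P.A 0 μ 0) (curvEnd C P.A (p.plane 0 μ 1) 0) 1 0
        (chartRep a.toFun p.base (extChartAt 𝓘(ℝ, E) p.base p.base) ![p.u]) =
      -⁅p.connection C P μ 0, pathExp (p.conn C P.A 0 μ 0) 1 0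
        (chartRep a.toFun p.base (extChartAt 𝓘(ℝ, E) p.base p.base) ![p.u])⁆ := by
  set ζ := chartRep a.toFun p.base (extChartAt 𝓘(ℝ, E) p.base p.base) ![p.u] with hζ
  have hW := hasDerivAt_pathExp (ρ.toCLM.continuous.comp (continuous_connection (p := p) (C := C)
    P μ)) 0 0
  have hU := ρ.toCLM.hasFDerivAt.comp_hasDerivAt 0
    ((hasDerivAt_pathExp_conn (p := p) (C := C) P.A μ).clm_apply (hasDerivAt_const 0 ζ))
  have h1 := (hW.mul hU).unique ((hW.const_mul (ρ.toCLM (pathExp (p.conn C P.A 0 μ 0) 1 0 ζ))).congr_of_eventuallyEq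
    (Eventually.of_forall fun T => pathExp_transport_eq (p := p) H μ T))
  simp only [pathExp_self, one_mul, map_zero, add_zero, Function.comp_apply] at h1
  refine ρ.injective ?_
  show ρ.toCLM _ = ρ.toCLM _
  rw [map_neg, ← sub_eq_zero, sub_neg_eq_add]
  have h2 : ρ.toCLM ⁅p.connection C P μ 0, pathExp (p.conn C P.A 0 μ 0) 1 0 ζ⁆ = _ :=
    ρ.map_lie _ _
  rw [h2]
  simp only [← FaithfulRep.toCLM_apply]
  rw [← h1]
  abel

/-- The `B`-part of the fake curvature acts by brackets, so by `pathExpDeriv_bracket` its variation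
term cancels the commutator with the connection in `pathExpDeriv_curvEnd_eq`. -/
theorem pathExpDeriv_fakeCurvature {R : Type*} [NormedRing R] [NormedAlgebra ℝ R] [CompleteSpace R]
    {ρ : FaithfulRep h R} {P : OneTwoForm E M g h} {a : DiffForm E M h 1}
    (H : YieldsSomeStandardConnection C ρ P a) (μ : ℝ) :
    pathExpDeriv (p.conn C P.A 0 μ 0) (fun σ => C.dαCLM ((fakeCurvature C P).planePart
        (p.plane 0 μ 1) ![(1, 0), (0, 1)] 0 σ)) 1 0
      (chartRep a.toFun p.base (extChartAt 𝓘(ℝ, E) p.base p.base) ![p.u]) = 0 := by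
  have hS := smoothPlane (p := p) 0 μ 1
  have hb := continuous_planePart_right hS P.B ![(0, 1), (1, 0)] 0
  have hf : connEnd C P.A (p.plane 0 μ 1) (0, 1) 0 = p.conn C P.A 0 μ 0 := by
    rw [connEnd_plane, mul_zero]
  have hfc : Continuous (p.conn C P.A 0 μ 0) := hf ▸ continuous_connEnd hS (0, 1) 0
  have h1 := integral_connection_plane (C := C) P (p := p) 0 μ 1 0
  rw [hf, one_smul, mul_zero] at h1
  have hbr : Continuous fun σ => bracketCLM h (P.B.planePart (p.plane 0 μ 1) ![(0, 1), (1, 0)] 0 σ) :=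
    (bracketCLM h).continuous.comp hb
  simp only [dαCLM_fakeCurvature]
  rw [pathExpDeriv_sub hfc (continuous_curvEnd hS 0) hbr,
    pathExpDeriv_bracket hfc (hf ▸ connEnd_derivation (C := C) (A := P.A) (0, 1) 0) hb,
    intervalIntegral.integral_symm, h1, sub_apply, pathExpDeriv_curvEnd_eq H, mul_apply_eq_comp,
    DifferentialCrossedModule.bracketCLM_apply, neg_lie, sub_self]

/-- The vanishing factor `sin μ` is isolated, so that it can be divided out before the path shrinks
to a point. -/
theorem dαCLM_planePart_plane (F : DiffForm E M g 2) (μ σ : ℝ) :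
    C.dαCLM (F.planePart (p.plane 0 μ 1) ![(1, 0), (0, 1)] 0 σ) =
      (p.r ^ 2 * Real.sin μ) • p.frameEnd C F μ σ := by
  have h1 := planePart_chartPlane_left_right (contDiff_path (p := p) 0 μ 1)
    (fun _ _ => p.mem _ _ _ _) F (hasDerivAt_probe 0 μ (1 * 0) σ)
    (hasDerivAt_probe_variation 0 μ 1 0 σ)
  have h2 : probeSpeed p.r p.u p.v 0 μ (1 * 0) σ =
      (p.r * (Real.sin μ * deriv finalStep σ)) • p.u := by
    simp [probeSpeed, smul_smul]
  rw [plane, h1, h2, one_smul, alternating_one_smul, map_smul, frameEnd, smul_smul]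
  simp only [mul_zero, Real.cos_zero]
  congr 1
  ring

theorem continuous_uncurry_conn (A : DiffForm E M g 1) :
    Continuous (Function.uncurry fun μ σ => p.conn C A 0 μ 0 σ) := by
  have hc := contDiff_path_extent (p := p) 0
  have ht : ∀ μ σ, p.path 0 μ 0 σ ∈ (extChartAt 𝓘(ℝ, E) p.base).target := fun _ _ => p.mem _ _ _ _
  have h1 := continuous_uncurry_connEnd (C := C) (A := A) (smoothPlane_chartPlane hc ht) (0, 1)
  refine h1.congr fun z => congrArg C.dαCLM ?_
  exact planePart_chartPlane_right hc ht A (hasDerivAt_probe 0 z.1 0 z.2)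

theorem dα_fakeCurvature_eq_zero {R : Type*} [NormedRing R] [NormedAlgebra ℝ R] [CompleteSpace R]
    {ρ : FaithfulRep h R} {P : OneTwoForm E M g h} {a : DiffForm E M h 1}
    (H : YieldsSomeStandardConnection C ρ P a) :
    C.dαCLM (chartRep (fakeCurvature C P).toFun p.base (extChartAt 𝓘(ℝ, E) p.base p.base)
        ![p.v, p.u])
      (chartRep a.toFun p.base (extChartAt 𝓘(ℝ, E) p.base p.base) ![p.u]) = 0 := by
  set ζ := chartRep a.toFun p.base (extChartAt 𝓘(ℝ, E) p.base p.base) ![p.u] with hζ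
  set F := fakeCurvature C P with hF
  have hcont : Continuous fun μ => pathExpDeriv (p.conn C P.A 0 μ 0) (p.frameEnd C F μ) 1 0 ζ :=
    ((continuous_uncurry_pathExpDeriv (continuous_uncurry_conn (p := p) P.A)
      (continuous_frameEnd F) 1).comp (continuous_id.prodMk continuous_const)).clm_apply
        continuous_const
  -- At `μ = 0` itself the identity is void; it is divided by `r ^ 2 * sin μ` for small `μ ≠ 0` and
  -- extended by continuity.
  have hzero : ∀ᶠ μ in 𝓝[≠] (0 : ℝ),
      pathExpDeriv (p.conn C P.A 0 μ 0) (p.frameEnd C F μ) 1 0 ζ = 0 := by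
    filter_upwards [self_mem_nhdsWithin,
      nhdsWithin_le_nhds (Ioo_mem_nhds (neg_lt_zero.2 Real.pi_pos) Real.pi_pos)] with μ h0 hμ
    have hs : Real.sin μ ≠ 0 := fun h => h0 ((Real.sin_eq_zero_iff_of_lt_of_lt hμ.1 hμ.2).1 h)
    have h1 := pathExpDeriv_fakeCurvature (p := p) H μ
    simp only [dαCLM_planePart_plane] at h1
    rw [pathExpDeriv_smul, smul_apply] at h1
    exact (smul_eq_zero.1 h1).resolve_left (mul_ne_zero (pow_ne_zero 2 p.r_pos.ne') hs)
  have h0 : pathExpDeriv (p.conn C P.A 0 0 0) (p.frameEnd C F 0) 1 0 ζ = 0 :=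
    tendsto_nhds_unique ((hcont.tendsto 0).mono_left nhdsWithin_le_nhds)
      (tendsto_const_nhds.congr' (hzero.mono fun _ h => h.symm))
  -- At `μ = 0` the path is constant: transport is trivial and the remaining integral is a nonzero
  -- number times the action of the fake curvature at the base point.
  have hpath : ∀ σ, p.path 0 0 0 σ = extChartAt 𝓘(ℝ, E) p.base p.base := fun σ => by
    simp [path, probe]
  have hconn : p.conn C P.A 0 0 0 = fun _ => 0 := funext fun σ => by
    have h1 : p.speed 0 0 0 σ = 0 := by simp [speed, probeSpeed]
    rw [conn, along, h1, alternating_one_zero, map_zero]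
  have hframe : p.frameEnd C F 0 = fun σ => (stepBump σ * deriv finalStep σ) •
      C.dαCLM (chartRep F.toFun p.base (extChartAt 𝓘(ℝ, E) p.base p.base) ![p.v, p.u]) :=
    funext fun σ => by rw [frameEnd, hpath]
  rw [hconn, hframe, pathExpDeriv] at h0
  simp only [pathExp_zero, one_mul, mul_one] at h0
  rw [intervalIntegral.integral_smul_const, integral_stepBump_mul_deriv, smul_apply] at h0
  exact (smul_eq_zero.1 h0).resolve_left (by norm_num)

end ProbeFrame

/-! ### Existence of an obstructing form, and the notions of flatness -/

section
variable {E M g h R : Type*} [NormedAddCommGroup E] [NormedSpace ℝ E] [TopologicalSpace M]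
  [ChartedSpace E M] [FinDimLieAlgebra g] [FinDimLieAlgebra h] [NormedRing R] [NormedAlgebra ℝ R]
  {C : DifferentialCrossedModule g h} {P : OneTwoForm E M g h} [IsManifold 𝓘(ℝ, E) ∞ M]

theorem exists_not_yieldsSomeStandardConnection [FiniteDimensional ℝ E] [T2Space M]
    [CompleteSpace R] (ρ : FaithfulRep h R) (hP : ¬ FakeCurvatureActsTrivially C P) :
    ∃ a : DiffForm E M h 1, ¬ YieldsSomeStandardConnection C ρ P a := by
  simp only [FakeCurvatureActsTrivially, not_forall] at hP
  obtain ⟨x, w, hw⟩ := hP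
  have hex : ∃ ζ, C.dα ((fakeCurvature C P).toFun x w) ζ ≠ 0 := by
    by_contra! hall
    exact hw (LieDerivation.ext hall)
  obtain ⟨ζ, hζ⟩ := hex
  let v : E := w 0
  -- The second vector becomes the direction of the path, on which `a` is prescribed; it is nonzero
  -- since otherwise the fake curvature would vanish on `w`.
  let u : E := w 1
  have hvu : chartRep (fakeCurvature C P).toFun x (extChartAt 𝓘(ℝ, E) x x) ![v, u] =
      (fakeCurvature C P).toFun x w := by
    rw [chartRep_self]
    congr 1
    ext i
    fin_cases i <;> rfl
  have hu : u ≠ 0 := fun h0 => hζ (by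
    rw [← hvu, h0, alternating_two_zero_right, map_zero, LieDerivation.coe_zero, Pi.zero_apply])
  obtain ⟨a, ha⟩ := exists_diffForm_chartRep_eq x hu ζ
  obtain ⟨r, hr, hmem⟩ := exists_probe_mem (extChartAt_target_mem_nhds (I := 𝓘(ℝ, E)) x) u v
  refine ⟨a, fun H => hζ ?_⟩
  have h1 := ProbeFrame.dα_fakeCurvature_eq_zero (p := ⟨x, r, u, v, hr, hmem⟩) H
  simp only [ha, hvu] at h1
  exact h1

theorem YieldsTransformedConnection.yieldsSomeStandardConnection {ρ : FaithfulRep h R}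
    {a : DiffForm E M h 1} (H : YieldsTransformedConnection C ρ P a) :
    YieldsSomeStandardConnection C ρ P a := by
  refine ⟨fun ε => P.transform C a ε, fun s t S hS => ?_⟩
  have h1 : (fun ε : ℝ => ε ^ 2) =o[𝓝[≠] 0] fun ε : ℝ => ε := by
    simpa using ((isLittleO_pow_pow (𝕜 := ℝ) one_lt_two).mono nhdsWithin_le_nhds)
  exact ((H s t S hS).mono nhdsWithin_le_nhds).trans_isLittleO h1

theorem StrictlyRFlat.fakeCurvatureActsTrivially (hP : StrictlyRFlat C P) :
    FakeCurvatureActsTrivially C P := fun x v => by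
  rw [hP x]
  exact map_zero C.dα

theorem FakeCurvatureActsTrivially.strictlyRFlat (hP : FakeCurvatureActsTrivially C P)
    (hC : Function.Injective C.dα) : StrictlyRFlat C P := fun x =>
  ContinuousAlternatingMap.ext fun v => hC ((hP x v).trans (map_zero C.dα).symm)

end

end

theorem mainTheorem8 {E M g h R : Type*} [NormedAddCommGroup E] [NormedSpace ℝ E]
    [FiniteDimensional ℝ E] [TopologicalSpace M] [T2Space M] [ChartedSpace E M]
    [IsManifold 𝓘(ℝ, E) ∞ M] [FinDimLieAlgebra g] [FinDimLieAlgebra h] [NormedRing R]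
    [NormedAlgebra ℝ R] [CompleteSpace R] (C : DifferentialCrossedModule g h)
    (ρ : FaithfulRep h R) (P : OneTwoForm E M g h) :
    (StrictlyRFlat C P → ∀ a : DiffForm E M h 1, YieldsTransformedConnection C ρ P a) ∧
    ((∀ a : DiffForm E M h 1, YieldsTransformedConnection C ρ P a) ↔
      FakeCurvatureActsTrivially C P) ∧
    (¬ FakeCurvatureActsTrivially C P →
      ∃ a : DiffForm E M h 1, ¬ YieldsSomeStandardConnection C ρ P a) ∧
    (Function.Injective C.dα →
      ((∀ a : DiffForm E M h 1, YieldsTransformedConnection C ρ P a) ↔ StrictlyRFlat C P) ∧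
      (¬ StrictlyRFlat C P →
        ∃ a : DiffForm E M h 1, ¬ YieldsSomeStandardConnection C ρ P a)) := by
  have h2 : (∀ a : DiffForm E M h 1, YieldsTransformedConnection C ρ P a) ↔
      FakeCurvatureActsTrivially C P := by
    refine ⟨fun H => ?_, fun hP a => hP.yieldsTransformedConnection ρ a⟩
    by_contra hP
    obtain ⟨a, ha⟩ := exists_not_yieldsSomeStandardConnection ρ hP
    exact ha (H a).yieldsSomeStandardConnection
  have h4 (hC : Function.Injective C.dα) : FakeCurvatureActsTrivially C P ↔ StrictlyRFlat C P :=
    ⟨fun hP => hP.strictlyRFlat hC, StrictlyRFlat.fakeCurvatureActsTrivially⟩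
  exact ⟨fun hP => h2.2 hP.fakeCurvatureActsTrivially, h2,
    exists_not_yieldsSomeStandardConnection ρ, fun hC => ⟨h2.trans (h4 hC), fun hP =>
      exists_not_yieldsSomeStandardConnection ρ fun h => hP ((h4 hC).1 h)⟩⟩
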